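/- **Setting.** Let $n\ge 1$. All vectors carry the Euclidean norm and all matrices the induced norm. $\nabla$ denotes the derivative in the first argument (a row vector for scalar functions); $\mathcal K$ is the set of continuous strictly increasing $\alpha:[0,\infty)\to[0,\infty)$ with $\alpha(0)=0$. *Plant and safe set.* $\dot x=f(x)+g(x)u$ with $f:\mathbb R^n\to\mathbb R^n$, $g:\mathbb R^n\to\mathbb R^{n\times m}$ locally Lipschitz, $f(0)=0$; $\mathcal C=\{h\ge 0\}$, $\partial\mathcal C=\{h=0\}$, $\mathrm{Int}(\mathcal C)=\{h>0\}\ni 0$ with $h\in C^1$; $b:\mathrm{Int}(\mathcal C)\to\mathbb R_{\ge0}$ is $C^1$ with $1/\alpha_1(h)\le b\le 1/\alpha_2(h)$ for some $\alpha_1,\alpha_2\in\mathcal K$; $B(x)=(b(x)-b(0))^2$. Say that $F$ has *admissible growth* if $F(x)\le \ell(\|x\|)\|x\|$ on $\mathcal C$ for some positive non-decreasing $\ell$ such that $\ell(\|x\|)\|x\|$ stays bounded as $x$ tends to any point of $\partial\mathcal C$. *Assumption 1.* $\|f\|$ has admissible growth; $\|g(x)\|\ge\underline g>0$ on $\mathcal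 C$; on $\mathrm{Int}(\mathcal C)\cap\mathcal N$, for some neighbourhood $\mathcal N\not\ni0$ of $\partial\mathcal C$, $\nabla b\,g\ne0$. *Assumption 2.* With $r(x,u)=x^TQx+u^TRu$, $Q,R$ symmetric positive definite, there is a $C^1$ positive definite $V^*$ with $\nabla V^*$ locally Lipschitz and $0=\inf_u\{\nabla V^*f+\nabla V^*gu+r(x,u)\}$ for all $x\in\mathbb R^n$. *Approximation.* $\chi\ni0$ is compact, $l>0$, $B_l(x)$ is the closed $l$-ball about $x$; $W:\chi\to\mathbb R^L$ is $C^1$ (near $\chi$); $\phi(y,c(x))=(\phi_j(y,c_j(x)))_{j\le L}$ with $\phi_j$ smooth (near $\chi\times\chi$) positive (semi)definite kernels and $c_j(x)\in\chi\cap B_l(x)$; $x_i(x,t)\in\chi\cap B_l(x)$ for $x\in\chi$, $t\ge0$, $1\le i\le N$; $Y:\mathbb R^n\to\mathbb R^{n\times p}$ is continuous, $\theta\in\mathbb R^p$, $\varepsilon_\theta=f-Y\theta$. Moreover $\|g(x)^T\nabla\phi(x,c(x))^T\|$ has admissible growth. Write $G_R=gR^{-1}g^T$ and $G_\phi=\nabla\phi\,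 G_R\nabla\phi^T$. *Closed loop.* The gains $c_b,k_{c1},k_{c2},k_{a1},k_{a2},\gamma_c,\beta_c$ are positive. With $\hat k(y,x,w)=-\frac12R^{-1}g(y)^T\nabla\phi(y,c(x))^Tw$ let $u=\hat k(x,x,\hat W_a)-\frac{c_b}2R^{-1}g(x)^T\nabla B(x)^T$, $\omega=\nabla\phi(x,c(x))(Y(x)\hat\theta+g(x)u)$, $\rho=1+\gamma_c\omega^T\omega$, $\Lambda=\omega\omega^T/\rho^2$, $\delta_t=r(x,u)+\hat W_c^T\omega$; and let $\omega_i,\rho_i,\Lambda_i,\delta_i,G_{\phi,i}$ be the same expressions with $\nabla\phi,Y,g,r$ evaluated at $x_i=x_i(x,t)$ (centres $c(x)$) and $u$ replaced by $\hat k(x_i,x,\hat W_a)$. A solution on $[t_0,\tau)$, $t_0\ge 0$, $\tau\le\infty$, consists of continuous signals $x,\hat W_c,\Gamma,\hat W_a,\hat\theta$ which, except at locally finitely many times and as long as $x\in\mathrm{Int}(\mathcal C)$, satisfy $\dot x=f+gu$, $$\dot{\hat W}_c=-\Gamma\Big(k_{c1}\tfrac{\omega}{\rho^2}\delta_t+\tfrac{k_{c2}}N\sum_i\tfrac{\omega_i}{\rho_i^2}\delta_i\Big),\qquad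 \dot\Gamma=\beta_c\Gamma-\Gamma\Big(k_{c1}\Lambda+\tfrac{k_{c2}}N\sum_i\Lambda_i\Big)\Gamma,$$ $$\dot{\hat W}_a=\mathrm{proj}\Big\{-k_{a1}(\hat W_a-\hat W_c)-k_{a2}\hat W_a+\tfrac{k_{c1}}{4\rho^2}G_\phi^T\hat W_a\omega^T\hat W_c+\sum_i\tfrac{k_{c2}}{4N\rho_i^2}G_{\phi,i}^T\hat W_a\omega_i^T\hat W_c\Big\}$$ and an identifier law $\dot{\hat\theta}=\psi(\hat\theta,t)$; $\Gamma(t_0)$ is symmetric positive definite. Here $\mathrm{proj}$ is the standard smooth projection for $\Pi=\{\mathcal P\le0\}$ with boundary layer $\{0\le \mathcal P\le\epsilon\}$: $\mathrm{proj}\{\tau\}=\tau$ if $\mathcal P(\hat W_a)\le0$ or $\nabla\mathcal P(\hat W_a)\tau\le0$, and $\mathrm{proj}\{\tau\}=\tau-\min\{1,\mathcal P/\epsilon\}\frac{\nabla\mathcal P^T\nabla\mathcal P}{\|\nabla\mathcal P\|^2}\tau$ otherwise, where $\mathcal P$ is $C^1$ and convex, $\epsilon>0$, $\{\mathcal P\le\epsilon\}$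 is bounded and contains $\hat W_a(t_0)$, and $W(\chi)\subset\Pi$. *Identifier inequality.* There are $K_\theta,D_\theta>0$ and a continuous $V_\theta:\mathbb R^p\times\mathbb R_{\ge0}\to\mathbb R_{\ge 0}$ with $v_1(\|\tilde\theta\|)\le V_\theta(\tilde\theta,t)\le v_2(\|\tilde\theta\|)$ for some $v_1,v_2\in\mathcal K$, differentiable for $t>t_0$, whose derivative along $\dot{\tilde\theta}=-\psi(\theta-\tilde\theta,t)$ satisfies $\dot V_\theta\le-K_\theta\|\tilde\theta\|^2+D_\theta\|\tilde\theta\|$ for all $\tilde\theta$ and all $t>t_0$. *Assumption 3 (for a solution on $[t_0,\infty)$).* There are $T>0$ and $\underline c_1,\underline c_2,\underline c_3\ge0$, not all zero, such that for all $t\ge t_0$: $\underline c_1I\le\int_t^{t+T}\Lambda$, $\underline c_2I\le\int_t^{t+T}\frac1N\sum_i\Lambda_i$, $\underline c_3I\le\frac1N\sum_i\Lambda_i(t)$. *Composite state.* $\tilde W_c=W(x)-\hat W_c$, $\tilde W_a=W(x)-\hat W_a$, $\tilde\theta=\theta-\hat\theta$, $Z=[x^T,\tilde W_c^T,\tilde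 W_a^T,\tilde\theta^T]^T$, $V_L(Z,t)=V^*(x)+\frac12\tilde W_c^T\Gamma^{-1}(t)\tilde W_c+\frac12\tilde W_a^T\tilde W_a+V_\theta(\tilde\theta,t)$. *Constants.* Let $\|\nabla B\|_\infty$ be a finite bound on $\|\nabla B(x(t))\|$ along the solution. $\overline{\|\cdot\|}$ is the supremum over $x\in\chi$ and, for $G_\phi$, $\|G_\phi\|\|W\|$, $\Delta$ and $W^T\nabla\phi Y$, over $x\in\chi$, $y\in\chi\cap B_l(x)$, with $\phi=\phi(y,c(x))$, $W=W(x)$ and all else at $y$. Let $e=\nabla V^*-W^T\nabla\phi$, $\Delta=-ef-W^T\nabla\phi\,\varepsilon_\theta+\frac12W^T\nabla\phi G_Re^T+\frac14eG_Re^T$, let $\nabla\varepsilon$ be the gradient of $V^*-W^T\phi$ for fixed centres, $q=3\sqrt3/\sqrt{\gamma_c}$ and $k_c=k_{c1}+k_{c2}$. Given $0<\underline\Gamma,\overline\Gamma$, put $\underline c=\frac{\underline c_3}2+\frac{\beta_c}{2k_{c2}\overline\Gamma}$, $\kappa=\min\{\lambda_{\min}(Q),\frac{\underline ck_{c2}}4,\frac{k_{a1}+k_{a2}}4,\frac{K_\theta}4\}$,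 $$\iota_x=\overline{\|\nabla Wf\|}+\tfrac12\overline{\|\nabla WG_R\nabla\phi^TW\|}+\tfrac{c_b}2\overline{\|\nabla WG_R\|}\|\nabla B\|_\infty,$$ $$\iota_c=\tfrac{k_{c1}q}{64}c_b^2\overline{\|G_R\|}\|\nabla B\|_\infty^2+\tfrac{k_cq}{16}\overline{\|\Delta\|}+\tfrac{\iota_x}{\underline\Gamma},$$ $$\iota_a=\tfrac12\overline{\|\nabla V^*G_R\nabla\phi^T\|}+k_{a2}\overline{\|W\|}+\tfrac{k_cq}{64}\overline{\|G_\phi\|}\,\overline{\|W\|}^2+\iota_x,$$ $$\iota=\tfrac12\overline{\|\nabla V^*G_R\|}\big(\overline{\|\phi^T\nabla W+\nabla\varepsilon\|}+c_b\|\nabla B\|_\infty\big)+\tfrac{\iota_c^2}{2\underline ck_{c2}}+\tfrac{\iota_a^2}{2(k_{a1}+k_{a2})}+\tfrac{D_\theta^2}{2K_\theta},$$ $$\varphi_a=\tfrac{k_cq}{64}\overline{\|G_\phi\|\|W\|}+\tfrac12\overline{\|\nabla WG_R\nabla\phi^T\|},\qquad \varphi_{c\theta}=\tfrac{k_cq}{16}\overline{\|W^T\nabla\phi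 Y\|},$$ $$\varphi_{ac}=k_{a1}+\tfrac{k_cq}{64}\overline{\|G_\phi\|\|W\|}+\tfrac{c_bk_{c1}q}{32}\overline{\|G_R\nabla\phi^T\|}\|\nabla B\|_\infty+\tfrac1{2\underline\Gamma}\overline{\|\nabla WG_R\nabla\phi^T\|},$$ $$M=\begin{bmatrix}\frac{\underline ck_{c2}}4&-\frac{\varphi_{ac}}2&-\frac{\varphi_{c\theta}}2\\-\frac{\varphi_{ac}}2&\frac{k_{a1}+k_{a2}}4-\varphi_a&0\\-\frac{\varphi_{c\theta}}2&0&\frac{K_\theta}4\end{bmatrix}.$$ **Theorem 2.** Under Assumptions 1–2 and the above: 1. $\mathrm{Int}(\mathcal C)$ is forward invariant: every solution on $[t_0,\tau)$ with $x(t_0)\in\mathrm{Int}(\mathcal C)$ and finite $\|\nabla B\|_\infty$ satisfies $x(t)\in\mathrm{Int}(\mathcal C)$ for all $t\in[t_0,\tau)$. 2. For every solution on $[t_0,\infty)$ with $x(t_0)\in\mathrm{Int}(\mathcal C)$ and finite $\|\nabla B\|_\infty$ that satisfies the identifier inequality and Assumption 3, there are $\underline\Gamma,\overline\Gamma>0$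 with $\underline\Gamma I\le\Gamma(t)=\Gamma(t)^T\le\overline\Gamma I$ for all $t\ge t_0$, and $\eta_1,\eta_2\in\mathcal K$ with $\eta_1(\|Z\|)\le V_L(Z,t)\le\eta_2(\|Z\|)$ for all $t\ge t_0$, $Z\in\chi\times\mathbb R^{2L+p}$. 3. Fix $\underline c_3\ge 0$, $\underline\Gamma,\overline\Gamma>0$, $\|\nabla B\|_\infty\ge 0$, $\eta_1,\eta_2\in\mathcal K$ and $\zeta>0$ such that the closed ball of radius $\zeta$ about $Z=0$ is contained in $\chi\times\mathbb R^{2L+p}$, $$\lambda_{\min}(M)>0,\qquad\sqrt{2\iota/\kappa}<\eta_1^{-1}(\eta_2(\zeta)),$$ and $\eta_1^{-1}(\eta_2(\sqrt{2\iota/\kappa}))$ is defined. Consider all solutions as in 2 for which these are admissible constants and comparison functions, and for which either $x(t)\in\chi$ for all $t\ge t_0$, or $\eta_2(\|Z(t_0)\|)<\eta_1(\zeta)$ and $\eta_2(\sqrt{2\iota/\kappa})<\eta_1(\zeta)$. Along these, $Z$ is uniformly ultimately bounded with ultimate bound $\eta_1^{-1}\circ\eta_2(\sqrt{2\iota/\kappa})$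 (for every $a>0$ there is $T\ge0$, depending neither on $t_0$ nor on the solution, such that $\|Z(t_0)\|\le a$ implies $\|Z(t)\|\le\eta_1^{-1}\circ\eta_2(\sqrt{2\iota/\kappa})$ for all $t\ge t_0+T$); in particular $$\limsup_{t\to\infty}\|Z(t)\|\le\eta_1^{-1}\circ\eta_2\big(\sqrt{2\iota/\kappa}\big).$$ -/

import Mathlib

open Set Filter Topology
open scoped ContDiff RealInnerProductSpace

noncomputable section

namespace SafeMBRL

/-- `ℝᵏ` with its Euclidean norm. -/
abbrev E (k : ℕ) := EuclideanSpace ℝ (Fin k)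

/-- Class `𝒦`: continuous, strictly increasing on `[0, ∞)`, zero at zero. -/
def ClassK (α : ℝ → ℝ) : Prop :=
  ContinuousOn α (Ici 0) ∧ StrictMonoOn α (Ici 0) ∧ α 0 = 0

/-- The smallest eigenvalue (used for symmetric matrices and operators only). -/
def lambdaMin {A : Type*} [Ring A] [Algebra ℝ A] (a : A) : ℝ := sInf (spectrum ℝ a)

/-- Symmetric and positive definite. -/
def PosDefOp {k : ℕ} (A : E k →L[ℝ] E k) : Prop :=
  IsSelfAdjoint A ∧ ∀ v, v ≠ 0 → 0 < ⟪v, A v⟫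

/-- All the data of the plant, of the optimal control problem, of the approximation scheme and of
the learning laws. Matrices are linear maps between Euclidean spaces, so that `‖·‖` is the induced
Euclidean norm. Functions which are meaningful only on a part of the space (`b` on `Int 𝒞`;
`W, φ, c, xi` on `χ`) are total here, with arbitrary values elsewhere. -/
structure Scheme (n m L p N : ℕ) where
  /-- drift -/
  f : E n → E n
  /-- control directions -/
  g : E n → (E m →L[ℝ] E n)
  /-- the safe set is `{h ≥ 0}` -/
  h : E n → ℝ
  /-- candidate control barrier function -/
  b : E n → ℝ
  /-- state weight of the running cost -/
  Q : E n →L[ℝ] E n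
  /-- control weight of the running cost -/
  R : E m →L[ℝ] E m
  /-- optimal value function `V*` -/
  V : E n → ℝ
  /-- compact set over which the approximation takes place -/
  χ : Set (E n)
  /-- radius of the ball that follows the state -/
  l : ℝ
  /-- ideal weights -/
  W : E n → E L
  /-- kernels `φ_j(y, c)` -/
  φ : Fin L → E n → E n → ℝ
  /-- centres `c_j(x)` -/
  c : Fin L → E n → E n
  /-- extrapolation maps `x_i(x, t)` -/
  xi : Fin N → E n → ℝ → E n
  /-- basis for the drift -/
  Y : E n → (E p →L[ℝ] E n)
  /-- ideal drift parameters -/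
  θ : E p
  /-- Lyapunov function of the parameter identifier, `V_θ(θ̃, t)` -/
  Vθ : E p × ℝ → ℝ
  /-- constants of the identifier -/
  Kθ : ℝ
  Dθ : ℝ
  /-- convex function that defines the projection operator -/
  P : E L → ℝ
  /-- width of the boundary layer of the projection operator -/
  εP : ℝ
  /-- gains -/
  cb : ℝ
  kc1 : ℝ
  kc2 : ℝ
  ka1 : ℝ
  ka2 : ℝ
  γc : ℝ
  βc : ℝ

/-- The signals of a closed-loop run: state, critic weights, actor weights, least-squares gain,
parameter estimate, together with the update law `θ̂' = ψ(θ̂, t)` of the parameter identifier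
(its dependence on measured data is part of its dependence on time). -/
structure Run (n L p : ℕ) where
  x : ℝ → E n
  Wc : ℝ → E L
  Wa : ℝ → E L
  Γ : ℝ → (E L →L[ℝ] E L)
  θh : ℝ → E p
  ψ : E p → ℝ → E p

/-- `Γlow I ≤ Γ(t) ≤ Γup I` (with `Γ(t)` symmetric) for all `t ≥ t₀`. -/
def Run.GainBounds {n L p : ℕ} (r : Run n L p) (t₀ Γlow Γup : ℝ) : Prop :=
  ∀ t ≥ t₀, IsSelfAdjoint (r.Γ t) ∧
    ∀ v : E L, Γlow * ‖v‖ ^ 2 ≤ ⟪v, r.Γ t v⟫ ∧ ⟪v, r.Γ t v⟫ ≤ Γup * ‖v‖ ^ 2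

/-- The composite vector `[xᵀ, w_cᵀ, w_aᵀ, ϑᵀ]ᵀ`. -/
def stack {n L p : ℕ} (x : E n) (wc wa : E L) (th : E p) :
    EuclideanSpace ℝ (Fin n ⊕ Fin L ⊕ Fin L ⊕ Fin p) :=
  WithLp.toLp 2 (Sum.elim (fun i => x i)
    (Sum.elim (fun i => wc i) (Sum.elim (fun i => wa i) (fun i => th i))))

/-- Interval of existence `[t₀, τ)`, where `τ = ⊤` is allowed. -/
def timeInterval (t₀ : ℝ) (τ : EReal) : Set ℝ := {t | t₀ ≤ t ∧ (t : EReal) < τ}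

/-- Trajectories are given as pairs of an initial time and a curve. A family of them is uniformly
ultimately bounded with ultimate bound `r` if, for every bound `a` on the initial value, all of
them are within `r` from some time after the start on which depends on `a` only. -/
def UniformlyUltimatelyBounded {F : Type*} [NormedAddCommGroup F]
    (𝓕 : Set (ℝ × (ℝ → F))) (r : ℝ) : Prop :=
  ∀ a > 0, ∃ T ≥ 0, ∀ q ∈ 𝓕, ‖q.2 q.1‖ ≤ a → ∀ t ≥ q.1 + T, ‖q.2 t‖ ≤ r

namespace Scheme

variable {n m L p N : ℕ} (S : Scheme n m L p N)

/-! ### Objects built from the data -/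

/-- The set `𝒞`. -/
def safe : Set (E n) := {x | 0 ≤ S.h x}

/-- The recentred barrier function `B(x) = (b(x) - b(0))²`. -/
def B (x : E n) : ℝ := (S.b x - S.b 0) ^ 2

/-- `∇B(x)ᵀ`. -/
def gradB (x : E n) : E n := gradient S.B x

/-- `∇V*(x)` as a row vector. -/
def dV (x : E n) : E n →L[ℝ] ℝ := fderiv ℝ S.V x

/-- `∇W(x)`. -/
def dW (x : E n) : E n →L[ℝ] E L := fderiv ℝ S.W x

/-- `φ(y, c(x))`. -/
def phi (y x : E n) : E L := WithLp.toLp 2 fun j => S.φ j y (S.c j x)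

/-- `∇φ(y, c(x))`, the derivative in the first argument. -/
def dphi (y x : E n) : E n →L[ℝ] E L := fderiv ℝ (fun z => S.phi z x) y

/-- `∇φ(y, c(x))ᵀ`. -/
def dphiT (y x : E n) : E L →L[ℝ] E n := ContinuousLinearMap.adjoint (S.dphi y x)

/-- `g(x)ᵀ`. -/
def gT (x : E n) : E n →L[ℝ] E m := ContinuousLinearMap.adjoint (S.g x)

/-- `R⁻¹`. -/
def Rinv : E m →L[ℝ] E m := S.R.inverse

/-- `G_R = g R⁻¹ gᵀ`. -/
def GR (y : E n) : E n →L[ℝ] E n := S.g y ∘L S.Rinv ∘L S.gT y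

/-- `G_φ = ∇φ G_R ∇φᵀ` at the point `y`, with centres `c(x)`. -/
def Gphi (y x : E n) : E L →L[ℝ] E L := S.dphi y x ∘L S.GR y ∘L S.dphiT y x

/-- Running cost `r(y, u) = yᵀQy + uᵀRu`. -/
def cost (y : E n) (u : E m) : ℝ := ⟪y, S.Q y⟫ + ⟪u, S.R u⟫

/-- Approximate optimal policy `k̂(y, x, w) = -½ R⁻¹ g(y)ᵀ ∇φ(y, c(x))ᵀ w`. -/
def khat (y x : E n) (w : E L) : E m :=
  -((1 / 2 : ℝ) • S.Rinv (S.gT y (S.dphiT y x w)))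

/-- The policy applied to the plant,
`u = k̂(x, x, Ŵ_a) - (c_b/2) R⁻¹ g(x)ᵀ ∇B(x)ᵀ`. -/
def policy (x : E n) (wa : E L) : E m :=
  S.khat x x wa - (S.cb / 2) • S.Rinv (S.gT x (S.gradB x))

/-- The regressor `ω` along the trajectory. -/
def omega (x : E n) (wa : E L) (th : E p) : E L :=
  S.dphi x x (S.Y x th + S.g x (S.policy x wa))

/-- The regressor at an extrapolated point `y`, under the exploratory policy. -/
def omegaAt (y x : E n) (wa : E L) (th : E p) : E L :=
  S.dphi y x (S.Y y th + S.g y (S.khat y x wa))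

/-- Normalizing signal `ρ = 1 + γ_c ωᵀω`. -/
def rho (w : E L) : ℝ := 1 + S.γc * ⟪w, w⟫

/-- `Λ = ω ωᵀ / ρ²` for the regressor `ω = w`. -/
def Lam (w : E L) : E L →L[ℝ] E L := (1 / S.rho w ^ 2) • (innerSL ℝ w).smulRight w

/-- Bellman error `δ_t` along the trajectory. -/
def delta (x : E n) (wc wa : E L) (th : E p) : ℝ :=
  S.cost x (S.policy x wa) + ⟪wc, S.omega x wa th⟫

/-- Bellman error `δ_i` at an extrapolated point `y`. -/
def deltaAt (y x : E n) (wc wa : E L) (th : E p) : ℝ :=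
  S.cost y (S.khat y x wa) + ⟪wc, S.omegaAt y x wa th⟫

/-- `(1/N) ∑ᵢ Λᵢ` at time `t`. -/
def LamAvg (x : E n) (wa : E L) (th : E p) (t : ℝ) : E L →L[ℝ] E L :=
  (1 / (N : ℝ)) • ∑ i, S.Lam (S.omegaAt (S.xi i x t) x wa th)

/-- The smooth projection operator for the convex set `{P ≤ 0}` with boundary layer
`{0 ≤ P ≤ εP}`, at the current estimate `w`. -/
def proj (w τ : E L) : E L :=
  open Classical in
  if S.P w ≤ 0 ∨ ⟪gradient S.P w, τ⟫ ≤ 0 then τ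
  else τ - (min 1 (S.P w / S.εP) * (⟪gradient S.P w, τ⟫ / ‖gradient S.P w‖ ^ 2)) •
    gradient S.P w

/-- Right-hand side of the critic update law. -/
def critic (x : E n) (wc wa : E L) (Γ : E L →L[ℝ] E L) (th : E p) (t : ℝ) : E L :=
  -(Γ ((S.kc1 / S.rho (S.omega x wa th) ^ 2 * S.delta x wc wa th) • S.omega x wa th
    + (S.kc2 / N) • ∑ i,
      (S.deltaAt (S.xi i x t) x wc wa th / S.rho (S.omegaAt (S.xi i x t) x wa th) ^ 2) •
        S.omegaAt (S.xi i x t) x wa th))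

/-- Right-hand side of the update law of the least-squares gain. -/
def gain (x : E n) (wa : E L) (Γ : E L →L[ℝ] E L) (th : E p) (t : ℝ) : E L →L[ℝ] E L :=
  S.βc • Γ - Γ ∘L (S.kc1 • S.Lam (S.omega x wa th) + S.kc2 • S.LamAvg x wa th t) ∘L Γ

/-- Right-hand side of the actor update law. -/
def actor (x : E n) (wc wa : E L) (th : E p) (t : ℝ) : E L :=
  S.proj wa (-(S.ka1 • (wa - wc)) - S.ka2 • wa
    + (S.kc1 / (4 * S.rho (S.omega x wa th) ^ 2) * ⟪S.omega x wa th, wc⟫) •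
        ContinuousLinearMap.adjoint (S.Gphi x x) wa
    + ∑ i, (S.kc2 / (4 * N * S.rho (S.omegaAt (S.xi i x t) x wa th) ^ 2)
          * ⟪S.omegaAt (S.xi i x t) x wa th, wc⟫) •
        ContinuousLinearMap.adjoint (S.Gphi (S.xi i x t) x) wa)

/-! ### Assumptions on the data -/

/-- Regularity of the plant; the origin is an equilibrium of the drift. -/
structure PlantRegular : Prop where
  f_lip : LocallyLipschitz S.f
  g_lip : LocallyLipschitz S.g
  f_zero : S.f 0 = 0

/-- `𝒞 = {h ≥ 0}`, `∂𝒞 = {h = 0}`, `Int 𝒞 = {h > 0} ∋ 0`, with `h` of class `C¹`. -/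
structure SafeSet : Prop where
  h_smooth : ContDiff ℝ 1 S.h
  boundary : frontier S.safe = {x | S.h x = 0}
  inside : interior S.safe = {x | 0 < S.h x}
  zero_mem : (0 : E n) ∈ interior S.safe

/-- `b : Int 𝒞 → ℝ≥0` is a candidate control barrier function. -/
structure CandidateCBF : Prop where
  smooth : ContDiffOn ℝ 1 S.b (interior S.safe)
  nonneg : ∀ x ∈ interior S.safe, 0 ≤ S.b x
  bounds : ∃ α₁ α₂ : ℝ → ℝ, ClassK α₁ ∧ ClassK α₂ ∧ ∀ x ∈ interior S.safe,
    1 / α₁ (S.h x) ≤ S.b x ∧ S.b x ≤ 1 / α₂ (S.h x)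

/-- `F` is bounded on `𝒞` by `ℓ(‖x‖)‖x‖` for some positive non-decreasing `ℓ`, and
`ℓ(‖x‖)‖x‖` stays finite as `x` tends to `∂𝒞`. -/
def GrowthOnSafe (F : E n → ℝ) : Prop :=
  ∃ ℓ : ℝ → ℝ, (∀ s ≥ 0, 0 < ℓ s) ∧ MonotoneOn ℓ (Ici 0) ∧
    (∀ x ∈ S.safe, F x ≤ ℓ ‖x‖ * ‖x‖) ∧
    ∀ q ∈ frontier S.safe,
      IsBoundedUnder (· ≤ ·) (𝓝[interior S.safe] q) fun x => ℓ ‖x‖ * ‖x‖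

/-- Conditions on the dynamics, the safe set and the barrier function. In the last one `b`, which
lives on `Int 𝒞`, is looked at on the part of the neighbourhood that lies in `Int 𝒞`. -/
structure DynamicsCondition : Prop where
  drift : S.GrowthOnSafe fun x => ‖S.f x‖
  control : ∃ glow > 0, ∀ x ∈ S.safe, glow ≤ ‖S.g x‖
  relative_degree : ∃ U ∈ 𝓝ˢ (frontier S.safe), (0 : E n) ∉ U ∧
    ∀ x ∈ U ∩ interior S.safe, fderiv ℝ S.b x ∘L S.g x ≠ 0

/-- Weights of the cost, and a positive definite `C¹` solution of the HJB equation with locally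
Lipschitz gradient. -/
structure ValueCondition : Prop where
  Q_pos : PosDefOp S.Q
  R_pos : PosDefOp S.R
  smooth : ContDiff ℝ 1 S.V
  zero : S.V 0 = 0
  pos : ∀ x, x ≠ 0 → 0 < S.V x
  hjb : ∀ x, IsGLB (range fun u : E m =>
    S.dV x (S.f x) + S.dV x (S.g x u) + S.cost x u) 0
  grad_lip : LocallyLipschitz S.dV

/-- State-following approximation over the compact set `χ ∋ 0`. The reconstruction errors
`ε(x, y) = V*(y) - W(x)ᵀφ(y, c(x))` and `ε_θ = f - Yθ` are defined by their equations. -/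
structure Approximation : Prop where
  compact : IsCompact S.χ
  zero_mem : (0 : E n) ∈ S.χ
  l_pos : 0 < S.l
  W_smooth : ∃ O, IsOpen O ∧ S.χ ⊆ O ∧ ContDiffOn ℝ 1 S.W O
  φ_smooth : ∀ j, ∃ O, IsOpen O ∧ S.χ ⊆ O ∧
    ContDiffOn ℝ ∞ (fun q : E n × E n => S.φ j q.1 q.2) (O ×ˢ O)
  φ_posdef : ∀ (j : Fin L) (k : ℕ) (q : Fin k → E n), (∀ i, q i ∈ S.χ) →
    (Matrix.of fun i i' => S.φ j (q i) (q i')).PosSemidef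
  centre : ∀ j, ∀ x ∈ S.χ, S.c j x ∈ S.χ ∩ Metric.closedBall x S.l
  extrapolation : ∀ i, ∀ x ∈ S.χ, ∀ t ≥ 0, S.xi i x t ∈ S.χ ∩ Metric.closedBall x S.l
  Y_cont : Continuous S.Y

/-- `V_θ` is continuous, positive definite and decrescent; the constants are positive. -/
structure IdentifierFunction : Prop where
  K_pos : 0 < S.Kθ
  D_pos : 0 < S.Dθ
  cont : ContinuousOn S.Vθ (univ ×ˢ Ici 0)
  bounds : ∃ v₁ v₂ : ℝ → ℝ, ClassK v₁ ∧ ClassK v₂ ∧ ∀ th, ∀ t ≥ 0,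
    v₁ ‖th‖ ≤ S.Vθ (th, t) ∧ S.Vθ (th, t) ≤ v₂ ‖th‖

/-- The projection operator is built on a convex set that contains the ideal weights and whose
boundary layer is bounded. -/
structure ProjectionSet : Prop where
  smooth : ContDiff ℝ 1 S.P
  convex : ConvexOn ℝ univ S.P
  ε_pos : 0 < S.εP
  bounded : Bornology.IsBounded {w | S.P w ≤ S.εP}
  ideal : ∀ x ∈ S.χ, S.P (S.W x) ≤ 0

structure GainsPos : Prop where
  cb_pos : 0 < S.cb
  kc1_pos : 0 < S.kc1
  kc2_pos : 0 < S.kc2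
  ka1_pos : 0 < S.ka1
  ka2_pos : 0 < S.ka2
  γc_pos : 0 < S.γc
  βc_pos : 0 < S.βc

/-- All assumptions on the data. -/
structure Assumptions : Prop where
  plant : S.PlantRegular
  safeSet : S.SafeSet
  cbf : S.CandidateCBF
  dynamics : S.DynamicsCondition
  value : S.ValueCondition
  approx : S.Approximation
  policy_growth : S.GrowthOnSafe fun x => ‖S.gT x ∘L S.dphiT x x‖
  identifier : S.IdentifierFunction
  projection : S.ProjectionSet
  gains : S.GainsPos

/-! ### Closed-loop runs -/

/-- `r` is a solution of the closed loop on `[t₀, τ)`: plant under the policy, critic, gain and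
actor update laws, and identifier. The signals are continuous and satisfy the differential
equations at all times but the elements of a locally finite set (switching instants), as long as
the state is in `Int 𝒞`, where the policy is defined. -/
structure IsSolution (r : Run n L p) (t₀ : ℝ) (τ : EReal) : Prop where
  x_cont : ContinuousOn r.x (timeInterval t₀ τ)
  Wc_cont : ContinuousOn r.Wc (timeInterval t₀ τ)
  Wa_cont : ContinuousOn r.Wa (timeInterval t₀ τ)
  Γ_cont : ContinuousOn r.Γ (timeInterval t₀ τ)
  θh_cont : ContinuousOn r.θh (timeInterval t₀ τ)
  Γ_init : PosDefOp (r.Γ t₀)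
  Wa_init : S.P (r.Wa t₀) ≤ S.εP
  ode : ∃ D : Set ℝ, (∀ s, (D ∩ Icc t₀ s).Finite) ∧
    ∀ t ∈ timeInterval t₀ τ, t₀ < t → t ∉ D → r.x t ∈ interior S.safe →
      HasDerivAt r.x (S.f (r.x t) + S.g (r.x t) (S.policy (r.x t) (r.Wa t))) t ∧
      HasDerivAt r.Wc (S.critic (r.x t) (r.Wc t) (r.Wa t) (r.Γ t) (r.θh t) t) t ∧
      HasDerivAt r.Γ (S.gain (r.x t) (r.Wa t) (r.Γ t) (r.θh t) t) t ∧
      HasDerivAt r.Wa (S.actor (r.x t) (r.Wc t) (r.Wa t) (r.θh t) t) t ∧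
      HasDerivAt r.θh (r.ψ (r.θh t) t) t

/-- `‖∇B(x(·))‖_∞ ≤ Bsup` on `[t₀, τ)` (where `∇B` is defined). -/
def GradBBound (r : Run n L p) (t₀ : ℝ) (τ : EReal) (Bsup : ℝ) : Prop :=
  ∀ t ∈ timeInterval t₀ τ, r.x t ∈ interior S.safe → ‖S.gradB (r.x t)‖ ≤ Bsup

/-- The Lyapunov inequality `V̇_θ ≤ -K_θ‖θ̃‖² + D_θ‖θ̃‖` of the identifier, for all `θ̃`;
here `θ̃ = θ - θ̂`, so that `θ̃' = -ψ(θ - θ̃, t)`. -/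
def IdentifierInequality (r : Run n L p) (t₀ : ℝ) : Prop :=
  ∀ (th : E p), ∀ t > t₀, DifferentiableAt ℝ S.Vθ (th, t) ∧
    fderiv ℝ S.Vθ (th, t) (-r.ψ (S.θ - th) t, 1) ≤ -S.Kθ * ‖th‖ ^ 2 + S.Dθ * ‖th‖

/-- `Λ(t)` along a run. -/
def LamRun (r : Run n L p) (t : ℝ) : E L →L[ℝ] E L :=
  S.Lam (S.omega (r.x t) (r.Wa t) (r.θh t))

/-- `(1/N) ∑ᵢ Λᵢ(t)` along a run. -/
def LamAvgRun (r : Run n L p) (t : ℝ) : E L →L[ℝ] E L :=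
  S.LamAvg (r.x t) (r.Wa t) (r.θh t) t

/-- The excitation condition with window `T` and levels `c₁, c₂, c₃`. -/
def Excitation (r : Run n L p) (t₀ T c₁ c₂ c₃ : ℝ) : Prop :=
  0 < T ∧ 0 ≤ c₁ ∧ 0 ≤ c₂ ∧ 0 ≤ c₃ ∧ (0 < c₁ ∨ 0 < c₂ ∨ 0 < c₃) ∧
  ∀ t ≥ t₀, ∀ v : E L,
    c₁ * ‖v‖ ^ 2 ≤ ∫ s in t..(t + T), ⟪v, S.LamRun r s v⟫ ∧
    c₂ * ‖v‖ ^ 2 ≤ ∫ s in t..(t + T), ⟪v, S.LamAvgRun r s v⟫ ∧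
    c₃ * ‖v‖ ^ 2 ≤ ⟪v, S.LamAvgRun r t v⟫

/-- A run on `[t₀, ∞)` that starts in `Int 𝒞` and meets the identifier inequality and the
excitation condition with third level `c₃`, with `‖∇B(x(·))‖_∞ ≤ Bsup`. -/
structure ExcitedRun (r : Run n L p) (t₀ c₃ Bsup : ℝ) : Prop where
  t₀_nonneg : 0 ≤ t₀
  sol : S.IsSolution r t₀ ⊤
  init : r.x t₀ ∈ interior S.safe
  identifier : S.IdentifierInequality r t₀
  excitation : ∃ T c₁ c₂, S.Excitation r t₀ T c₁ c₂ c₃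
  gradB_bound : S.GradBBound r t₀ ⊤ Bsup

/-- `Int 𝒞` is forward invariant along all solutions of the closed loop, on any interval of
existence, along which `‖∇B(x(·))‖_∞` is finite. -/
def ForwardInvariant : Prop :=
  ∀ (r : Run n L p) (t₀ : ℝ) (τ : EReal), 0 ≤ t₀ → S.IsSolution r t₀ τ →
    r.x t₀ ∈ interior S.safe → (∃ Bsup, S.GradBBound r t₀ τ Bsup) →
    ∀ t ∈ timeInterval t₀ τ, r.x t ∈ interior S.safe

/-- The composite state `Z(t)`. -/
def Z (r : Run n L p) (t : ℝ) : EuclideanSpace ℝ (Fin n ⊕ Fin L ⊕ Fin L ⊕ Fin p) :=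
  stack (r.x t) (S.W (r.x t) - r.Wc t) (S.W (r.x t) - r.Wa t) (S.θ - r.θh t)

/-- The Lyapunov function candidate `V_L(Z, t)`, `Z = [xᵀ, w_cᵀ, w_aᵀ, ϑᵀ]ᵀ`. -/
def VL (r : Run n L p) (x : E n) (wc wa : E L) (th : E p) (t : ℝ) : ℝ :=
  S.V x + 1 / 2 * ⟪wc, (r.Γ t).inverse wc⟫ + 1 / 2 * ⟪wa, wa⟫ + S.Vθ (th, t)

/-- `η₁(‖Z‖) ≤ V_L(Z, t) ≤ η₂(‖Z‖)` for all `t ≥ t₀` and `Z ∈ χ × ℝ^{2L+p}`. -/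
def Sandwich (r : Run n L p) (t₀ : ℝ) (η₁ η₂ : ℝ → ℝ) : Prop :=
  ∀ t ≥ t₀, ∀ x ∈ S.χ, ∀ (wc wa : E L) (th : E p),
    η₁ ‖stack x wc wa th‖ ≤ S.VL r x wc wa th t ∧
    S.VL r x wc wa th t ≤ η₂ ‖stack x wc wa th‖

/-! ### Constants -/

/-- Supremum over `x ∈ χ`. -/
def sup₁ (F : E n → ℝ) : ℝ := sSup (F '' S.χ)

/-- Supremum over `x ∈ χ` and `y ∈ χ ∩ B_l(x)`, for quantities which are evaluated at the
extrapolated points `y = x_i(x, t)` as well as at `y = x`. -/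
def sup₂ (F : E n → E n → ℝ) : ℝ :=
  sSup {a | ∃ x ∈ S.χ, ∃ y ∈ S.χ ∩ Metric.closedBall x S.l, a = F x y}

/-- The residual `Δ` of the Bellman error at `y` for the state `x`, that is
`-e f - Wᵀ∇φ ε_θ + ½ Wᵀ∇φ G_R eᵀ + ¼ e G_R eᵀ` with `e = ∇V* - Wᵀ∇φ`. -/
def Delta (x y : E n) : ℝ :=
  let q : E n := S.dphiT y x (S.W x)
  let e : E n := gradient S.V y - q
  1 / 2 * ⟪q, S.GR y e⟫ + 1 / 4 * ⟪e, S.GR y e⟫ - ⟪e, S.f y⟫ - ⟪q, S.f y - S.Y y S.θ⟫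

/-- `∇ε` in `∇V* = Wᵀ∇φ + φᵀ∇W + ∇ε`: the gradient of `V* - Wᵀφ` for fixed centres. -/
def dEps (x : E n) : E n →L[ℝ] ℝ := fderiv ℝ (fun z => S.V z - ⟪S.W z, S.phi z x⟫) x

/-- `c̲`. -/
def clow (c₃ Γup : ℝ) : ℝ := c₃ / 2 + S.βc / (2 * S.kc2 * Γup)

def kappa (c₃ Γup : ℝ) : ℝ :=
  min (lambdaMin S.Q) (min (S.clow c₃ Γup * S.kc2 / 4) (min ((S.ka1 + S.ka2) / 4) (S.Kθ / 4)))

def iotaX (Bsup : ℝ) : ℝ :=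
  S.sup₁ (fun x => ‖S.dW x (S.f x)‖)
    + 1 / 2 * S.sup₁ (fun x => ‖S.dW x (S.GR x (S.dphiT x x (S.W x)))‖)
    + S.cb / 2 * S.sup₁ (fun x => ‖S.dW x ∘L S.GR x‖) * Bsup

def iotaC (Γlow Bsup : ℝ) : ℝ :=
  S.kc1 * (3 * √3) / (64 * √S.γc) * S.cb ^ 2 * S.sup₁ (fun x => ‖S.GR x‖) * Bsup ^ 2
    + (S.kc1 + S.kc2) * (3 * √3) / (16 * √S.γc) * S.sup₂ (fun x y => |S.Delta x y|)
    + S.iotaX Bsup / Γlow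

def iotaA (Bsup : ℝ) : ℝ :=
  1 / 2 * S.sup₁ (fun x => ‖S.dV x ∘L S.GR x ∘L S.dphiT x x‖)
    + S.ka2 * S.sup₁ (fun x => ‖S.W x‖)
    + (S.kc1 + S.kc2) * (3 * √3) / (64 * √S.γc) * S.sup₂ (fun x y => ‖S.Gphi y x‖)
        * S.sup₁ (fun x => ‖S.W x‖) ^ 2
    + S.iotaX Bsup

def iota (c₃ Γlow Γup Bsup : ℝ) : ℝ :=
  1 / 2 * S.sup₁ (fun x => ‖S.dV x ∘L S.GR x‖)
      * (S.sup₁ (fun x => ‖innerSL ℝ (S.phi x x) ∘L S.dW x + S.dEps x‖) + S.cb * Bsup)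
    + S.iotaC Γlow Bsup ^ 2 / (2 * S.clow c₃ Γup * S.kc2)
    + S.iotaA Bsup ^ 2 / (2 * (S.ka1 + S.ka2))
    + S.Dθ ^ 2 / (2 * S.Kθ)

def phiA : ℝ :=
  (S.kc1 + S.kc2) * (3 * √3) / (64 * √S.γc) * S.sup₂ (fun x y => ‖S.Gphi y x‖ * ‖S.W x‖)
    + 1 / 2 * S.sup₁ (fun x => ‖S.dW x ∘L S.GR x ∘L S.dphiT x x‖)

def phiAC (Γlow Bsup : ℝ) : ℝ :=
  S.ka1
    + (S.kc1 + S.kc2) * (3 * √3) / (64 * √S.γc) * S.sup₂ (fun x y => ‖S.Gphi y x‖ * ‖S.W x‖)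
    + S.cb * S.kc1 * (3 * √3) / (32 * √S.γc) * S.sup₁ (fun x => ‖S.GR x ∘L S.dphiT x x‖) * Bsup
    + 1 / (2 * Γlow) * S.sup₁ (fun x => ‖S.dW x ∘L S.GR x ∘L S.dphiT x x‖)

def phiCθ : ℝ :=
  (S.kc1 + S.kc2) * (3 * √3) / (16 * √S.γc)
    * S.sup₂ (fun x y => ‖innerSL ℝ (S.W x) ∘L S.dphi y x ∘L S.Y y‖)

/-- The matrix `M`. -/
def M (c₃ Γlow Γup Bsup : ℝ) : Matrix (Fin 3) (Fin 3) ℝ :=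
  !![S.clow c₃ Γup * S.kc2 / 4, -S.phiAC Γlow Bsup / 2, -S.phiCθ / 2;
     -S.phiAC Γlow Bsup / 2, (S.ka1 + S.ka2) / 4 - S.phiA, 0;
     -S.phiCθ / 2, 0, S.Kθ / 4]

/-- `√(2ι/κ)`. -/
def mu (c₃ Γlow Γup Bsup : ℝ) : ℝ :=
  √(2 * S.iota c₃ Γlow Γup Bsup / S.kappa c₃ Γup)

/-- The composite states, with their initial times, of all excited runs with the given constants
and comparison functions for which the state stays in `χ`, where the approximation is defined, or
for which the smallness conditions hold that keep `Z` in the ball of radius `ζ`. -/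
def compositeTrajectories (c₃ Γlow Γup Bsup ζ : ℝ) (η₁ η₂ : ℝ → ℝ) :
    Set (ℝ × (ℝ → EuclideanSpace ℝ (Fin n ⊕ Fin L ⊕ Fin L ⊕ Fin p))) :=
  {q | ∃ r : Run n L p, q.2 = S.Z r ∧
    S.ExcitedRun r q.1 c₃ Bsup ∧ r.GainBounds q.1 Γlow Γup ∧ S.Sandwich r q.1 η₁ η₂ ∧
    ((∀ t ≥ q.1, r.x t ∈ S.χ) ∨
      (η₂ ‖S.Z r q.1‖ < η₁ ζ ∧ η₂ (S.mu c₃ Γlow Γup Bsup) < η₁ ζ))}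

end Scheme

end SafeMBRL

end

open SafeMBRL

/-! Safety comes from the blow-up of the barrier. Since `1/α₁(h) ≤ b`, the function `B` tends to
infinity as `h` tends to `0` inside the safe set. Up to a first exit time the state and the actor
weights stay in compact sets, `∇B` is bounded by hypothesis, and the growth condition bounds the
policy. So `B` has a bounded derivative along the run and cannot blow up in finite time
(`forwardInvariant`).

The gain solves a Riccati equation which is linear in `P = Γ⁻¹`: `P' = A - βP`, with `A` the
information matrix. Hence `e^{βt} P` is nondecreasing. Normalization of the regressors bounds `A`,
hence `P` from above, and this prevents `Γ` from becoming singular (`GainFlow.isUnit`); excitation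
over one window bounds `P` from below (`GainFlow.exists_inverse_coercive`). Together these give both
bounds on `Γ`.

The core of the last part is the estimate `V_L' ≤ -κ‖Z‖² + ι` while the state is in `χ`
(`lyapunov_rate_le`). The HJB equation produces `-xᵀQx` from `V*`, and it expresses the Bellman
error through the weight errors and the residual `Δ` (`bellman_error_eq`). The product of the critic
error with the quadratic form `G_φ` of the actor error cancels against the actor law
(`regressorTerm_eq`), and every other factor `ω/ρ²` is at most `3√3/(16√γ_c)`. Damping of the critic
error comes from pointwise excitation at the extrapolated points and from the forgetting factor. The
damping of each weight or parameter error is split: one half absorbs the linear terms and leaves a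
constant in `ι`, one quarter dominates the cross terms because `M` is positive definite, and one
quarter remains for `κ`.

Above the level `η₂(√(2ι/κ))` one has `κ‖Z‖² > 2ι`, so `V_L` falls at rate at least `ι` and goes
below the level after a time controlled by the initial norm alone (`lyap_le`). This needs the state
in `χ`, which the smallness conditions secure by a first-exit argument (`norm_Z_lt`). Switching
instants are harmless, since a continuous function with finitely many exceptional times obeys the
usual comparison inequalities. -/

namespace SafeMBRL

/-! ### Scalar comparison lemmas with finitely many exceptional times -/

section Comparison

open MeasureTheory

variable {F F' φ : ℝ → ℝ} {D : Set ℝ} {a b : ℝ}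

/-- Strong induction on the number of exceptional times: splitting at one of them leaves strictly
fewer in each open half, and continuity joins the halves. Only the majorant has to be integrable,
not the derivative itself. -/
theorem sub_le_integral_of_hasDerivAt_off_finite (hab : a ≤ b) (hD : (D ∩ Ioo a b).Finite)
    (hF : ContinuousOn F (Icc a b)) (hd : ∀ t ∈ Ioo a b, t ∉ D → HasDerivAt F (F' t) t)
    (hφ : IntegrableOn φ (Icc a b)) (hle : ∀ t ∈ Ioo a b, t ∉ D → F' t ≤ φ t) :
    F b - F a ≤ ∫ t in a..b, φ t := by
  induction hk : (D ∩ Ioo a b).ncard using Nat.strong_induction_on generalizing a b with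
  | _ k ih =>
    by_cases hne : ∃ d, d ∈ D ∩ Ioo a b
    · obtain ⟨d, hdD, had, hdb⟩ := hne
      have hc1 : Icc a d ⊆ Icc a b := Icc_subset_Icc_right hdb.le
      have hc2 : Icc d b ⊆ Icc a b := Icc_subset_Icc_left had.le
      have ho1 : Ioo a d ⊆ Ioo a b := Ioo_subset_Ioo_right hdb.le
      have ho2 : Ioo d b ⊆ Ioo a b := Ioo_subset_Ioo_left had.le
      have key : ∀ J : Set ℝ, J ⊆ Ioo a b → d ∉ J → (D ∩ J).ncard < k := fun J hJ hdJ => by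
        rw [← hk]
        refine ncard_lt_ncard ⟨inter_subset_inter_right _ hJ, fun h => ?_⟩ hD
        exact hdJ (h ⟨hdD, had, hdb⟩).2
      have h1 := ih _ (key _ ho1 (by simp)) had.le (hD.subset (inter_subset_inter_right _ ho1))
        (hF.mono hc1) (fun t ht => hd t (ho1 ht)) (hφ.mono_set hc1)
        (fun t ht => hle t (ho1 ht)) rfl
      have h2 := ih _ (key _ ho2 (by simp)) hdb.le (hD.subset (inter_subset_inter_right _ ho2))
        (hF.mono hc2) (fun t ht => hd t (ho2 ht)) (hφ.mono_set hc2)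
        (fun t ht => hle t (ho2 ht)) rfl
      have hi1 : IntervalIntegrable φ volume a d :=
        (intervalIntegrable_iff_integrableOn_Icc_of_le had.le).2 (hφ.mono_set hc1)
      have hi2 : IntervalIntegrable φ volume d b :=
        (intervalIntegrable_iff_integrableOn_Icc_of_le hdb.le).2 (hφ.mono_set hc2)
      rw [← intervalIntegral.integral_add_adjacent_intervals hi1 hi2]
      linarith
    · exact intervalIntegral.sub_le_integral_of_hasDeriv_right_of_le hab hF
        (fun t ht => (hd t ht fun h => hne ⟨t, h, ht⟩).hasDerivWithinAt) hφ
        (fun t ht => hle t ht fun h => hne ⟨t, h, ht⟩)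

theorem integral_le_sub_of_hasDerivAt_off_finite (hab : a ≤ b) (hD : (D ∩ Ioo a b).Finite)
    (hF : ContinuousOn F (Icc a b)) (hd : ∀ t ∈ Ioo a b, t ∉ D → HasDerivAt F (F' t) t)
    (hφ : IntegrableOn φ (Icc a b)) (hle : ∀ t ∈ Ioo a b, t ∉ D → φ t ≤ F' t) :
    ∫ t in a..b, φ t ≤ F b - F a := by
  have h := sub_le_integral_of_hasDerivAt_off_finite (F := fun t => -F t) (F' := fun t => -F' t)
    (φ := fun t => -φ t) hab hD hF.neg (fun t ht h => (hd t ht h).neg) hφ.neg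
    (fun t ht h => neg_le_neg (hle t ht h))
  rw [intervalIntegral.integral_neg] at h
  linarith

theorem sub_le_mul_of_deriv_le_off_finite {C : ℝ} (hab : a ≤ b) (hD : (D ∩ Ioo a b).Finite)
    (hF : ContinuousOn F (Icc a b)) (hd : ∀ t ∈ Ioo a b, t ∉ D → HasDerivAt F (F' t) t)
    (hle : ∀ t ∈ Ioo a b, t ∉ D → F' t ≤ C) : F b - F a ≤ C * (b - a) := by
  have h := sub_le_integral_of_hasDerivAt_off_finite (φ := fun _ => C) hab hD hF hd
    (by simp) hle
  simpa [mul_comm] using h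

theorem abs_sub_le_mul_of_abs_deriv_le_off_finite {C : ℝ} (hab : a ≤ b)
    (hD : (D ∩ Ioo a b).Finite) (hF : ContinuousOn F (Icc a b))
    (hd : ∀ t ∈ Ioo a b, t ∉ D → HasDerivAt F (F' t) t)
    (hle : ∀ t ∈ Ioo a b, t ∉ D → |F' t| ≤ C) : |F b - F a| ≤ C * (b - a) := by
  have h1 := sub_le_mul_of_deriv_le_off_finite hab hD hF hd
    fun t ht h => (le_abs_self _).trans (hle t ht h)
  have h2 := sub_le_mul_of_deriv_le_off_finite (F := fun t => -F t) hab hD hF.neg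
    (fun t ht h => (hd t ht h).neg) fun t ht h => (neg_le_abs _).trans (hle t ht h)
  exact abs_le.2 ⟨by linarith, h1⟩

/-- If `F` decreases at rate at least `ι` while it is above the level `m`, it reaches this level in
finite time and stays below. -/
theorem le_max_of_decreasing_above {m ι : ℝ} (hab : a ≤ b) (hD : (D ∩ Ioo a b).Finite)
    (hι : 0 ≤ ι) (hF : ContinuousOn F (Icc a b))
    (hd : ∀ t ∈ Ioo a b, t ∉ D → HasDerivAt F (F' t) t)
    (hle : ∀ t ∈ Ioo a b, t ∉ D → m < F t → F' t ≤ -ι) :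
    F b ≤ max m (F a - ι * (b - a)) := by
  by_contra! hcon
  obtain ⟨hm, hlt⟩ := max_lt_iff.1 hcon
  have decr : ∀ s ∈ Icc a b, (∀ t ∈ Ioo s b, m < F t) → F b ≤ F s - ι * (b - s) := by
    intro s hs habove
    have := sub_le_mul_of_deriv_le_off_finite (C := -ι) hs.2
      (hD.subset (inter_subset_inter_right _ (Ioo_subset_Ioo_left hs.1)))
      (hF.mono (Icc_subset_Icc_left hs.1)) (fun t ht => hd t ⟨hs.1.trans_lt ht.1, ht.2⟩)
      (fun t ht h => hle t ⟨hs.1.trans_lt ht.1, ht.2⟩ h (habove t ht))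
    linarith
  -- After the last time at or below the level the function only decreases, so it could not end
  -- above; if there is no such time, the decrease acts on the whole interval.
  by_cases hex : ∃ s ∈ Icc a b, F s ≤ m
  · have hcl : IsCompact (Icc a b ∩ F ⁻¹' Iic m) :=
      isCompact_Icc.of_isClosed_subset (hF.preimage_isClosed_of_isClosed isClosed_Icc isClosed_Iic)
        inter_subset_left
    obtain ⟨s, ⟨hs, hsm⟩, hmax⟩ := hcl.exists_isGreatest (by
      obtain ⟨s, hs, h⟩ := hex
      exact ⟨s, hs, h⟩)
    have := decr s hs fun t ht => by
      by_contra! h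
      exact absurd (hmax ⟨⟨hs.1.trans ht.1.le, ht.2.le⟩, h⟩) (not_le.2 ht.1)
    have h0 : 0 ≤ ι * (b - s) := mul_nonneg hι (sub_nonneg.2 hs.2)
    have : F s ≤ m := hsm
    linarith
  · push Not at hex
    have := decr a ⟨le_rfl, hab⟩ fun t ht => hex t ⟨ht.1.le, ht.2.le⟩
    linarith

end Comparison

/-! ### Linear algebra -/

section LinearAlgebra

/-- The real spectrum of a matrix is finite, so its infimum is a genuine lower bound for all
eigenvalues. -/
theorem dotProduct_mulVec_nonneg_of_lambdaMin_pos {k : ℕ} {A : Matrix (Fin k) (Fin k) ℝ}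
    (hA : A.IsHermitian) (h : 0 < lambdaMin A) (z : Fin k → ℝ) : 0 ≤ z ⬝ᵥ (A.mulVec z) := by
  have hfin : (spectrum ℝ A).Finite := Matrix.finite_real_spectrum
  have hpd : A.PosDef := hA.posDef_iff_eigenvalues_pos.2 fun i =>
    h.trans_le (csInf_le hfin.bddBelow (hA.eigenvalues_mem_spectrum_real i))
  simpa using hpd.posSemidef.dotProduct_mulVec_nonneg z

variable {k : ℕ} {A : E k →L[ℝ] E k}

theorem isUnit_of_injective (h : Function.Injective A) : IsUnit A := by
  rw [ContinuousLinearMap.isUnit_iff_bijective]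
  exact ⟨h, LinearMap.injective_iff_surjective.1 h⟩

theorem PosDefOp.isUnit (hA : PosDefOp A) : IsUnit A :=
  isUnit_of_injective <| (injective_iff_map_eq_zero A).2 fun v hv => by
    by_contra hne
    have := hA.2 v hne
    simp [hv] at this

theorem apply_inverse_of_isUnit (hA : IsUnit A) (v : E k) : A (A.inverse v) = v := by
  rw [← ContinuousLinearMap.ringInverse_eq_inverse]
  simpa using DFunLike.congr_fun (Ring.mul_inverse_cancel A hA) v

theorem inverse_apply_of_isUnit (hA : IsUnit A) (v : E k) : A.inverse (A v) = v := by
  rw [← ContinuousLinearMap.ringInverse_eq_inverse]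
  simpa using DFunLike.congr_fun (Ring.inverse_mul_cancel A hA) v

theorem inner_self_adjoint (hA : IsSelfAdjoint A) (v w : E k) : ⟪A v, w⟫ = ⟪v, A w⟫ := by
  conv_lhs => rw [← hA.adjoint_eq, ContinuousLinearMap.adjoint_inner_left]

theorem inner_inverse_of_isUnit (hA : IsSelfAdjoint A) (hu : IsUnit A) (v w : E k) :
    ⟪A.inverse v, w⟫ = ⟪v, A.inverse w⟫ := by
  conv_lhs => rw [← apply_inverse_of_isUnit hu w]
  rw [← inner_self_adjoint hA, apply_inverse_of_isUnit hu]

theorem hasEigenvector_of_mem_spectrum {μ : ℝ} (h : μ ∈ spectrum ℝ A) :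
    ∃ v, v ≠ 0 ∧ A v = μ • v := by
  by_contra! hcon
  refine h ((isUnit_of_injective (A := algebraMap ℝ (E k →L[ℝ] E k) μ - A)) ?_)
  refine (injective_iff_map_eq_zero _).2 fun v hv => ?_
  by_contra hne
  refine hcon v hne ?_
  have : μ • v - A v = 0 := by simpa [Algebra.algebraMap_eq_smul_one] using hv
  exact (sub_eq_zero.1 this).symm

theorem mem_spectrum_of_apply_eq_smul {μ : ℝ} {v : E k} (hv : v ≠ 0) (h : A v = μ • v) :
    μ ∈ spectrum ℝ A := fun hu =>
  hv <| ((ContinuousLinearMap.isUnit_iff_bijective).1 hu).1 <| by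
    simp [Algebra.algebraMap_eq_smul_one, h]

/-- In finite dimension the infimum of the Rayleigh quotient is an eigenvalue. Nontriviality
matters: on the zero space the spectrum is empty. -/
theorem exists_mem_spectrum_le_rayleigh [Nontrivial (E k)] (hA : IsSelfAdjoint A) :
    ∃ μ ∈ spectrum ℝ A, ∀ v, μ * ‖v‖ ^ 2 ≤ ⟪v, A v⟫ := by
  have hsym : (A : E k →ₗ[ℝ] E k).IsSymmetric := fun v w => inner_self_adjoint hA v w
  obtain ⟨w, hw⟩ := hsym.hasEigenvalue_iInf_of_finiteDimensional.exists_hasEigenvector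
  refine ⟨_, mem_spectrum_of_apply_eq_smul hw.2 hw.apply_eq_smul, fun v => ?_⟩
  rcases eq_or_ne v 0 with rfl | hv
  · simp
  -- The infimum is only known to be a lower bound once the quotient is bounded below, here by
  -- `-‖A‖`.
  have hbdd : BddBelow (range fun x : { x : E k // x ≠ 0 } =>
      RCLike.re (inner ℝ ((A : E k →ₗ[ℝ] E k) x) (x : E k)) / ‖(x : E k)‖ ^ 2) := by
    refine ⟨-‖A‖, ?_⟩
    rintro _ ⟨⟨x, hx⟩, rfl⟩
    have hx' : 0 < ‖x‖ ^ 2 := by positivity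
    simp only [RCLike.re_to_real, ContinuousLinearMap.coe_coe]
    rw [le_div_iff₀ hx']
    have h2 := neg_le_of_abs_le (abs_real_inner_le_norm (A x) x)
    have h3 := mul_le_mul_of_nonneg_right (A.le_opNorm x) (norm_nonneg x)
    nlinarith
  rw [real_inner_comm]
  exact (le_div_iff₀ (by positivity)).1 (ciInf_le hbdd ⟨v, hv⟩)

theorem lambdaMin_mul_norm_sq_le (hA : IsSelfAdjoint A) (v : E k) :
    lambdaMin A * ‖v‖ ^ 2 ≤ ⟪v, A v⟫ := by
  rcases eq_or_ne v 0 with rfl | hv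
  · simp
  have : Nontrivial (E k) := ⟨v, 0, hv⟩
  obtain ⟨μ, hμ, hle⟩ := exists_mem_spectrum_le_rayleigh hA
  have h1 : lambdaMin A ≤ μ := csInf_le (spectrum.isCompact A).bddBelow hμ
  exact (mul_le_mul_of_nonneg_right h1 (by positivity)).trans (hle v)

/-- The spectrum is compact and nonempty, so the infimum is itself an eigenvalue, and testing with
its eigenvector gives the sign. In dimension zero the infimum would be `sInf ∅ = 0`. -/
theorem PosDefOp.lambdaMin_pos (hk : 0 < k) (hA : PosDefOp A) : 0 < lambdaMin A := by
  have : Nonempty (Fin k) := ⟨⟨0, hk⟩⟩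
  obtain ⟨μ, hμ, -⟩ := exists_mem_spectrum_le_rayleigh hA.1
  have hmem : lambdaMin A ∈ spectrum ℝ A := (spectrum.isCompact A).sInf_mem ⟨μ, hμ⟩
  obtain ⟨v, hv, hAv⟩ := hasEigenvector_of_mem_spectrum hmem
  have h := hA.2 v hv
  rw [hAv, inner_smul_right, real_inner_self_eq_norm_sq] at h
  exact pos_of_mul_pos_left h (by positivity)

end LinearAlgebra

/-! ### The quadratic form `G_R` and the Hamilton-Jacobi-Bellman equation -/

namespace Scheme

variable {n m L p N : ℕ} {S : Scheme n m L p N}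

theorem dV_apply (x v : E n) : S.dV x v = ⟪gradient S.V x, v⟫ := by
  simp [gradient, dV]

theorem R_Rinv (hV : S.ValueCondition) (u : E m) : S.R (S.Rinv u) = u :=
  apply_inverse_of_isUnit hV.R_pos.isUnit u

theorem inner_Rinv (hV : S.ValueCondition) (u w : E m) : ⟪S.Rinv u, w⟫ = ⟪u, S.Rinv w⟫ :=
  inner_inverse_of_isUnit hV.R_pos.1 hV.R_pos.isUnit u w

theorem inner_gT (x v : E n) (u : E m) : ⟪S.gT x v, u⟫ = ⟪v, S.g x u⟫ :=
  ContinuousLinearMap.adjoint_inner_left _ _ _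

theorem inner_dphiT (y x v : E n) (w : E L) : ⟪S.dphiT y x w, v⟫ = ⟪w, S.dphi y x v⟫ :=
  ContinuousLinearMap.adjoint_inner_left _ _ _

theorem inner_GR_comm (hV : S.ValueCondition) (y v w : E n) : ⟪S.GR y v, w⟫ = ⟪v, S.GR y w⟫ := by
  simp only [GR, ContinuousLinearMap.comp_apply]
  rw [← inner_gT, ← inner_Rinv hV, real_inner_comm, ← inner_gT, real_inner_comm]

/-- With `w = gᵀv` the form equals `⟪R⁻¹w, R (R⁻¹w)⟫`, so positivity is inherited from `R`. -/
theorem inner_GR_nonneg (hV : S.ValueCondition) (y v : E n) : 0 ≤ ⟪v, S.GR y v⟫ := by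
  simp only [GR, ContinuousLinearMap.comp_apply]
  rw [← inner_gT]
  set w := S.gT y v
  have : w = S.R (S.Rinv w) := (R_Rinv hV w).symm
  conv_rhs => rw [this, R_Rinv hV, real_inner_comm]
  rw [this, R_Rinv hV]
  rcases eq_or_ne (S.Rinv w) 0 with h | h
  · simp [h]
  · have := hV.R_pos.2 _ h
    rw [R_Rinv hV] at this
    exact this.le

/-- The policy `-½ R⁻¹ gᵀ v` has cost `¼ vᵀ G_R v`. -/
theorem inner_policy_cost (hV : S.ValueCondition) (y v : E n) :
    ⟪-((1 / 2 : ℝ) • S.Rinv (S.gT y v)), S.R (-((1 / 2 : ℝ) • S.Rinv (S.gT y v)))⟫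
      = 1 / 4 * ⟪v, S.GR y v⟫ := by
  rw [map_neg, map_smul, R_Rinv hV, inner_neg_neg, inner_smul_left, inner_smul_right,
    real_inner_comm, inner_gT]
  simp only [GR, ContinuousLinearMap.comp_apply, conj_trivial]
  ring

theorem g_policy (y v : E n) :
    S.g y (-((1 / 2 : ℝ) • S.Rinv (S.gT y v))) = -((1 / 2 : ℝ) • S.GR y v) := by
  simp [GR]

/-- The Hamilton-Jacobi-Bellman equation with the minimum evaluated. -/
theorem hjb_eq (hV : S.ValueCondition) (x : E n) :
    ⟪x, S.Q x⟫ = 1 / 4 * ⟪gradient S.V x, S.GR x (gradient S.V x)⟫ - ⟪gradient S.V x, S.f x⟫ := by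
  set v := gradient S.V x with hv
  have hglb := hV.hjb x
  set u₀ : E m := -((1 / 2 : ℝ) • S.Rinv (S.gT x v)) with hu₀
  have h1 := hglb.1 ⟨u₀, rfl⟩
  have hR₀ : S.R u₀ = -((1 / 2 : ℝ) • S.gT x v) := by
    rw [hu₀, map_neg, map_smul, R_Rinv hV]
  -- Completing the square about the minimizer `u₀`. The lower bound at `u₀` and the greatest lower
  -- bound property then force the remaining constant to be zero.
  have key : ∀ u : E m, S.dV x (S.f x) + S.dV x (S.g x u) + S.cost x u
      = ⟪v, S.f x⟫ + ⟪x, S.Q x⟫ - 1 / 4 * ⟪v, S.GR x v⟫ + ⟪u - u₀, S.R (u - u₀)⟫ := by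
    intro u
    have hc : ⟪u₀, S.R u₀⟫ = 1 / 4 * ⟪v, S.GR x v⟫ := inner_policy_cost hV x v
    have h2 : ⟪u, S.R u₀⟫ = -(1 / 2 * ⟪v, S.g x u⟫) := by
      rw [hR₀, inner_neg_right, inner_smul_right, real_inner_comm, inner_gT]
    have h3 : ⟪u₀, S.R u⟫ = -(1 / 2 * ⟪v, S.g x u⟫) := by
      rw [← h2, ← inner_self_adjoint hV.R_pos.1, real_inner_comm]
    rw [map_sub, inner_sub_left, inner_sub_right, inner_sub_right, hc, h2, h3, dV_apply, dV_apply,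
      cost]
    ring
  have h2 : ⟪v, S.f x⟫ + ⟪x, S.Q x⟫ - 1 / 4 * ⟪v, S.GR x v⟫ ≤ 0 := hglb.2 (by
    rintro _ ⟨u, rfl⟩
    simp only [key u]
    rcases eq_or_ne (u - u₀) 0 with h | h
    · simp [h]
    · linarith [hV.R_pos.2 _ h])
  simp only [key u₀] at h1
  simp only [sub_self, inner_zero_left] at h1
  linarith

end Scheme

/-! ### Bounded maps on a set -/

section BddOn

/-- `F` is bounded in norm on `s`. -/
def BddOn {α V : Type*} [Norm V] (s : Set α) (F : α → V) : Prop := ∃ C, ∀ a ∈ s, ‖F a‖ ≤ C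

namespace BddOn

variable {α V V₁ V₂ V₃ : Type*} {s : Set α} [NormedAddCommGroup V]
  [NormedAddCommGroup V₁] [NormedSpace ℝ V₁] [NormedAddCommGroup V₂] [NormedSpace ℝ V₂]
  [NormedAddCommGroup V₃] [NormedSpace ℝ V₃]

/-- The map `u` allows the same bounds to serve for suprema over `x ∈ χ` and for suprema over pairs,
through the two projections. -/
theorem of_continuousOn {X : Type*} [TopologicalSpace X] {K : Set X} (hK : IsCompact K)
    {F : X → V} (hF : ContinuousOn F K) {u : α → X} (hu : MapsTo u s K) :
    BddOn s fun a => F (u a) := by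
  obtain ⟨C, hC⟩ := hK.exists_bound_of_continuousOn hF
  exact ⟨C, fun a ha => hC _ (hu ha)⟩

theorem const (v : V) : BddOn s fun _ => v := ⟨‖v‖, fun _ _ => le_rfl⟩

theorem of_norm_le {W : Type*} [NormedAddCommGroup W] {F : α → V} {G : α → W} (hG : BddOn s G)
    (h : ∀ a ∈ s, ‖F a‖ ≤ ‖G a‖) : BddOn s F := by
  obtain ⟨C, hC⟩ := hG
  exact ⟨C, fun a ha => (h a ha).trans (hC a ha)⟩

theorem norm {F : α → V} (hF : BddOn s F) : BddOn s fun a => ‖F a‖ :=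
  hF.of_norm_le fun _ _ => (norm_norm _).le

theorem add {F G : α → V} (hF : BddOn s F) (hG : BddOn s G) : BddOn s fun a => F a + G a := by
  obtain ⟨C, hC⟩ := hF
  obtain ⟨C', hC'⟩ := hG
  exact ⟨C + C', fun a ha => (norm_add_le _ _).trans (add_le_add (hC a ha) (hC' a ha))⟩

theorem neg {F : α → V} (hF : BddOn s F) : BddOn s fun a => -F a :=
  hF.of_norm_le fun _ _ => (norm_neg _).le

theorem sub {F G : α → V} (hF : BddOn s F) (hG : BddOn s G) : BddOn s fun a => F a - G a := by
  simpa only [sub_eq_add_neg] using hF.add hG.neg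

theorem mul {F G : α → ℝ} (hF : BddOn s F) (hG : BddOn s G) : BddOn s fun a => F a * G a := by
  obtain ⟨C, hC⟩ := hF
  obtain ⟨C', hC'⟩ := hG
  refine ⟨C * C', fun a ha => (norm_mul_le _ _).trans ?_⟩
  exact mul_le_mul (hC a ha) (hC' a ha) (norm_nonneg _) ((norm_nonneg _).trans (hC a ha))

theorem clm_comp {F : α → V₂ →L[ℝ] V₃} {G : α → V₁ →L[ℝ] V₂} (hF : BddOn s F)
    (hG : BddOn s G) : BddOn s fun a => F a ∘L G a :=
  (hF.norm.mul hG.norm).of_norm_le fun a _ => by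
    simpa using (F a).opNorm_comp_le (G a)

theorem clm_apply {F : α → V₁ →L[ℝ] V₂} {G : α → V₁} (hF : BddOn s F)
    (hG : BddOn s G) : BddOn s fun a => F a (G a) :=
  (hF.norm.mul hG.norm).of_norm_le fun a _ => by
    simpa using (F a).le_opNorm (G a)

theorem inner {k : ℕ} {F G : α → E k} (hF : BddOn s F) (hG : BddOn s G) :
    BddOn s fun a => ⟪F a, G a⟫ :=
  (hF.norm.mul hG.norm).of_norm_le fun a _ => by
    simpa using abs_real_inner_le_norm (F a) (G a)

theorem le_sSup_image {F : α → ℝ} (hF : BddOn s F) {a : α} (ha : a ∈ s) :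
    F a ≤ sSup (F '' s) := by
  obtain ⟨C, hC⟩ := hF
  refine le_csSup ⟨C, ?_⟩ ⟨a, ha, rfl⟩
  rintro _ ⟨b, hb, rfl⟩
  exact (le_abs_self _).trans (hC b hb)

end BddOn

end BddOn

theorem norm_le_sum_abs {k : ℕ} (v : E k) : ‖v‖ ≤ ∑ j, |v j| := by
  have h : v = ∑ j, v j • EuclideanSpace.single j (1 : ℝ) := by
    ext i
    simp [Finset.sum_apply, Pi.single_apply]
  conv_lhs => rw [h]
  refine (norm_sum_le _ _).trans (Finset.sum_le_sum fun j _ => ?_)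
  simp [norm_smul]

namespace Scheme

variable {n m L p N : ℕ} {S : Scheme n m L p N}

/-! ### Finiteness of the suprema in the constants -/

theorem hasFDerivAt_kernel (hA : S.Approximation) (j : Fin L) {y c : E n} (hy : y ∈ S.χ)
    (hc : c ∈ S.χ) : HasFDerivAt (fun z => S.φ j z c)
      (fderiv ℝ (fun q : E n × E n => S.φ j q.1 q.2) (y, c) ∘L
        ContinuousLinearMap.inl ℝ (E n) (E n)) y := by
  obtain ⟨O, hO, hχ, hφ⟩ := hA.φ_smooth j
  have hd : DifferentiableAt ℝ (fun q : E n × E n => S.φ j q.1 q.2) (y, c) :=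
    (hφ.differentiableOn (by simp)).differentiableAt
      ((hO.prod hO).mem_nhds ⟨hχ hy, hχ hc⟩)
  have hl : HasFDerivAt (fun z : E n => (z, c)) (ContinuousLinearMap.inl ℝ (E n) (E n)) y :=
    hasFDerivAt_prodMk_left y c
  exact HasFDerivAt.comp (f := fun z : E n => (z, c)) y hd.hasFDerivAt hl

/-- The centres need not depend continuously on the state, so `∇φ(y, c(x))` need not be continuous
in `x`. A bound uniform over all centres in the compact set makes this irrelevant. -/
theorem exists_kernel_deriv_bound (hA : S.Approximation) (j : Fin L) :
    ∃ C, ∀ y ∈ S.χ, ∀ c ∈ S.χ, ‖fderiv ℝ (fun z => S.φ j z c) y‖ ≤ C := by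
  obtain ⟨O, hO, hχ, hφ⟩ := hA.φ_smooth j
  have hcont : ContinuousOn (fderiv ℝ fun q : E n × E n => S.φ j q.1 q.2) (S.χ ×ˢ S.χ) :=
    (hφ.continuousOn_fderiv_of_isOpen (hO.prod hO) (by simp)).mono (prod_mono hχ hχ)
  obtain ⟨C, hC⟩ := (hA.compact.prod hA.compact).exists_bound_of_continuousOn hcont
  refine ⟨C * ‖ContinuousLinearMap.inl ℝ (E n) (E n)‖, fun y hy c hc => ?_⟩
  rw [(hasFDerivAt_kernel hA j hy hc).fderiv]
  exact (ContinuousLinearMap.opNorm_comp_le _ _).trans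
    (mul_le_mul_of_nonneg_right (hC _ ⟨hy, hc⟩) (norm_nonneg _))

theorem differentiableAt_phi (hA : S.Approximation) {y x : E n} (hy : y ∈ S.χ) (hx : x ∈ S.χ) :
    DifferentiableAt ℝ (fun z => S.phi z x) y :=
  (differentiableAt_euclidean).2 fun j =>
    (hasFDerivAt_kernel hA j hy (hA.centre j x hx).1).differentiableAt

theorem dphi_apply (hA : S.Approximation) {y x : E n} (hy : y ∈ S.χ) (hx : x ∈ S.χ) (v : E n)
    (j : Fin L) : S.dphi y x v j = fderiv ℝ (fun z => S.φ j z (S.c j x)) y v := by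
  have h : HasFDerivAt (fun z => S.φ j z (S.c j x)) (EuclideanSpace.proj j ∘L S.dphi y x) y :=
    (EuclideanSpace.proj (𝕜 := ℝ) j).hasFDerivAt.comp y
      (differentiableAt_phi hA hy hx).hasFDerivAt
  rw [h.fderiv]
  rfl

theorem W_contDiffAt (hA : S.Approximation) {x : E n} (hx : x ∈ S.χ) : ContDiffAt ℝ 1 S.W x := by
  obtain ⟨O, hO, hχ, hW⟩ := hA.W_smooth
  exact hW.contDiffAt (hO.mem_nhds (hχ hx))

section Bounded

variable {α : Type*} {s : Set α} {u w : α → E n}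

theorem bddOn_f (hS : S.Assumptions) (hu : MapsTo u s S.χ) : BddOn s fun a => S.f (u a) :=
  BddOn.of_continuousOn hS.approx.compact hS.plant.f_lip.continuous.continuousOn hu

theorem bddOn_g (hS : S.Assumptions) (hu : MapsTo u s S.χ) : BddOn s fun a => S.g (u a) :=
  BddOn.of_continuousOn hS.approx.compact hS.plant.g_lip.continuous.continuousOn hu

theorem bddOn_Y (hS : S.Assumptions) (hu : MapsTo u s S.χ) : BddOn s fun a => S.Y (u a) :=
  BddOn.of_continuousOn hS.approx.compact hS.approx.Y_cont.continuousOn hu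

theorem bddOn_dV (hS : S.Assumptions) (hu : MapsTo u s S.χ) : BddOn s fun a => S.dV (u a) :=
  BddOn.of_continuousOn hS.approx.compact hS.value.grad_lip.continuous.continuousOn hu

theorem bddOn_gradV (hS : S.Assumptions) (hu : MapsTo u s S.χ) :
    BddOn s fun a => gradient S.V (u a) :=
  (bddOn_dV hS hu).of_norm_le fun a _ => by simp [gradient, dV]

theorem bddOn_W (hS : S.Assumptions) (hu : MapsTo u s S.χ) : BddOn s fun a => S.W (u a) :=
  BddOn.of_continuousOn hS.approx.compact
    (fun _ hx => (W_contDiffAt hS.approx hx).continuousAt.continuousWithinAt) hu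

theorem bddOn_dW (hS : S.Assumptions) (hu : MapsTo u s S.χ) : BddOn s fun a => S.dW (u a) := by
  obtain ⟨O, hO, hχ, hW⟩ := hS.approx.W_smooth
  exact BddOn.of_continuousOn hS.approx.compact
    ((hW.continuousOn_fderiv_of_isOpen hO (by simp)).mono hχ) hu

theorem bddOn_dphi (hS : S.Assumptions) (hu : MapsTo u s S.χ) (hw : MapsTo w s S.χ) :
    BddOn s fun a => S.dphi (u a) (w a) := by
  choose C hC using exists_kernel_deriv_bound hS.approx
  refine ⟨∑ j, |C j|, fun a ha => ContinuousLinearMap.opNorm_le_bound _ (by positivity) fun v => ?_⟩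
  refine (norm_le_sum_abs _).trans ?_
  rw [Finset.sum_mul]
  refine Finset.sum_le_sum fun j _ => ?_
  rw [dphi_apply hS.approx (hu ha) (hw ha)]
  refine ((fderiv ℝ (fun z => S.φ j z (S.c j (w a))) (u a)).le_opNorm v).trans ?_
  exact mul_le_mul_of_nonneg_right
    ((hC j _ (hu ha) _ (hS.approx.centre j _ (hw ha)).1).trans (le_abs_self _)) (norm_nonneg _)

theorem bddOn_dphiT (hS : S.Assumptions) (hu : MapsTo u s S.χ) (hw : MapsTo w s S.χ) :
    BddOn s fun a => S.dphiT (u a) (w a) :=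
  (bddOn_dphi hS hu hw).of_norm_le fun a _ => by simp [dphiT]

theorem bddOn_GR (hS : S.Assumptions) (hu : MapsTo u s S.χ) : BddOn s fun a => S.GR (u a) :=
  (bddOn_g hS hu).clm_comp ((BddOn.const S.Rinv).clm_comp
    ((bddOn_g hS hu).of_norm_le fun a _ => by simp [gT]))

theorem bddOn_Gphi (hS : S.Assumptions) (hu : MapsTo u s S.χ) (hw : MapsTo w s S.χ) :
    BddOn s fun a => S.Gphi (u a) (w a) :=
  (bddOn_dphi hS hu hw).clm_comp ((bddOn_GR hS hu).clm_comp (bddOn_dphiT hS hu hw))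

theorem bddOn_Delta (hS : S.Assumptions) (hu : MapsTo u s S.χ) (hw : MapsTo w s S.χ) :
    BddOn s fun a => S.Delta (w a) (u a) := by
  have hq := (bddOn_dphiT hS hu hw).clm_apply (bddOn_W hS hw)
  have he := (bddOn_gradV hS hu).sub hq
  have hG := bddOn_GR hS hu
  have hf := bddOn_f hS hu
  exact ((((BddOn.const (1 / 2 : ℝ)).mul (hq.inner (hG.clm_apply he))).add
    ((BddOn.const (1 / 4 : ℝ)).mul (he.inner (hG.clm_apply he)))).sub (he.inner hf)).sub
    (hq.inner (hf.sub ((bddOn_Y hS hu).clm_apply (BddOn.const S.θ))))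

end Bounded

/-- A real `sSup` of an unbounded set has the default value `0`; boundedness is what makes the
constants true upper bounds. -/
theorem le_sup₁ {F : E n → ℝ} (hF : BddOn S.χ F) {x : E n} (hx : x ∈ S.χ) : F x ≤ S.sup₁ F :=
  hF.le_sSup_image hx

theorem le_sup₂ {F : E n → E n → ℝ} (hF : BddOn (S.χ ×ˢ S.χ) fun q => F q.1 q.2) {x y : E n}
    (hx : x ∈ S.χ) (hy : y ∈ S.χ ∩ Metric.closedBall x S.l) : F x y ≤ S.sup₂ F := by
  obtain ⟨C, hC⟩ := hF
  refine le_csSup ⟨C, ?_⟩ ⟨x, hx, y, hy, rfl⟩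
  rintro _ ⟨x, hx, y, hy, rfl⟩
  exact (le_abs_self _).trans (hC (x, y) ⟨hx, hy.1⟩)

/-- `φᵀ∇W + ∇ε = ∇V* - Wᵀ∇φ`. -/
theorem inner_phi_dW_add_dEps (hS : S.Assumptions) {x : E n} (hx : x ∈ S.χ) :
    innerSL ℝ (S.phi x x) ∘L S.dW x + S.dEps x = S.dV x - innerSL ℝ (S.W x) ∘L S.dphi x x := by
  have hV : HasFDerivAt S.V (S.dV x) x :=
    (hS.value.smooth.differentiable (by simp)).differentiableAt.hasFDerivAt
  have hW : HasFDerivAt S.W (S.dW x) x :=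
    ((W_contDiffAt hS.approx hx).differentiableAt (by simp)).hasFDerivAt
  have hφ : HasFDerivAt (fun z => S.phi z x) (S.dphi x x) x :=
    (differentiableAt_phi hS.approx hx hx).hasFDerivAt
  have h : S.dEps x = _ := (hV.sub (hW.inner ℝ hφ)).fderiv
  rw [h]
  ext v
  simp only [add_apply, sub_apply, ContinuousLinearMap.comp_apply, innerSL_apply_apply,
    fderivInnerCLM_apply, ContinuousLinearMap.prod_apply]
  rw [real_inner_comm (S.phi x x)]
  ring

/-- Neither summand is estimated alone: the sum equals `∇V* - Wᵀ∇φ`, whose terms are already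
bounded. -/
theorem bddOn_phi_dW_add_dEps (hS : S.Assumptions) :
    BddOn S.χ fun x => innerSL ℝ (S.phi x x) ∘L S.dW x + S.dEps x := by
  have hid : MapsTo (fun x => x) S.χ S.χ := fun _ h => h
  have h := (bddOn_dV hS hid).sub
    (((bddOn_W hS hid).of_norm_le (F := fun x => innerSL ℝ (S.W x)) fun _ _ => by simp).clm_comp
      (bddOn_dphi hS hid hid))
  exact h.of_norm_le fun x hx => by rw [inner_phi_dW_add_dEps hS hx]

end Scheme

/-! ### Elementary facts on class `𝒦` and time intervals -/

theorem ClassK.pos {α : ℝ → ℝ} (hα : ClassK α) {s : ℝ} (hs : 0 < s) : 0 < α s := by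
  simpa [hα.2.2] using hα.2.1 (mem_Ici.2 le_rfl) (mem_Ici.2 hs.le) hs

theorem ClassK.nonneg {α : ℝ → ℝ} (hα : ClassK α) {s : ℝ} (hs : 0 ≤ s) : 0 ≤ α s := by
  simpa [hα.2.2] using hα.2.1.monotoneOn (mem_Ici.2 le_rfl) (mem_Ici.2 hs) hs

theorem ClassK.tendsto_nhdsGT_zero {α : ℝ → ℝ} (hα : ClassK α) :
    Tendsto α (𝓝[>] 0) (𝓝[>] 0) := by
  refine tendsto_nhdsWithin_iff.2 ⟨?_, ?_⟩
  · have h := (hα.1 0 (mem_Ici.2 le_rfl)).mono_left (nhdsWithin_mono 0 Ioi_subset_Ici_self)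
    simpa [hα.2.2] using h
  · filter_upwards [self_mem_nhdsWithin] with s hs using hα.pos hs

theorem Icc_subset_timeInterval {t₀ t : ℝ} {τ : EReal} (ht : t ∈ timeInterval t₀ τ) :
    Icc t₀ t ⊆ timeInterval t₀ τ := fun _ hs =>
  ⟨hs.1, (EReal.coe_le_coe_iff.2 hs.2).trans_lt ht.2⟩

theorem mem_timeInterval_top {t₀ t : ℝ} : t ∈ timeInterval t₀ ⊤ ↔ t₀ ≤ t := by
  simp [timeInterval]

namespace Scheme

variable {n m L p N : ℕ} {S : Scheme n m L p N}

/-! ### Forward invariance of the interior of the safe set -/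

theorem hasFDerivAt_B (hS : S.Assumptions) {x : E n} (hx : x ∈ interior S.safe) :
    HasFDerivAt S.B (innerSL ℝ (S.gradB x)) x := by
  have hb : DifferentiableAt ℝ S.b x :=
    (hS.cbf.smooth.differentiableOn (by simp)).differentiableAt (isOpen_interior.mem_nhds hx)
  have hB : DifferentiableAt ℝ S.B x := (hb.sub_const _).pow 2
  have h : innerSL ℝ (S.gradB x) = fderiv ℝ S.B x := by
    ext v
    simp [gradB, gradient]
  exact h ▸ hB.hasFDerivAt

/-- The closed-loop vector field of the plant. -/
theorem plant_field_eq (x : E n) (wa : E L) :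
    S.f x + S.g x (S.policy x wa) = S.f x - (1 / 2 : ℝ) • S.GR x (S.dphiT x x wa)
      - (S.cb / 2) • S.GR x (S.gradB x) := by
  simp only [policy, khat, GR, map_sub, map_neg, map_smul, ContinuousLinearMap.comp_apply]
  abel

/-- The bound must hold up to the boundary of the safe set and outside `χ`, where `∇φ` has no
regularity and `∇B` no continuous extension. The growth condition controls `gᵀ∇φᵀ` and `Bsup`
controls `∇B`; the rest is continuous on `K`. -/
theorem exists_closedLoop_bound (hS : S.Assumptions) {K : Set (E n)} (hK : IsCompact K)
    (Ca Bsup : ℝ) : ∃ C, ∀ x ∈ K, x ∈ interior S.safe → ∀ wa : E L, ‖wa‖ ≤ Ca →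
      ‖S.gradB x‖ ≤ Bsup → ‖S.f x + S.g x (S.policy x wa)‖ ≤ C := by
  obtain ⟨Cf, hCf⟩ := hK.exists_bound_of_continuousOn hS.plant.f_lip.continuous.continuousOn
  obtain ⟨Cg, hCg⟩ := hK.exists_bound_of_continuousOn hS.plant.g_lip.continuous.continuousOn
  obtain ⟨Rx, hRx⟩ := hK.exists_bound_of_continuousOn (f := fun x => x) continuousOn_id
  obtain ⟨ℓ, hℓpos, hℓmono, hℓ, -⟩ := hS.policy_growth
  refine ⟨Cf + Cg * (1 / 2 * (‖S.Rinv‖ * (ℓ Rx * Rx * Ca)) + S.cb / 2 * (‖S.Rinv‖ * (Cg * Bsup))),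
    fun x hx hint wa hwa hB => ?_⟩
  have hg := hCg x hx
  have hR := hRx x hx
  have hCg0 : 0 ≤ Cg := (norm_nonneg _).trans hg
  have hR0 : 0 ≤ Rx := (norm_nonneg _).trans hR
  have hℓ0 := hℓpos Rx hR0
  have h1 : ‖S.gT x (S.dphiT x x wa)‖ ≤ ℓ Rx * Rx * Ca := by
    -- Monotonicity of `ℓ` turns the pointwise growth bound into one on the whole ball of radius
    -- `Rx`.
    have h2 := (hℓ x (interior_subset hint)).trans
      (mul_le_mul (hℓmono (mem_Ici.2 (norm_nonneg x)) (mem_Ici.2 hR0) hR) hR (norm_nonneg _) hℓ0.le)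
    exact ((S.gT x ∘L S.dphiT x x).le_opNorm wa).trans
      (mul_le_mul h2 hwa (norm_nonneg _) (by positivity))
  have h2 : ‖S.gT x (S.gradB x)‖ ≤ Cg * Bsup := by
    refine ((S.gT x).le_opNorm _).trans (mul_le_mul ?_ hB (norm_nonneg _) hCg0)
    simpa [gT] using hg
  have h3 : ‖S.policy x wa‖ ≤ 1 / 2 * (‖S.Rinv‖ * (ℓ Rx * Rx * Ca))
      + S.cb / 2 * (‖S.Rinv‖ * (Cg * Bsup)) := by
    have hcb := hS.gains.cb_pos
    refine (norm_sub_le _ _).trans (add_le_add ?_ ?_)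
    · rw [khat, norm_neg, norm_smul, Real.norm_of_nonneg (by norm_num)]
      gcongr
      exact (S.Rinv.le_opNorm _).trans (by gcongr)
    · rw [norm_smul, Real.norm_of_nonneg (by positivity)]
      gcongr
      exact (S.Rinv.le_opNorm _).trans (by gcongr)
  refine (norm_add_le _ _).trans (add_le_add (hCf x hx) ?_)
  exact ((S.g x).le_opNorm _).trans (mul_le_mul hg h3 (norm_nonneg _) hCg0)

/-- Since `α₁(h)` tends to zero from above, its inverse, a lower bound of `b`, tends to infinity;
recentring and squaring preserve this. -/
theorem tendsto_B_atTop (hS : S.Assumptions) {ι : Type*} {l : Filter ι} {x : ι → E n}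
    (hx : ∀ᶠ i in l, x i ∈ interior S.safe) (h0 : Tendsto (fun i => S.h (x i)) l (𝓝 0)) :
    Tendsto (fun i => S.B (x i)) l atTop := by
  obtain ⟨α₁, α₂, hα₁, -, hb⟩ := hS.cbf.bounds
  have h1 : Tendsto (fun i => S.h (x i)) l (𝓝[>] 0) := by
    refine tendsto_nhdsWithin_iff.2 ⟨h0, ?_⟩
    filter_upwards [hx] with i hi
    rwa [hS.safeSet.inside] at hi
  have h2 : Tendsto (fun i => S.b (x i)) l atTop := by
    refine tendsto_atTop_mono' l ?_ ((hα₁.tendsto_nhdsGT_zero.comp h1).inv_tendsto_nhdsGT_zero)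
    filter_upwards [hx] with i hi
    simpa using (hb _ hi).1
  exact (tendsto_pow_atTop two_ne_zero).comp (tendsto_atTop_add_const_right _ (-S.b 0) h2)

/-- At a first exit time `h` vanishes by continuity, so `B` blows up from the left. Yet `B' = ⟪∇B,
ẋ⟫` is bounded before that time, so `B` grows at most linearly. -/
theorem forwardInvariant (hS : S.Assumptions) : S.ForwardInvariant := by
  intro r t₀ τ _ hsol hinit ⟨Bsup, hBsup⟩ t₁ ht₁
  by_contra hout
  have hcont : ContinuousOn (fun t => S.h (r.x t)) (Icc t₀ t₁) :=
    hS.safeSet.h_smooth.continuous.comp_continuousOn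
      (hsol.x_cont.mono (Icc_subset_timeInterval ht₁))
  have hmem : ∀ x, x ∈ interior S.safe ↔ 0 < S.h x := fun x => by rw [hS.safeSet.inside]; rfl
  have hcl : IsCompact (Icc t₀ t₁ ∩ (fun t => S.h (r.x t)) ⁻¹' Iic 0) :=
    isCompact_Icc.of_isClosed_subset
      (hcont.preimage_isClosed_of_isClosed isClosed_Icc isClosed_Iic) inter_subset_left
  -- The first exit time exists because the set of times in `[t₀, t₁]` with `h ≤ 0` is compact.
  obtain ⟨t, ⟨htI, hth⟩, hmin⟩ := hcl.exists_isLeast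
    ⟨t₁, ⟨ht₁.1, le_rfl⟩, not_lt.1 fun h => hout ((hmem _).2 h)⟩
  have hth : S.h (r.x t) ≤ 0 := hth
  have hin : ∀ s ∈ Ico t₀ t, r.x s ∈ interior S.safe := fun s hs => by
    by_contra h
    exact absurd (hmin ⟨⟨hs.1, hs.2.le.trans htI.2⟩, not_lt.1 fun h' => h ((hmem _).2 h')⟩)
      (not_le.2 hs.2)
  have hlt : t₀ < t := lt_of_le_of_ne htI.1 fun h => by
    rw [hmem, h] at hinit
    exact absurd hinit (not_lt.2 hth)
  have hI : Icc t₀ t ⊆ timeInterval t₀ τ :=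
    (Icc_subset_Icc_right htI.2).trans (Icc_subset_timeInterval ht₁)
  have hle : 𝓝[<] t ≤ 𝓝[Icc t₀ t] t := by
    rw [← nhdsWithin_Ioo_eq_nhdsLT hlt]
    exact nhdsWithin_mono _ Ioo_subset_Icc_self
  have hev : ∀ᶠ s in 𝓝[<] t, s ∈ Ioo t₀ t := Ioo_mem_nhdsLT hlt
  have htend : Tendsto (fun s => S.h (r.x s)) (𝓝[<] t) (𝓝 (S.h (r.x t))) :=
    ((hcont.mono (Icc_subset_Icc_right htI.2)) t ⟨hlt.le, le_rfl⟩).mono_left hle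
  have hzero : S.h (r.x t) = 0 := le_antisymm hth <|
    ge_of_tendsto htend (hev.mono fun s hs => ((hmem _).1 (hin s ⟨hs.1.le, hs.2⟩)).le)
  have hBtop : Tendsto (fun s => S.B (r.x s)) (𝓝[<] t) atTop :=
    tendsto_B_atTop hS (hev.mono fun s hs => hin s ⟨hs.1.le, hs.2⟩) (hzero ▸ htend)
  obtain ⟨D, hD, hode⟩ := hsol.ode
  have hxc := hsol.x_cont.mono hI
  obtain ⟨Ca, hCa⟩ := isCompact_Icc.exists_bound_of_continuousOn (hsol.Wa_cont.mono hI)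
  obtain ⟨C, hC⟩ := exists_closedLoop_bound hS (isCompact_Icc.image_of_continuousOn hxc) Ca Bsup
  have hbound : ∀ s ∈ Ioo t₀ t, S.B (r.x s) ≤ S.B (r.x t₀) + |Bsup * C| * (t - t₀) := by
    intro s hs
    have hBc : ContinuousOn (fun u => S.B (r.x u)) (Icc t₀ s) := fun u hu =>
      (hasFDerivAt_B hS (hin u ⟨hu.1, hu.2.trans_lt hs.2⟩)).continuousAt.comp_continuousWithinAt
        (hxc.mono (Icc_subset_Icc_right hs.2.le) u hu)
    have hder : ∀ u ∈ Ioo t₀ s, u ∉ D → HasDerivAt (fun u => S.B (r.x u))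
        ⟪S.gradB (r.x u), S.f (r.x u) + S.g (r.x u) (S.policy (r.x u) (r.Wa u))⟫ u := by
      intro u hu huD
      have hui := hin u ⟨hu.1.le, hu.2.trans hs.2⟩
      exact (hasFDerivAt_B hS hui).comp_hasDerivAt u
        (hode u (hI ⟨hu.1.le, (hu.2.trans hs.2).le⟩) hu.1 huD hui).1
    have h := sub_le_mul_of_deriv_le_off_finite (C := |Bsup * C|) hs.1.le
      ((hD s).subset (inter_subset_inter_right _ Ioo_subset_Icc_self)) hBc hder (by
        intro u hu huD
        have huI : u ∈ Icc t₀ t := ⟨hu.1.le, (hu.2.trans hs.2).le⟩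
        have hui := hin u ⟨hu.1.le, hu.2.trans hs.2⟩
        have hB := hBsup u (hI huI) hui
        refine (real_inner_le_norm _ _).trans ((mul_le_mul hB
          (hC _ ⟨u, huI, rfl⟩ hui _ (hCa u huI) hB) (norm_nonneg _)
          ((norm_nonneg _).trans hB)).trans (le_abs_self _)))
    have h' : |Bsup * C| * (s - t₀) ≤ |Bsup * C| * (t - t₀) := by
      gcongr
      exact hs.2.le
    linarith
  obtain ⟨s, hs, hs'⟩ := (hev.and (hBtop.eventually_gt_atTop
    (S.B (r.x t₀) + |Bsup * C| * (t - t₀)))).exists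
  exact absurd (hbound s hs) (not_le.2 hs')

end Scheme

/-! ### The least-squares gain -/

theorem PosDefOp.inverse {k : ℕ} {A : E k →L[ℝ] E k} (hA : PosDefOp A) : PosDefOp A.inverse := by
  refine ⟨?_, fun v hv => ?_⟩
  · rw [ContinuousLinearMap.isSelfAdjoint_iff_isSymmetric]
    exact fun v w => inner_inverse_of_isUnit hA.1 hA.isUnit v w
  · have hw : A.inverse v ≠ 0 := fun h => hv <| by
      rw [← apply_inverse_of_isUnit hA.isUnit v, h, map_zero]
    have := hA.2 _ hw
    rwa [apply_inverse_of_isUnit hA.isUnit, real_inner_comm] at this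

theorem PosDefOp.exists_coercive {k : ℕ} {A : E k →L[ℝ] E k} (hA : PosDefOp A) :
    ∃ c > 0, ∀ v, c * ‖v‖ ^ 2 ≤ ⟪v, A v⟫ := by
  rcases Nat.eq_zero_or_pos k with rfl | hk
  · exact ⟨1, one_pos, fun v => by simp [Subsingleton.elim v 0]⟩
  · exact ⟨_, hA.lambdaMin_pos hk, lambdaMin_mul_norm_sq_le hA.1⟩

/-- `Γ` solves `Γ' = β Γ - Γ A Γ` on `[t₀, ∞)` off a locally finite set, where `A` is symmetric,
positive semidefinite and bounded by `K`. -/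
structure GainFlow {k : ℕ} (Γ A : ℝ → (E k →L[ℝ] E k)) (β t₀ K : ℝ) (D : Set ℝ) : Prop where
  cont : ContinuousOn Γ (Ici t₀)
  init : PosDefOp (Γ t₀)
  finite : ∀ s, (D ∩ Icc t₀ s).Finite
  symm : ∀ t v w, ⟪v, A t w⟫ = ⟪w, A t v⟫
  psd : ∀ t v, 0 ≤ ⟪v, A t v⟫
  bound : ∀ t v w, ⟪v, A t w⟫ ≤ K * (‖v‖ * ‖w‖)
  bound_nonneg : 0 ≤ K
  rate_pos : 0 < β
  ode : ∀ t > t₀, t ∉ D → HasDerivAt Γ (β • Γ t - Γ t ∘L A t ∘L Γ t) t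

namespace GainFlow

variable {k : ℕ} {Γ A : ℝ → (E k →L[ℝ] E k)} {β t₀ K : ℝ} {D : Set ℝ}

/-- The derivative of inversion turns `Γ'` into `-Γ⁻¹ Γ' Γ⁻¹`, and the Riccati equation becomes
linear. -/
theorem hasDerivAt_inverse (h : GainFlow Γ A β t₀ K D) {t : ℝ} (ht : t₀ < t) (htD : t ∉ D)
    (hu : IsUnit (Γ t)) :
    HasDerivAt (fun s => (Γ s).inverse) (A t - β • (Γ t).inverse) t := by
  obtain ⟨u, hu'⟩ := hu
  have hi := (hasFDerivAt_ringInverse (𝕜 := ℝ) u)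
  rw [hu'] at hi
  have hd := hi.comp_hasDerivAt t (h.ode t ht htD)
  have hinv : (↑u⁻¹ : E k →L[ℝ] E k) = (Γ t).inverse := by
    rw [← ContinuousLinearMap.ringInverse_eq_inverse, ← hu', Ring.inverse_unit]
  have hun : IsUnit (Γ t) := ⟨u, hu'⟩
  have : (Ring.inverse ∘ Γ) = fun s => (Γ s).inverse := by
    funext s
    simp [← ContinuousLinearMap.ringInverse_eq_inverse]
  rw [this] at hd
  refine hd.congr_deriv ?_
  ext1 v
  rw [hinv]
  simp [ContinuousLinearMap.mulLeftRight_apply, inverse_apply_of_isUnit hun,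
    apply_inverse_of_isUnit hun]

/-- The integrating factor removes the decay term. The offset `C` lets one formula serve for upper
bounds, symmetry and monotonicity. -/
theorem hasDerivAt_exp_inner (h : GainFlow Γ A β t₀ K D) {t : ℝ} (ht : t₀ < t) (htD : t ∉ D)
    (hu : IsUnit (Γ t)) (v w : E k) (C : ℝ) :
    HasDerivAt (fun s => Real.exp (β * s) * (⟪v, (Γ s).inverse w⟫ - C))
      (Real.exp (β * t) * (⟪v, A t w⟫ - β * C)) t := by
  have h1 : HasDerivAt (fun s => Real.exp (β * s)) (Real.exp (β * t) * β) t := by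
    simpa using ((hasDerivAt_id t).const_mul β).exp
  have h2 : HasDerivAt (fun s => ⟪v, (Γ s).inverse w⟫)
      ⟪v, (A t - β • (Γ t).inverse) w⟫ t := by
    have h3 := (h.hasDerivAt_inverse ht htD hu).clm_apply (hasDerivAt_const t w)
    have h4 := (hasDerivAt_const t v).inner ℝ h3
    refine h4.congr_deriv ?_
    simp
  refine (h1.mul (h2.sub_const C)).congr_deriv ?_
  simp only [sub_apply, smul_apply, inner_sub_right, inner_smul_right]
  ring

theorem continuousOn_inverse (h : GainFlow Γ A β t₀ K D) {s : Set ℝ} (hs : s ⊆ Ici t₀)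
    (hu : ∀ t ∈ s, IsUnit (Γ t)) : ContinuousOn (fun t => (Γ t).inverse) s := by
  intro t ht
  obtain ⟨u, hu'⟩ := hu t ht
  have hc := (NormedRing.inverse_continuousAt u)
  rw [hu'] at hc
  have := ContinuousAt.comp_continuousWithinAt hc (h.cont.mono hs t ht)
  rw [ContinuousLinearMap.ringInverse_eq_inverse] at this
  exact this

theorem continuousOn_exp_inner (h : GainFlow Γ A β t₀ K D) {s : Set ℝ} (hs : s ⊆ Ici t₀)
    (hu : ∀ t ∈ s, IsUnit (Γ t)) (v w : E k) (C : ℝ) :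
    ContinuousOn (fun s => Real.exp (β * s) * (⟪v, (Γ s).inverse w⟫ - C)) s := by
  have h1 : ContinuousOn (fun t => (Γ t).inverse w) s :=
    (h.continuousOn_inverse hs hu).clm_apply continuousOn_const
  have h2 : ContinuousOn (fun t => ⟪v, (Γ t).inverse w⟫) s := continuousOn_const.inner h1
  have h3 : ContinuousOn (fun t => Real.exp (β * t)) s := by fun_prop
  exact h3.mul (h2.sub continuousOn_const)

/-- The offset `C = K‖v‖‖w‖/β` is the equilibrium of the comparison equation, so `e^{βs}(⟪v, P w⟫ -
C)` cannot increase. Invertibility up to time `t` is assumed because this estimate is what proves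
it. -/
theorem inner_inverse_le (h : GainFlow Γ A β t₀ K D) {t : ℝ} (ht : t₀ ≤ t)
    (hu : ∀ s ∈ Icc t₀ t, IsUnit (Γ s)) (v w : E k) :
    ⟪v, (Γ t).inverse w⟫ ≤ (‖(Γ t₀).inverse‖ + K / β) * (‖v‖ * ‖w‖) := by
  have hβ := h.rate_pos
  set C := K / β * (‖v‖ * ‖w‖) with hC
  have hC0 : 0 ≤ C := by have := h.bound_nonneg; positivity
  have hβC : β * C = K * (‖v‖ * ‖w‖) := by rw [hC]; field_simp
  have h1 := sub_le_mul_of_deriv_le_off_finite (C := 0) ht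
    ((h.finite t).subset (inter_subset_inter_right _ Ioo_subset_Icc_self))
    (h.continuousOn_exp_inner Icc_subset_Ici_self hu v w C)
    (fun s hs hsD => h.hasDerivAt_exp_inner hs.1 hsD (hu s (Ioo_subset_Icc_self hs)) v w C)
    (fun s hs _ => mul_nonpos_of_nonneg_of_nonpos (Real.exp_pos _).le
      (by rw [hβC]; linarith [h.bound s v w]))
  have he : Real.exp (β * t₀) ≤ Real.exp (β * t) :=
    Real.exp_le_exp.2 (mul_le_mul_of_nonneg_left ht hβ.le)
  have h2 : ⟪v, (Γ t₀).inverse w⟫ ≤ ‖(Γ t₀).inverse‖ * (‖v‖ * ‖w‖) := by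
    refine (real_inner_le_norm _ _).trans ?_
    have := mul_le_mul_of_nonneg_left ((Γ t₀).inverse.le_opNorm w) (norm_nonneg v)
    linarith
  have h3 : 0 ≤ ‖(Γ t₀).inverse‖ * (‖v‖ * ‖w‖) := by positivity
  have h4 : Real.exp (β * t) * (⟪v, (Γ t).inverse w⟫ - C)
      ≤ Real.exp (β * t) * (‖(Γ t₀).inverse‖ * (‖v‖ * ‖w‖)) := by
    have h5 : Real.exp (β * t₀) * (⟪v, (Γ t₀).inverse w⟫ - C)
        ≤ Real.exp (β * t₀) * (‖(Γ t₀).inverse‖ * (‖v‖ * ‖w‖)) :=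
      mul_le_mul_of_nonneg_left (by linarith) (Real.exp_pos _).le
    have h6 := mul_le_mul_of_nonneg_right he h3
    linarith
  have := le_of_mul_le_mul_left h4 (Real.exp_pos _)
  rw [add_mul]
  linarith

theorem norm_inverse_le (h : GainFlow Γ A β t₀ K D) {t : ℝ} (ht : t₀ ≤ t)
    (hu : ∀ s ∈ Icc t₀ t, IsUnit (Γ s)) : ‖(Γ t).inverse‖ ≤ ‖(Γ t₀).inverse‖ + K / β := by
  have hβ := h.rate_pos
  have hK := h.bound_nonneg
  refine ContinuousLinearMap.opNorm_le_bound _ (by positivity) fun w => ?_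
  have h1 := h.inner_inverse_le ht hu ((Γ t).inverse w) w
  rw [real_inner_self_eq_norm_sq] at h1
  rcases (norm_nonneg ((Γ t).inverse w)).eq_or_lt with h0 | h0
  · rw [← h0]; positivity
  · exact le_of_mul_le_mul_left (by linarith) h0

/-- Before a first singular time the inverses are uniformly bounded, that is `‖v‖ ≤ C‖Γ v‖`. This
inequality passes to the limit and makes `Γ` injective there too. -/
theorem isUnit (h : GainFlow Γ A β t₀ K D) {t : ℝ} (ht : t₀ ≤ t) : IsUnit (Γ t) := by
  by_contra hcon
  have hc : ContinuousOn Γ (Icc t₀ t) := h.cont.mono Icc_subset_Ici_self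
  have hcl : IsCompact (Icc t₀ t ∩ Γ ⁻¹' {B | IsUnit B}ᶜ) :=
    isCompact_Icc.of_isClosed_subset (hc.preimage_isClosed_of_isClosed isClosed_Icc
      Units.isOpen.isClosed_compl) inter_subset_left
  obtain ⟨s, ⟨hsI, hs⟩, hmin⟩ := hcl.exists_isLeast ⟨t, ⟨ht, le_rfl⟩, hcon⟩
  have hun : ∀ u ∈ Ico t₀ s, IsUnit (Γ u) := fun u hu => by
    by_contra hne
    exact absurd (hmin ⟨⟨hu.1, hu.2.le.trans hsI.2⟩, hne⟩) (not_le.2 hu.2)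
  have hlt : t₀ < s := lt_of_le_of_ne hsI.1 fun he => hs (he ▸ h.init.isUnit)
  set C := ‖(Γ t₀).inverse‖ + K / β with hC
  have hbelow : ∀ v, ‖v‖ ≤ C * ‖Γ s v‖ := by
    intro v
    have hle : 𝓝[<] s ≤ 𝓝[Icc t₀ t] s := by
      rw [← nhdsWithin_Ioo_eq_nhdsLT hlt]
      exact nhdsWithin_mono _ (Ioo_subset_Icc_self.trans (Icc_subset_Icc_right hsI.2))
    have htend : Tendsto (fun u => C * ‖Γ u v‖) (𝓝[<] s) (𝓝 (C * ‖Γ s v‖)) :=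
      ((((hc s hsI).clm_apply continuousWithinAt_const).mono_left hle).norm).const_mul C
    refine ge_of_tendsto htend ?_
    filter_upwards [Ioo_mem_nhdsLT hlt] with u hu
    have h1 := h.norm_inverse_le hu.1.le fun w hw => hun w ⟨hw.1, hw.2.trans_lt hu.2⟩
    have h2 := (Γ u).inverse.le_opNorm (Γ u v)
    rw [inverse_apply_of_isUnit (hun u ⟨hu.1.le, hu.2⟩)] at h2
    exact h2.trans (mul_le_mul_of_nonneg_right h1 (norm_nonneg _))
  refine hs (isUnit_of_injective ((injective_iff_map_eq_zero _).2 fun v hv => ?_))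
  have := hbelow v
  rw [hv, norm_zero, mul_zero] at this
  exact norm_le_zero_iff.1 this

/-- As `A` is symmetric, `e^{βs}` times the antisymmetric part of `Γ⁻¹` has zero derivative, and it
vanishes initially. -/
theorem inner_inverse_comm (h : GainFlow Γ A β t₀ K D) {t : ℝ} (ht : t₀ ≤ t) (v w : E k) :
    ⟪v, (Γ t).inverse w⟫ = ⟪w, (Γ t).inverse v⟫ := by
  have hu : ∀ s ∈ Icc t₀ t, IsUnit (Γ s) := fun s hs => h.isUnit hs.1
  have h1 := abs_sub_le_mul_of_abs_deriv_le_off_finite (C := 0) ht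
    ((h.finite t).subset (inter_subset_inter_right _ Ioo_subset_Icc_self))
    ((h.continuousOn_exp_inner Icc_subset_Ici_self hu v w 0).sub
      (h.continuousOn_exp_inner Icc_subset_Ici_self hu w v 0))
    (fun s hs hsD => (h.hasDerivAt_exp_inner hs.1 hsD (h.isUnit hs.1.le) v w 0).sub
      (h.hasDerivAt_exp_inner hs.1 hsD (h.isUnit hs.1.le) w v 0))
    (fun s _ _ => by rw [h.symm s v w]; simp)
  have h0 : ⟪v, (Γ t₀).inverse w⟫ = ⟪w, (Γ t₀).inverse v⟫ := by
    rw [← inner_inverse_of_isUnit h.init.1 h.init.isUnit, real_inner_comm]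
  simp only [Pi.sub_apply, h0, sub_self, sub_zero, zero_mul] at h1
  have h2 := abs_eq_zero.1 (le_antisymm h1 (abs_nonneg _))
  rw [← mul_sub] at h2
  exact sub_eq_zero.1 ((mul_eq_zero.1 h2).resolve_left (Real.exp_pos _).ne')

theorem isSelfAdjoint (h : GainFlow Γ A β t₀ K D) {t : ℝ} (ht : t₀ ≤ t) : IsSelfAdjoint (Γ t) := by
  rw [ContinuousLinearMap.isSelfAdjoint_iff_isSymmetric]
  intro v w
  have hu := h.isUnit ht
  have := h.inner_inverse_comm ht (Γ t v) (Γ t w)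
  rw [inverse_apply_of_isUnit hu, inverse_apply_of_isUnit hu] at this
  rw [ContinuousLinearMap.coe_coe, this, real_inner_comm]

/-- Since `A` is not assumed measurable in time, the increase is measured by an integrable minorant
`ψ`. On the interval the weight `e^{βs}` is at least `e^{βa}`. -/
theorem exp_inner_mono (h : GainFlow Γ A β t₀ K D) {a t : ℝ} (ha : t₀ ≤ a) (hat : a ≤ t)
    (v : E k) {ψ : ℝ → ℝ} (hψ : MeasureTheory.IntegrableOn ψ (Icc a t))
    (hle : ∀ s ∈ Icc a t, ψ s ≤ ⟪v, A s v⟫) :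
    Real.exp (β * a) * ⟪v, (Γ a).inverse v⟫ + Real.exp (β * a) * ∫ s in a..t, ψ s
      ≤ Real.exp (β * t) * ⟪v, (Γ t).inverse v⟫ := by
  have h1 := integral_le_sub_of_hasDerivAt_off_finite (φ := fun s => Real.exp (β * a) * ψ s) hat
    ((h.finite t).subset (inter_subset_inter_right _
      (Ioo_subset_Icc_self.trans (Icc_subset_Icc_left ha))))
    (h.continuousOn_exp_inner (fun s hs => ha.trans hs.1) (fun s hs => h.isUnit (ha.trans hs.1))
      v v 0)
    (fun s hs hsD => h.hasDerivAt_exp_inner (ha.trans_lt hs.1) hsD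
      (h.isUnit (ha.trans hs.1.le)) v v 0)
    (hψ.const_mul _) (fun s hs _ => by
      have he : Real.exp (β * a) ≤ Real.exp (β * s) :=
        Real.exp_le_exp.2 (mul_le_mul_of_nonneg_left hs.1.le h.rate_pos.le)
      have h2 := mul_le_mul_of_nonneg_left (hle s (Ioo_subset_Icc_self hs)) (Real.exp_pos (β * a)).le
      have h3 := mul_le_mul_of_nonneg_right he (h.psd s v)
      simp only [mul_zero, sub_zero]
      exact h2.trans h3)
  rw [intervalIntegral.integral_const_mul] at h1
  simp only [sub_zero] at h1
  linarith

/-- Excitation over windows of length `T` makes `Γ⁻¹` uniformly coercive. -/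
theorem exists_inverse_coercive (h : GainFlow Γ A β t₀ K D) {T c : ℝ} (hT : 0 < T) (hc : 0 < c)
    (hexc : ∀ a ≥ t₀, ∀ v ≠ 0, ∃ ψ : ℝ → ℝ, MeasureTheory.IntegrableOn ψ (Icc a (a + T)) ∧
      (∀ s ∈ Icc a (a + T), ψ s ≤ ⟪v, A s v⟫) ∧ c * ‖v‖ ^ 2 ≤ ∫ s in a..(a + T), ψ s) :
    ∃ q > 0, ∀ t ≥ t₀, ∀ v, q * ‖v‖ ^ 2 ≤ ⟪v, (Γ t).inverse v⟫ := by
  obtain ⟨c₀, hc₀, hcoer⟩ := h.init.inverse.exists_coercive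
  have hβ := h.rate_pos
  have hmono : ∀ a t, t₀ ≤ a → a ≤ t → ∀ v,
      Real.exp (β * a) * ⟪v, (Γ a).inverse v⟫ ≤ Real.exp (β * t) * ⟪v, (Γ t).inverse v⟫ := by
    intro a t ha hat v
    have := h.exp_inner_mono ha hat v (ψ := fun _ => 0) MeasureTheory.integrableOn_zero
      (fun s _ => h.psd s v)
    simpa using this
  have hnonneg : ∀ t ≥ t₀, ∀ v, 0 ≤ ⟪v, (Γ t).inverse v⟫ := fun t ht v => by
    have h1 := hmono t₀ t le_rfl ht v
    have h2 : 0 ≤ ⟪v, (Γ t₀).inverse v⟫ := le_trans (by positivity) (hcoer v)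
    exact nonneg_of_mul_nonneg_right ((mul_nonneg (Real.exp_pos _).le h2).trans h1)
      (Real.exp_pos _)
  -- Looking back by at most `T` costs the factor `e^{-βT}`. The constant `c₀` comes from the
  -- initial gain and serves while less than one window has elapsed; `c` comes from excitation.
  refine ⟨Real.exp (-(β * T)) * min c₀ c, by positivity, fun t ht v => ?_⟩
  rcases eq_or_ne v 0 with rfl | hv
  · simp
  have key : ∀ a, t - T ≤ a → min c₀ c * ‖v‖ ^ 2 * Real.exp (β * a)
      ≤ Real.exp (β * t) * ⟪v, (Γ t).inverse v⟫ →
      Real.exp (-(β * T)) * min c₀ c * ‖v‖ ^ 2 ≤ ⟪v, (Γ t).inverse v⟫ := by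
    intro a ha hle
    have he : Real.exp (β * t) * Real.exp (-(β * T)) ≤ Real.exp (β * a) := by
      rw [← Real.exp_add]
      exact Real.exp_le_exp.2 (by nlinarith)
    have h0 : 0 ≤ min c₀ c * ‖v‖ ^ 2 := by positivity
    have := mul_le_mul_of_nonneg_left he h0
    refine le_of_mul_le_mul_left ?_ (Real.exp_pos (β * t))
    linarith
  have hmin1 : min c₀ c * ‖v‖ ^ 2 ≤ c₀ * ‖v‖ ^ 2 := by gcongr; exact min_le_left _ _
  have hmin2 : min c₀ c * ‖v‖ ^ 2 ≤ c * ‖v‖ ^ 2 := by gcongr; exact min_le_right _ _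
  rcases le_total t (t₀ + T) with htT | htT
  · refine key t₀ (by linarith) ?_
    have h1 := hmono t₀ t le_rfl ht v
    have h2 := mul_le_mul_of_nonneg_left (hmin1.trans (hcoer v)) (Real.exp_pos (β * t₀)).le
    linarith
  · have ha : t₀ ≤ t - T := by linarith
    obtain ⟨ψ, hψ, hle, hint⟩ := hexc (t - T) ha v hv
    rw [sub_add_cancel] at hψ hle hint
    refine key (t - T) le_rfl ?_
    have h1 := h.exp_inner_mono ha (by linarith) v hψ hle
    have h2 := mul_nonneg (Real.exp_pos (β * (t - T))).le (hnonneg _ ha v)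
    have h3 := mul_le_mul_of_nonneg_left (hmin2.trans hint) (Real.exp_pos (β * (t - T))).le
    linarith

/-- Two-sided bounds on the gain from the coercivity of its inverse. -/
theorem exists_bounds (h : GainFlow Γ A β t₀ K D) {q : ℝ} (hq : 0 < q)
    (hcoer : ∀ t ≥ t₀, ∀ v, q * ‖v‖ ^ 2 ≤ ⟪v, (Γ t).inverse v⟫) :
    ∃ low > 0, ∃ up > 0, ∀ t ≥ t₀, ∀ v,
      low * ‖v‖ ^ 2 ≤ ⟪v, Γ t v⟫ ∧ ⟪v, Γ t v⟫ ≤ up * ‖v‖ ^ 2 := by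
  have hβ := h.rate_pos
  have hK := h.bound_nonneg
  -- The added `1` only makes `C` positive, so that division by `C ^ 2` is legitimate.
  set C := ‖(Γ t₀).inverse‖ + K / β + 1 with hC
  have hCpos : 0 < C := by positivity
  refine ⟨q / C ^ 2, by positivity, 1 / q, by positivity, fun t ht v => ?_⟩
  have hu := h.isUnit ht
  have h1 := hcoer t ht (Γ t v)
  rw [inverse_apply_of_isUnit hu, real_inner_comm] at h1
  have h2 : ‖v‖ ≤ C * ‖Γ t v‖ := by
    have h3 := (Γ t).inverse.le_opNorm (Γ t v)
    rw [inverse_apply_of_isUnit hu] at h3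
    refine h3.trans (mul_le_mul_of_nonneg_right ?_ (norm_nonneg _))
    linarith [h.norm_inverse_le ht fun s hs => h.isUnit hs.1]
  constructor
  · refine le_trans ?_ h1
    rw [div_mul_eq_mul_div, div_le_iff₀ (by positivity), mul_assoc]
    refine mul_le_mul_of_nonneg_left ?_ hq.le
    calc ‖v‖ ^ 2 ≤ (C * ‖Γ t v‖) ^ 2 := by gcongr
      _ = _ := by ring
  · have h3 := real_inner_le_norm v (Γ t v)
    have h4 : q * ‖Γ t v‖ ≤ ‖v‖ := by
      rcases (norm_nonneg (Γ t v)).eq_or_lt with h0 | h0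
      · rw [← h0]; simp
      · exact le_of_mul_le_mul_right (by nlinarith) h0
    rw [one_div, inv_mul_eq_div, le_div_iff₀ hq]
    nlinarith [norm_nonneg v]

end GainFlow

/-! ### Consequences of two-sided bounds on an operator for its inverse -/

section OperatorBounds

variable {k : ℕ} {A : E k →L[ℝ] E k} {low up : ℝ}

theorem isUnit_of_coercive (hlow : 0 < low) (h : ∀ v, low * ‖v‖ ^ 2 ≤ ⟪v, A v⟫) : IsUnit A :=
  isUnit_of_injective <| (injective_iff_map_eq_zero A).2 fun v hv => by
    have h1 := h v
    rw [hv, inner_zero_right] at h1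
    have h2 : ‖v‖ ^ 2 ≤ 0 := nonpos_of_mul_nonpos_right h1 hlow
    exact norm_eq_zero.1 (pow_eq_zero_iff two_ne_zero |>.1 (le_antisymm h2 (by positivity)))

theorem norm_inverse_apply_le (hlow : 0 < low) (h : ∀ v, low * ‖v‖ ^ 2 ≤ ⟪v, A v⟫) (v : E k) :
    ‖A.inverse v‖ ≤ ‖v‖ / low := by
  have h1 := h (A.inverse v)
  rw [apply_inverse_of_isUnit (isUnit_of_coercive hlow h)] at h1
  have h2 := real_inner_le_norm (A.inverse v) v
  rw [le_div_iff₀ hlow]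
  rcases (norm_nonneg (A.inverse v)).eq_or_lt with h0 | h0
  · rw [← h0]; simp
  · exact le_of_mul_le_mul_left (by nlinarith) h0

/-- With `w = A⁻¹v`, expand the nonnegative form of `A` at `w - v/up` and use the upper bound at
`v`. -/
theorem norm_sq_div_le_inner_inverse (hA : IsSelfAdjoint A) (hlow : 0 < low) (hup : 0 < up)
    (h : ∀ v, low * ‖v‖ ^ 2 ≤ ⟪v, A v⟫ ∧ ⟪v, A v⟫ ≤ up * ‖v‖ ^ 2) (v : E k) :
    ‖v‖ ^ 2 / up ≤ ⟪v, A.inverse v⟫ := by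
  have hu := isUnit_of_coercive hlow fun v => (h v).1
  set w := A.inverse v with hw
  have hAw : A w = v := apply_inverse_of_isUnit hu v
  have h1 : 0 ≤ ⟪w - (1 / up) • v, A (w - (1 / up) • v)⟫ := le_trans (by positivity) (h _).1
  have h2 := (h v).2
  have h3 : ⟪w, A v⟫ = ‖v‖ ^ 2 := by
    rw [← inner_self_adjoint hA, hAw, real_inner_self_eq_norm_sq]
  rw [map_sub, map_smul, hAw, inner_sub_left, inner_sub_right, inner_sub_right, inner_smul_left,
    inner_smul_left, inner_smul_right, inner_smul_right, h3, real_inner_self_eq_norm_sq,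
    conj_trivial, real_inner_comm] at h1
  have h4 : 1 / up * (1 / up * ⟪v, A v⟫) ≤ ‖v‖ ^ 2 / up := by
    calc 1 / up * (1 / up * ⟪v, A v⟫) ≤ 1 / up * (1 / up * (up * ‖v‖ ^ 2)) := by gcongr
      _ = ‖v‖ ^ 2 / up := by field_simp
  have h5 : 1 / up * ‖v‖ ^ 2 = ‖v‖ ^ 2 / up := by ring
  linarith

end OperatorBounds

/-! ### Class `𝒦` functions -/

namespace ClassK

variable {α β : ℝ → ℝ}

theorem le_iff (hα : ClassK α) {a b : ℝ} (ha : 0 ≤ a) (hb : 0 ≤ b) :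
    α a ≤ α b ↔ a ≤ b := hα.2.1.le_iff_le ha hb

theorem lt_iff (hα : ClassK α) {a b : ℝ} (ha : 0 ≤ a) (hb : 0 ≤ b) :
    α a < α b ↔ a < b := hα.2.1.lt_iff_lt ha hb

theorem add (hα : ClassK α) (hβ : ClassK β) : ClassK fun s => α s + β s :=
  ⟨hα.1.add hβ.1, fun _ ha _ hb h => add_lt_add (hα.2.1 ha hb h) (hβ.2.1 ha hb h), by
    simp [hα.2.2, hβ.2.2]⟩

theorem min (hα : ClassK α) (hβ : ClassK β) : ClassK fun s => min (α s) (β s) :=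
  ⟨ContinuousOn.inf hα.1 hβ.1, fun _ ha _ hb h => min_lt_min (hα.2.1 ha hb h) (hβ.2.1 ha hb h), by
    simp [hα.2.2, hβ.2.2]⟩

theorem comp_half (hα : ClassK α) : ClassK fun s => α (s / 2) := by
  have hmaps : MapsTo (fun s : ℝ => s / 2) (Ici 0) (Ici 0) := fun s hs => by
    have : (0 : ℝ) ≤ s := hs
    exact mem_Ici.2 (by positivity)
  exact ⟨hα.1.comp (by fun_prop) hmaps,
    fun _ ha _ hb h => hα.2.1 (hmaps ha) (hmaps hb) (by linarith), by simp [hα.2.2]⟩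

theorem const_mul_sq {c : ℝ} (hc : 0 < c) : ClassK fun s => c * s ^ 2 :=
  ⟨by fun_prop, fun _ ha _ _ h =>
    mul_lt_mul_of_pos_left (pow_lt_pow_left₀ h ha two_ne_zero) hc, by simp⟩

theorem const_mul_id {c : ℝ} (hc : 0 < c) : ClassK fun s => c * s :=
  ⟨by fun_prop, fun _ _ _ _ h => mul_lt_mul_of_pos_left h hc, by simp⟩

end ClassK

/-- A continuous positive definite function on a compact set has a lower bound of class `𝒦`. -/
theorem exists_classK_le {X : Type*} [NormedAddCommGroup X] {K : Set X} (hK : IsCompact K)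
    (h0 : (0 : X) ∈ K) {V : X → ℝ} (hV : ContinuousOn V K) (hzero : V 0 = 0)
    (hpos : ∀ x ∈ K, x ≠ 0 → 0 < V x) : ∃ α, ClassK α ∧ ∀ x ∈ K, α ‖x‖ ≤ V x := by
  have hnn : ∀ x ∈ K, 0 ≤ V x := fun x hx => by
    rcases eq_or_ne x 0 with rfl | h
    · exact hzero.ge
    · exact (hpos x hx h).le
  -- The minimum over `K` of `V(x) + max(0, r - ‖x‖)` is nondecreasing and 1-Lipschitz in `r`,
  -- positive for `r > 0`, and at most `V(x)` when `r = ‖x‖`.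
  set Φ : ℝ → X → ℝ := fun r x => V x + max 0 (r - ‖x‖) with hΦ
  have hΦ0 : ∀ r, ∀ x ∈ K, 0 ≤ Φ r x := fun r x hx => add_nonneg (hnn x hx) (le_max_left _ _)
  have hmin : ∀ r, ∃ x ∈ K, ∀ y ∈ K, Φ r x ≤ Φ r y := fun r =>
    hK.exists_isMinOn ⟨0, h0⟩ (hV.add (by fun_prop))
  choose m hmK hmle using hmin
  set a : ℝ → ℝ := fun r => Φ r (m r) with ha
  have hmono : Monotone a := fun r s hrs => by
    refine (hmle r _ (hmK s)).trans ?_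
    simp only [hΦ, ha]
    gcongr
  have hlip : ∀ r s, a s ≤ a r + |s - r| := fun r s => by
    refine (hmle s _ (hmK r)).trans ?_
    simp only [hΦ, ha]
    rw [add_assoc]
    gcongr
    refine max_le (by positivity) ?_
    linarith [le_max_right 0 (r - ‖m r‖), le_abs_self (s - r)]
  have hcont : Continuous a := by
    refine (LipschitzWith.of_le_add_mul 1 fun s r => ?_).continuous
    simpa [Real.dist_eq] using hlip r s
  have hapos : ∀ r > 0, 0 < a r := fun r hr => by
    rcases eq_or_ne (m r) 0 with h | h
    · have : a r = V (m r) + max 0 (r - ‖m r‖) := rfl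
      rw [this, h]
      simpa [hzero] using hr
    · exact add_pos_of_pos_of_nonneg (hpos _ (hmK r) h) (le_max_left _ _)
  -- The factor `r/(1+r) ≤ 1` makes the monotone bound strictly increasing and zero at zero.
  refine ⟨fun r => a r * (r / (1 + r)), ⟨?_, ?_, by simp⟩, fun x hx => ?_⟩
  · refine hcont.continuousOn.mul (continuousOn_id.div (by fun_prop) fun r hr => ?_)
    have : (0 : ℝ) ≤ r := hr
    positivity
  · intro r hr s hs hrs
    have hr : (0 : ℝ) ≤ r := hr
    have hs : 0 < s := hr.trans_lt hrs
    have h1 : r / (1 + r) < s / (1 + s) := by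
      rw [div_lt_div_iff₀ (by positivity) (by positivity)]
      linarith
    exact mul_lt_mul' (hmono hrs.le) h1 (by positivity) (hapos s hs)
  · have h1 : a ‖x‖ ≤ V x := by simpa [hΦ] using hmle ‖x‖ x hx
    have h2 : ‖x‖ / (1 + ‖x‖) ≤ 1 := by
      rw [div_le_one (by positivity)]
      linarith
    exact (mul_le_of_le_one_right (hΦ0 _ _ (hmK _)) h2).trans h1

/-! ### The composite vector -/

theorem norm_stack_sq {n L p : ℕ} (x : E n) (wc wa : E L) (th : E p) :
    ‖stack x wc wa th‖ ^ 2 = ‖x‖ ^ 2 + ‖wc‖ ^ 2 + ‖wa‖ ^ 2 + ‖th‖ ^ 2 := by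
  simp only [EuclideanSpace.norm_sq_eq, stack, Fintype.sum_sum_type, Sum.elim_inl, Sum.elim_inr]
  ring

namespace Scheme

variable {n m L p N : ℕ} {S : Scheme n m L p N}

/-! ### Bounds on the gain along a run -/

theorem rho_pos (hS : S.Assumptions) (w : E L) : 0 < S.rho w := by
  have := hS.gains.γc_pos
  have := real_inner_self_nonneg (x := w)
  rw [rho]
  positivity

theorem inner_Lam (w v u : E L) : ⟪v, S.Lam w u⟫ = 1 / S.rho w ^ 2 * (⟪w, u⟫ * ⟪v, w⟫) := by
  simp [Lam, inner_smul_right]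

/-- Normalization at work: `s²/(1 + γs²)² ≤ 1/(4γ)`, by the arithmetic-geometric mean inequality. -/
theorem inner_Lam_le (hS : S.Assumptions) (w v u : E L) :
    ⟪v, S.Lam w u⟫ ≤ 1 / (4 * S.γc) * (‖v‖ * ‖u‖) := by
  have hγ := hS.gains.γc_pos
  have hρ := rho_pos hS w
  rw [inner_Lam]
  have h1 : ⟪w, u⟫ * ⟪v, w⟫ ≤ ‖w‖ ^ 2 * (‖v‖ * ‖u‖) := by
    refine (le_abs_self _).trans ?_
    rw [abs_mul]
    refine (mul_le_mul (abs_real_inner_le_norm w u) (abs_real_inner_le_norm v w) (abs_nonneg _)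
      (by positivity)).trans (le_of_eq (by ring))
  have h2 : 1 / S.rho w ^ 2 * ‖w‖ ^ 2 ≤ 1 / (4 * S.γc) := by
    rw [one_div_mul_eq_div, div_le_div_iff₀ (by positivity) (by positivity), rho,
      real_inner_self_eq_norm_sq]
    nlinarith [sq_nonneg (1 - S.γc * ‖w‖ ^ 2)]
  calc 1 / S.rho w ^ 2 * (⟪w, u⟫ * ⟪v, w⟫)
      ≤ 1 / S.rho w ^ 2 * (‖w‖ ^ 2 * (‖v‖ * ‖u‖)) := by gcongr
    _ = 1 / S.rho w ^ 2 * ‖w‖ ^ 2 * (‖v‖ * ‖u‖) := by ring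
    _ ≤ _ := by gcongr

theorem inner_Lam_comm (w v u : E L) : ⟪v, S.Lam w u⟫ = ⟪u, S.Lam w v⟫ := by
  rw [inner_Lam, inner_Lam, real_inner_comm u w, real_inner_comm w v]
  ring

theorem inner_Lam_nonneg (w v : E L) : 0 ≤ ⟪v, S.Lam w v⟫ := by
  rw [inner_Lam, real_inner_comm]
  exact mul_nonneg (by positivity) (mul_self_nonneg _)

theorem inner_LamAvg (x : E n) (wa : E L) (th : E p) (t : ℝ) (v u : E L) :
    ⟪v, S.LamAvg x wa th t u⟫
      = 1 / (N : ℝ) * ∑ i, ⟪v, S.Lam (S.omegaAt (S.xi i x t) x wa th) u⟫ := by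
  simp [LamAvg, inner_smul_right, inner_sum]

theorem inner_LamAvg_le (hS : S.Assumptions) (x : E n) (wa : E L) (th : E p) (t : ℝ) (v u : E L) :
    ⟪v, S.LamAvg x wa th t u⟫ ≤ 1 / (4 * S.γc) * (‖v‖ * ‖u‖) := by
  have hγ := hS.gains.γc_pos
  rw [inner_LamAvg]
  have h := Finset.sum_le_sum fun (i : Fin N) (_ : i ∈ Finset.univ) =>
    inner_Lam_le hS (S.omegaAt (S.xi i x t) x wa th) v u
  rw [Finset.sum_const, Finset.card_univ, Fintype.card_fin, nsmul_eq_mul] at h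
  -- Without extrapolated points `1/N` is `0`, and the average vanishes.
  rcases Nat.eq_zero_or_pos N with h0 | h0
  · simp only [h0, Nat.cast_zero, div_zero, zero_mul]
    positivity
  · have hN : (0 : ℝ) < N := Nat.cast_pos.2 h0
    rw [one_div_mul_eq_div, div_le_iff₀ hN]
    linarith

theorem inner_LamAvg_nonneg (x : E n) (wa : E L) (th : E p) (t : ℝ) (v : E L) :
    0 ≤ ⟪v, S.LamAvg x wa th t v⟫ := by
  rw [inner_LamAvg]
  exact mul_nonneg (by positivity) (Finset.sum_nonneg fun i _ => inner_Lam_nonneg _ _)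

theorem inner_LamAvg_comm (x : E n) (wa : E L) (th : E p) (t : ℝ) (v u : E L) :
    ⟪v, S.LamAvg x wa th t u⟫ = ⟪u, S.LamAvg x wa th t v⟫ := by
  simp only [inner_LamAvg, inner_Lam_comm _ v u]

/-- The information matrix `k_{c1} Λ + (k_{c2}/N) ∑ᵢ Λᵢ` along a run. -/
noncomputable def info (S : Scheme n m L p N) (r : Run n L p) (t : ℝ) : E L →L[ℝ] E L :=
  S.kc1 • S.LamRun r t + S.kc2 • S.LamAvgRun r t

theorem inner_info (r : Run n L p) (t : ℝ) (v u : E L) :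
    ⟪v, S.info r t u⟫ = S.kc1 * ⟪v, S.LamRun r t u⟫ + S.kc2 * ⟪v, S.LamAvgRun r t u⟫ := by
  simp [info, inner_add_right, inner_smul_right]

theorem ExcitedRun.mem_interior (hS : S.Assumptions) {r : Run n L p} {t₀ c₃ Bsup : ℝ}
    (hr : S.ExcitedRun r t₀ c₃ Bsup) {t : ℝ} (ht : t₀ ≤ t) : r.x t ∈ interior S.safe :=
  forwardInvariant hS r t₀ ⊤ hr.t₀_nonneg hr.sol hr.init ⟨Bsup, hr.gradB_bound⟩ t
    (mem_timeInterval_top.2 ht)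

theorem timeInterval_top (t₀ : ℝ) : timeInterval t₀ ⊤ = Ici t₀ := by
  ext t
  exact mem_timeInterval_top

/-- The differential equations are only required in the interior of the safe set; forward invariance
makes them hold at all but the exceptional times. -/
theorem ExcitedRun.exists_gainFlow (hS : S.Assumptions) {r : Run n L p} {t₀ c₃ Bsup : ℝ}
    (hr : S.ExcitedRun r t₀ c₃ Bsup) :
    ∃ K D, GainFlow r.Γ (S.info r) S.βc t₀ K D ∧ ∀ t > t₀, t ∉ D →
      HasDerivAt r.x (S.f (r.x t) + S.g (r.x t) (S.policy (r.x t) (r.Wa t))) t ∧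
      HasDerivAt r.Wc (S.critic (r.x t) (r.Wc t) (r.Wa t) (r.Γ t) (r.θh t) t) t ∧
      HasDerivAt r.Wa (S.actor (r.x t) (r.Wc t) (r.Wa t) (r.θh t) t) t ∧
      HasDerivAt r.θh (r.ψ (r.θh t) t) t := by
  obtain ⟨D, hD, hode⟩ := hr.sol.ode
  have h1 := hS.gains.kc1_pos
  have h2 := hS.gains.kc2_pos
  have h3 := hS.gains.γc_pos
  have hode' := fun t (ht : t > t₀) htD =>
    hode t (mem_timeInterval_top.2 ht.le) ht htD (hr.mem_interior hS ht.le)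
  refine ⟨S.kc1 * (1 / (4 * S.γc)) + S.kc2 * (1 / (4 * S.γc)), D, ⟨?_, hr.sol.Γ_init, hD, ?_, ?_,
    ?_, by positivity, hS.gains.βc_pos, fun t ht htD => (hode' t ht htD).2.2.1⟩,
    fun t ht htD => ?_⟩
  · simpa [timeInterval_top] using hr.sol.Γ_cont
  · intro t v w
    rw [inner_info, inner_info, LamRun, inner_Lam_comm, LamAvgRun, inner_LamAvg_comm]
  · intro t v
    rw [inner_info]
    exact add_nonneg (mul_nonneg h1.le (inner_Lam_nonneg _ _))
      (mul_nonneg h2.le (inner_LamAvg_nonneg _ _ _ _ _))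
  · intro t v w
    rw [inner_info, add_mul, mul_assoc, mul_assoc]
    exact add_le_add (mul_le_mul_of_nonneg_left (inner_Lam_le hS _ _ _) h1.le)
      (mul_le_mul_of_nonneg_left (inner_LamAvg_le hS _ _ _ _ _ _) h2.le)
  · obtain ⟨hx, hc, -, ha, hθ⟩ := hode' t ht htD
    exact ⟨hx, hc, ha, hθ⟩

/-- The integral of a non-integrable function is `0` by convention, so a positive lower bound forces
integrability of `F`; nothing is needed about the other summand in `G`. -/
theorem exists_integrable_minorant {F G : ℝ → ℝ} {a T c κ : ℝ} (hT : 0 < T) (hκ : 0 < κ)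
    (hc : 0 < c) (hint : c ≤ ∫ s in a..(a + T), F s) (hle : ∀ s, κ * F s ≤ G s) :
    ∃ ψ : ℝ → ℝ, MeasureTheory.IntegrableOn ψ (Icc a (a + T)) ∧
      (∀ s ∈ Icc a (a + T), ψ s ≤ G s) ∧ κ * c ≤ ∫ s in a..(a + T), ψ s := by
  have hI : IntervalIntegrable F MeasureTheory.volume a (a + T) := by
    by_contra hcon
    rw [intervalIntegral.integral_undef hcon] at hint
    linarith
  refine ⟨fun s => κ * F s,
    ((intervalIntegrable_iff_integrableOn_Icc_of_le (by linarith)).1 hI).const_mul κ,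
    fun s _ => hle s, ?_⟩
  rw [intervalIntegral.integral_const_mul]
  exact mul_le_mul_of_nonneg_left hint hκ.le

theorem ExcitedRun.exists_gainBounds (hS : S.Assumptions) {r : Run n L p} {t₀ c₃ Bsup : ℝ}
    (hr : S.ExcitedRun r t₀ c₃ Bsup) : ∃ Γlow > 0, ∃ Γup > 0, r.GainBounds t₀ Γlow Γup := by
  obtain ⟨K, D, hflow, -⟩ := hr.exists_gainFlow hS
  obtain ⟨T, c₁, c₂, hT, hc₁, hc₂, hc₃, hpos, hexc⟩ := hr.excitation
  have hk1 := hS.gains.kc1_pos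
  have hk2 := hS.gains.kc2_pos
  have hL : ∀ t v, 0 ≤ ⟪v, S.LamRun r t v⟫ := fun t v => inner_Lam_nonneg _ _
  have hA : ∀ t v, 0 ≤ ⟪v, S.LamAvgRun r t v⟫ := fun t v => inner_LamAvg_nonneg _ _ _ _ _
  obtain ⟨q, hq, hcoer⟩ : ∃ q > 0, ∀ t ≥ t₀, ∀ v, q * ‖v‖ ^ 2 ≤ ⟪v, (r.Γ t).inverse v⟫ := by
    -- Any one positive level suffices, the other part of the information matrix being nonnegative.
    -- The pointwise level `c₃` gives a constant minorant, hence a window level proportional to `T`.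
    rcases hpos with h | h | h
    · refine hflow.exists_inverse_coercive (c := S.kc1 * c₁) hT (by positivity) fun a ha v hv => ?_
      have hv' : 0 < ‖v‖ := norm_pos_iff.2 hv
      simpa only [mul_assoc] using exists_integrable_minorant hT hk1
        (by positivity) (hexc a ha v).1 fun s => by
          rw [inner_info]
          linarith [mul_nonneg hk2.le (hA s v)]
    · refine hflow.exists_inverse_coercive (c := S.kc2 * c₂) hT (by positivity) fun a ha v hv => ?_
      have hv' : 0 < ‖v‖ := norm_pos_iff.2 hv
      simpa only [mul_assoc] using exists_integrable_minorant hT hk2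
        (by positivity) (hexc a ha v).2.1 fun s => by
          rw [inner_info]
          linarith [mul_nonneg hk1.le (hL s v)]
    · refine hflow.exists_inverse_coercive (c := S.kc2 * c₃ * T) hT (by positivity)
        fun a ha v _ => ⟨fun _ => S.kc2 * (c₃ * ‖v‖ ^ 2), continuous_const.integrableOn_Icc,
          fun s hs => ?_, ?_⟩
      · rw [inner_info]
        have h1 := mul_le_mul_of_nonneg_left (hexc s (ha.le.trans hs.1) v).2.2 hk2.le
        linarith [mul_nonneg hk1.le (hL s v)]
      · rw [intervalIntegral.integral_const]
        simp only [add_sub_cancel_left, smul_eq_mul]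
        exact le_of_eq (by ring)
  obtain ⟨low, hlow, up, hup, hb⟩ := hflow.exists_bounds hq hcoer
  exact ⟨low, hlow, up, hup, fun t ht => ⟨hflow.isSelfAdjoint ht, hb t ht⟩⟩

/-! ### Comparison functions for the Lyapunov function -/

/-- The mean value inequality needs a convex domain, so it is applied on a ball that contains `χ`.
-/
theorem exists_V_le_mul_norm (hS : S.Assumptions) : ∃ C > 0, ∀ x ∈ S.χ, S.V x ≤ C * ‖x‖ := by
  obtain ⟨R, hR⟩ := hS.approx.compact.isBounded.subset_closedBall (0 : E n)
  obtain ⟨C, hC⟩ := (isCompact_closedBall (0 : E n) R).exists_bound_of_continuousOn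
    hS.value.grad_lip.continuous.continuousOn
  refine ⟨|C| + 1, by positivity, fun x hx => ?_⟩
  have h := (convex_closedBall (0 : E n) R).norm_image_sub_le_of_norm_fderiv_le (𝕜 := ℝ)
    (fun y _ => (hS.value.smooth.differentiable (by simp)).differentiableAt) (fun y hy => hC y hy)
    (hR hS.approx.zero_mem) (hR hx)
  rw [hS.value.zero, sub_zero, sub_zero] at h
  have h1 : C * ‖x‖ ≤ (|C| + 1) * ‖x‖ :=
    mul_le_mul_of_nonneg_right (by linarith [le_abs_self C]) (norm_nonneg x)
  exact ((le_abs_self _).trans h).trans h1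

theorem exists_sandwich (hS : S.Assumptions) {r : Run n L p} {t₀ Γlow Γup : ℝ} (ht₀ : 0 ≤ t₀)
    (hlow : 0 < Γlow) (hup : 0 < Γup) (hb : r.GainBounds t₀ Γlow Γup) :
    ∃ η₁ η₂ : ℝ → ℝ, ClassK η₁ ∧ ClassK η₂ ∧ S.Sandwich r t₀ η₁ η₂ := by
  obtain ⟨α, hα, hαV⟩ := exists_classK_le hS.approx.compact hS.approx.zero_mem
    hS.value.smooth.continuous.continuousOn hS.value.zero fun x _ => hS.value.pos x
  obtain ⟨C, hC, hCV⟩ := exists_V_le_mul_norm hS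
  obtain ⟨v₁, v₂, hv₁, hv₂, hv⟩ := hS.identifier.bounds
  have hVnn : ∀ x ∈ S.χ, 0 ≤ S.V x := fun x hx => (hα.nonneg (norm_nonneg x)).trans (hαV x hx)
  have hq1 : ClassK fun s => 1 / (8 * Γup) * s ^ 2 := ClassK.const_mul_sq (by positivity)
  have hq2 : ClassK fun s => 1 / 8 * s ^ 2 := ClassK.const_mul_sq (by positivity)
  have hq3 : ClassK fun s => (1 / (2 * Γlow) + 1 / 2) * s ^ 2 :=
    ClassK.const_mul_sq (by positivity)
  refine ⟨_, _, hα.comp_half.min (hv₁.comp_half.min (hq1.min hq2)),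
    ((ClassK.const_mul_id hC).add hq3).add hv₂, fun t ht x hx wc wa th => ?_⟩
  obtain ⟨hsa, hΓ⟩ := hb t ht
  have hth := hv th t (ht₀.trans ht)
  have hP1 := norm_sq_div_le_inner_inverse hsa hlow hup hΓ wc
  have hP2 : ⟪wc, (r.Γ t).inverse wc⟫ ≤ ‖wc‖ ^ 2 / Γlow := by
    have h1 := norm_inverse_apply_le hlow (fun v => (hΓ v).1) wc
    refine (real_inner_le_norm _ _).trans ((mul_le_mul_of_nonneg_left h1 (norm_nonneg _)).trans ?_)
    exact le_of_eq (by ring)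
  have hsq := norm_stack_sq x wc wa th
  set z := ‖stack x wc wa th‖ with hz
  have hz0 : 0 ≤ z := norm_nonneg _
  have hVx := hVnn x hx
  have hv1 := hv₁.nonneg (norm_nonneg th)
  have hP0 : 0 ≤ ‖wc‖ ^ 2 / Γup := by positivity
  have hwa0 : 0 ≤ ‖wa‖ ^ 2 := by positivity
  simp only [VL, real_inner_self_eq_norm_sq]
  constructor
  · have hcases : z / 2 ≤ ‖x‖ ∨ z / 2 ≤ ‖th‖ ∨ z / 2 ≤ ‖wc‖ ∨ z / 2 ≤ ‖wa‖ := by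
      by_contra! hcon
      obtain ⟨h1, h2, h3, h4⟩ := hcon
      have k1 := pow_lt_pow_left₀ h1 (norm_nonneg _) two_ne_zero
      have k2 := pow_lt_pow_left₀ h2 (norm_nonneg _) two_ne_zero
      have k3 := pow_lt_pow_left₀ h3 (norm_nonneg _) two_ne_zero
      have k4 := pow_lt_pow_left₀ h4 (norm_nonneg _) two_ne_zero
      linarith
    have hz2 : 0 ≤ z / 2 := by positivity
    rcases hcases with h | h | h | h
    · refine (min_le_left _ _).trans ?_
      have h1 := (hα.le_iff hz2 (norm_nonneg x)).2 h
      linarith [hαV x hx]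
    · refine (min_le_right _ _).trans ((min_le_left _ _).trans ?_)
      have h1 := (hv₁.le_iff hz2 (norm_nonneg th)).2 h
      linarith [hth.1]
    · refine (min_le_right _ _).trans ((min_le_right _ _).trans ((min_le_left _ _).trans ?_))
      have h1 : 1 / (8 * Γup) * z ^ 2 ≤ 1 / 2 * (‖wc‖ ^ 2 / Γup) := by
        calc 1 / (8 * Γup) * z ^ 2 = 1 / 2 * ((z / 2) ^ 2 / Γup) := by field_simp; ring
          _ ≤ _ := by gcongr
      linarith [hth.1]
    · refine (min_le_right _ _).trans ((min_le_right _ _).trans ((min_le_right _ _).trans ?_))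
      have h1 := pow_le_pow_left₀ hz2 h 2
      linarith [hth.1]
  · have hx2 : ‖x‖ ≤ z := by
      refine (pow_le_pow_iff_left₀ (norm_nonneg _) hz0 two_ne_zero).1 ?_
      nlinarith [sq_nonneg ‖th‖, sq_nonneg ‖wc‖]
    have hth2 : ‖th‖ ≤ z := by
      refine (pow_le_pow_iff_left₀ (norm_nonneg _) hz0 two_ne_zero).1 ?_
      nlinarith [sq_nonneg ‖x‖, sq_nonneg ‖wc‖]
    have hwc2 : ‖wc‖ ^ 2 ≤ z ^ 2 := by nlinarith [sq_nonneg ‖x‖, sq_nonneg ‖th‖]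
    have hwa2 : ‖wa‖ ^ 2 ≤ z ^ 2 := by nlinarith [sq_nonneg ‖x‖, sq_nonneg ‖wc‖, sq_nonneg ‖th‖]
    have h1 : S.V x ≤ C * z := (hCV x hx).trans (by gcongr)
    have h2 : 1 / 2 * (‖wc‖ ^ 2 / Γlow) ≤ 1 / (2 * Γlow) * z ^ 2 := by
      calc 1 / 2 * (‖wc‖ ^ 2 / Γlow) ≤ 1 / 2 * (z ^ 2 / Γlow) := by gcongr
        _ = _ := by field_simp
    have h3 := (hv₂.le_iff (norm_nonneg th) hz0).2 hth2
    linarith [hth.2]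

end Scheme

/-- `s/(1 + γ s²)²` is at most `3√3/(16√γ)`. -/
theorem div_one_add_mul_sq_sq_le {γ : ℝ} (hγ : 0 < γ) (s : ℝ) :
    s / (1 + γ * s ^ 2) ^ 2 ≤ 3 * √3 / (16 * √γ) := by
  have h3 : √3 ^ 2 = (3 : ℝ) := Real.sq_sqrt (by norm_num)
  have hγ2 : √γ ^ 2 = γ := Real.sq_sqrt hγ.le
  have hγ0 : 0 < √γ := Real.sqrt_pos.2 hγ
  have h30 : 0 < √3 := Real.sqrt_pos.2 (by norm_num)
  rw [div_le_div_iff₀ (by positivity) (by positivity)]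
  set σ := √3 * √γ * s with hσ
  have hσ2 : σ ^ 2 = 3 * (γ * s ^ 2) := by
    rw [hσ, mul_pow, mul_pow, h3, hγ2]; ring
  -- The maximum is at `γs² = 1/3`, that is `σ = 1`; the difference factors as `(σ - 1)²((σ + 1)² +
  -- 8)`.
  have key : 16 * σ ≤ (3 + σ ^ 2) ^ 2 := by
    have h8 : 0 ≤ (σ + 1) ^ 2 + 8 := by positivity
    nlinarith [mul_nonneg (sq_nonneg (σ - 1)) h8]
  rw [hσ2] at key
  have h5 : √3 * (s * (16 * √γ)) ≤ √3 * (3 * √3 * (1 + γ * s ^ 2) ^ 2) := by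
    calc √3 * (s * (16 * √γ)) = 16 * σ := by rw [hσ]; ring
      _ ≤ (3 + 3 * (γ * s ^ 2)) ^ 2 := key
      _ = √3 ^ 2 * (3 * (1 + γ * s ^ 2) ^ 2) := by rw [h3]; ring
      _ = _ := by ring
  exact le_of_mul_le_mul_left h5 h30

namespace Scheme

variable {n m L p N : ℕ} {S : Scheme n m L p N}

/-! ### Bellman errors -/

/-- The bound `3√3/(16√γ_c)` on the normalized regressor. -/
noncomputable def regBound (S : Scheme n m L p N) : ℝ := 3 * √3 / (16 * √S.γc)

theorem regBound_nonneg : 0 ≤ S.regBound := by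
  rw [regBound]; positivity

theorem abs_inner_div_rho_sq_le (hS : S.Assumptions) (w v : E L) :
    |⟪v, w⟫ / S.rho w ^ 2| ≤ S.regBound * ‖v‖ := by
  have hρ := rho_pos hS w
  have h := div_one_add_mul_sq_sq_le hS.gains.γc_pos ‖w‖
  have h1 : S.rho w = 1 + S.γc * ‖w‖ ^ 2 := by rw [rho, real_inner_self_eq_norm_sq]
  rw [← h1] at h
  rw [abs_div, abs_of_pos (by positivity : 0 < S.rho w ^ 2)]
  calc |⟪v, w⟫| / S.rho w ^ 2 ≤ ‖v‖ * ‖w‖ / S.rho w ^ 2 := by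
        gcongr
        exact abs_real_inner_le_norm v w
    _ = ‖w‖ / S.rho w ^ 2 * ‖v‖ := by ring
    _ ≤ _ := by
        rw [regBound]
        gcongr

/-- The Bellman error under the policy `-½ R⁻¹ gᵀ s` in terms of the weight errors. -/
theorem bellman_error_eq (hV : S.ValueCondition) (y x s : E n) (wc : E L) (th : E p) :
    S.cost y (-((1 / 2 : ℝ) • S.Rinv (S.gT y s)))
        + ⟪wc, S.dphi y x (S.Y y th + S.g y (-((1 / 2 : ℝ) • S.Rinv (S.gT y s))))⟫
      = -⟪S.W x - wc, S.dphi y x (S.Y y th + S.g y (-((1 / 2 : ℝ) • S.Rinv (S.gT y s))))⟫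
        - ⟪S.dphiT y x (S.W x), S.Y y (S.θ - th)⟫ + S.Delta x y
        + 1 / 4 * ⟪s - S.dphiT y x (S.W x), S.GR y (s - S.dphiT y x (S.W x))⟫ := by
  have hW : ⟪S.W x, S.dphi y x (S.Y y th + S.g y (-((1 / 2 : ℝ) • S.Rinv (S.gT y s))))⟫
      = ⟪S.dphiT y x (S.W x), S.Y y th⟫ - 1 / 2 * ⟪S.dphiT y x (S.W x), S.GR y s⟫ := by
    rw [← inner_dphiT, g_policy, inner_add_right, inner_neg_right, inner_smul_right]
    ring
  rw [cost, inner_policy_cost hV, hjb_eq hV y, Delta, inner_sub_left, hW]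
  set q := S.dphiT y x (S.W x)
  set v := gradient S.V y
  have h1 : ⟪v, S.GR y q⟫ = ⟪q, S.GR y v⟫ := by rw [← inner_GR_comm hV, real_inner_comm]
  have h2 : ⟪s, S.GR y q⟫ = ⟪q, S.GR y s⟫ := by rw [← inner_GR_comm hV, real_inner_comm]
  simp only [map_sub, inner_sub_left, inner_sub_right, h1, h2]
  ring

theorem policy_eq (x : E n) (wa : E L) :
    S.policy x wa = -((1 / 2 : ℝ) • S.Rinv (S.gT x (S.dphiT x x wa + S.cb • S.gradB x))) := by
  simp only [policy, khat, map_add, map_smul, smul_add, smul_smul, neg_add, sub_eq_add_neg]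
  congr 3
  ring

theorem inner_Gphi (y x : E n) (v w : E L) :
    ⟪v, S.Gphi y x w⟫ = ⟪S.dphiT y x v, S.GR y (S.dphiT y x w)⟫ := by
  simp [Gphi, inner_dphiT]

/-! ### Contribution of one regressor to the derivative of the Lyapunov function -/

/-- Contribution, per unit of learning gain, of a regressor `ϖ` with Bellman error `δ` at the
point `y` to the derivative of the Lyapunov function: critic law, gain law and actor law. -/
noncomputable def regressorTerm (S : Scheme n m L p N) (y x : E n) (wc wa ϖ : E L) (δ : ℝ) : ℝ :=
  ⟪S.W x - wc, ϖ⟫ / S.rho ϖ ^ 2 * δ + 1 / 2 * ⟪S.W x - wc, S.Lam ϖ (S.W x - wc)⟫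
    - 1 / (4 * S.rho ϖ ^ 2) * ⟪ϖ, wc⟫
      * ⟪S.W x - wa, ContinuousLinearMap.adjoint (S.Gphi y x) wa⟫

/-- Terms common to the bounds on all regressors. -/
noncomputable def commonBound (S : Scheme n m L p N) (c a ϑ : ℝ) : ℝ :=
  S.regBound * c * (S.sup₂ (fun x y => ‖innerSL ℝ (S.W x) ∘L S.dphi y x ∘L S.Y y‖) * ϑ
      + S.sup₂ (fun x y => |S.Delta x y|))
    + S.regBound / 4 * (S.sup₂ (fun x y => ‖S.Gphi y x‖) * S.sup₁ (fun x => ‖S.W x‖) ^ 2 * a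
      + S.sup₂ (fun x y => ‖S.Gphi y x‖ * ‖S.W x‖) * (a ^ 2 + c * a))

/-- The vector `b` carries the barrier part of the policy, and is zero at extrapolated points.
Writing `ŵ_c` as ideal weight minus error in the actor law yields a copy of `⟪c, ϖ⟫⟪a, G_φ a⟫/(4ρ²)`
that cancels the one in the Bellman error. The gain law takes back half of the damping `-⟪c, Λ c⟫`.
-/
theorem regressorTerm_eq (hV : S.ValueCondition) (y x b : E n) (wc wa ϖ : E L) (th : E p) (δ : ℝ)
    (hδ : δ = -⟪S.W x - wc, ϖ⟫ - ⟪S.dphiT y x (S.W x), S.Y y (S.θ - th)⟫ + S.Delta x y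
      + 1 / 4 * ⟪b - S.dphiT y x (S.W x - wa), S.GR y (b - S.dphiT y x (S.W x - wa))⟫) :
    S.regressorTerm y x wc wa ϖ δ
      = -(1 / 2 * ⟪S.W x - wc, S.Lam ϖ (S.W x - wc)⟫)
        + ⟪S.W x - wc, ϖ⟫ / S.rho ϖ ^ 2
          * (S.Delta x y - ⟪S.dphiT y x (S.W x), S.Y y (S.θ - th)⟫
            + 1 / 4 * ⟪S.W x - wa, S.Gphi y x (S.W x)⟫
            - 1 / 2 * ⟪b, S.GR y (S.dphiT y x (S.W x - wa))⟫ + 1 / 4 * ⟪b, S.GR y b⟫)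
        + 1 / 4 * (⟪S.W x, ϖ⟫ / S.rho ϖ ^ 2)
          * (⟪S.W x - wa, S.Gphi y x (S.W x - wa)⟫ - ⟪S.W x - wa, S.Gphi y x (S.W x)⟫) := by
  set c := S.W x - wc with hc
  set a := S.W x - wa with ha
  have hwc : ⟪ϖ, wc⟫ = ⟪S.W x, ϖ⟫ - ⟪c, ϖ⟫ := by
    rw [hc, inner_sub_left, real_inner_comm wc]; ring
  have hadj : ⟪a, ContinuousLinearMap.adjoint (S.Gphi y x) wa⟫
      = ⟪a, S.Gphi y x (S.W x)⟫ - ⟪a, S.Gphi y x a⟫ := by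
    have hwa : wa = S.W x - a := by rw [ha]; abel
    rw [ContinuousLinearMap.adjoint_inner_right, real_inner_comm, inner_Gphi,
      ← inner_GR_comm hV, real_inner_comm, ← inner_Gphi]
    conv_lhs => rw [hwa]
    rw [map_sub, inner_sub_right]
  have hcross : ⟪S.dphiT y x a, S.GR y b⟫ = ⟪b, S.GR y (S.dphiT y x a)⟫ := by
    rw [← inner_GR_comm hV, real_inner_comm]
  have hLam : ⟪c, S.Lam ϖ c⟫ = ⟪c, ϖ⟫ / S.rho ϖ ^ 2 * ⟪c, ϖ⟫ := by
    rw [inner_Lam, real_inner_comm c ϖ]; ring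
  have hinv : 1 / (4 * S.rho ϖ ^ 2) * (⟪S.W x, ϖ⟫ - ⟪c, ϖ⟫)
      = 1 / 4 * (⟪S.W x, ϖ⟫ / S.rho ϖ ^ 2) - 1 / 4 * (⟪c, ϖ⟫ / S.rho ϖ ^ 2) := by
    rw [one_div, mul_inv]; ring
  rw [regressorTerm, ← hc, ← ha, hδ, hwc, hadj, hLam, hinv, inner_Gphi y x a a]
  simp only [map_sub, inner_sub_left, inner_sub_right, hcross]
  ring

theorem regressorTerm_le (hS : S.Assumptions) {y x : E n} (hx : x ∈ S.χ)
    (hy : y ∈ S.χ ∩ Metric.closedBall x S.l) (b : E n) (wc wa ϖ : E L) (th : E p) (δ : ℝ)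
    (hδ : δ = -⟪S.W x - wc, ϖ⟫ - ⟪S.dphiT y x (S.W x), S.Y y (S.θ - th)⟫ + S.Delta x y
      + 1 / 4 * ⟪b - S.dphiT y x (S.W x - wa), S.GR y (b - S.dphiT y x (S.W x - wa))⟫) :
    S.regressorTerm y x wc wa ϖ δ
      ≤ -(1 / 2 * ⟪S.W x - wc, S.Lam ϖ (S.W x - wc)⟫)
        + S.commonBound ‖S.W x - wc‖ ‖S.W x - wa‖ ‖S.θ - th‖
        + S.regBound * ‖S.W x - wc‖ * (1 / 2 * (‖S.GR y ∘L S.dphiT y x‖ * ‖b‖ * ‖S.W x - wa‖)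
          + 1 / 4 * (‖S.GR y‖ * ‖b‖ ^ 2)) := by
  rw [regressorTerm_eq hS.value y x b wc wa ϖ th δ hδ]
  set c := S.W x - wc
  set a := S.W x - wa
  set ϑ := S.θ - th
  have hfst : MapsTo (fun q : E n × E n => q.1) (S.χ ×ˢ S.χ) S.χ := fun q h => h.1
  have hsnd : MapsTo (fun q : E n × E n => q.2) (S.χ ×ˢ S.χ) S.χ := fun q h => h.2
  have hid : MapsTo (fun x : E n => x) S.χ S.χ := fun _ h => h
  have hq := regBound_nonneg (S := S)
  have hα := abs_inner_div_rho_sq_le hS ϖ c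
  have hβ := abs_inner_div_rho_sq_le hS ϖ (S.W x)
  have hY : |⟪S.dphiT y x (S.W x), S.Y y ϑ⟫|
      ≤ S.sup₂ (fun x y => ‖innerSL ℝ (S.W x) ∘L S.dphi y x ∘L S.Y y‖) * ‖ϑ‖ := by
    have h1 := le_sup₂ (F := fun x y => ‖innerSL ℝ (S.W x) ∘L S.dphi y x ∘L S.Y y‖)
      ((((bddOn_W hS hfst).of_norm_le (F := fun q : E n × E n => innerSL ℝ (S.W q.1))
        fun _ _ => by simp).clm_comp ((bddOn_dphi hS hsnd hfst).clm_comp (bddOn_Y hS hsnd))).norm)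
      hx hy
    have h2 := (innerSL ℝ (S.W x) ∘L S.dphi y x ∘L S.Y y).le_opNorm ϑ
    simp only [ContinuousLinearMap.comp_apply, innerSL_apply_apply, Real.norm_eq_abs] at h2
    rw [inner_dphiT]
    exact h2.trans (mul_le_mul_of_nonneg_right h1 (norm_nonneg _))
  have hΔ : |S.Delta x y| ≤ S.sup₂ (fun x y => |S.Delta x y|) :=
    le_sup₂ (F := fun x y => |S.Delta x y|) (bddOn_Delta hS hsnd hfst).norm hx hy
  have hG : ‖S.Gphi y x‖ ≤ S.sup₂ (fun x y => ‖S.Gphi y x‖) :=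
    le_sup₂ (F := fun x y => ‖S.Gphi y x‖) (bddOn_Gphi hS hsnd hfst).norm hx hy
  have hGW : ‖S.Gphi y x‖ * ‖S.W x‖ ≤ S.sup₂ (fun x y => ‖S.Gphi y x‖ * ‖S.W x‖) :=
    le_sup₂ (F := fun x y => ‖S.Gphi y x‖ * ‖S.W x‖)
      ((bddOn_Gphi hS hsnd hfst).norm.mul (bddOn_W hS hfst).norm) hx hy
  have hWs : ‖S.W x‖ ≤ S.sup₁ (fun x => ‖S.W x‖) :=
    le_sup₁ (F := fun x => ‖S.W x‖) (bddOn_W hS hid).norm hx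
  have haW : |⟪a, S.Gphi y x (S.W x)⟫| ≤ ‖S.Gphi y x‖ * ‖S.W x‖ * ‖a‖ := by
    refine (abs_real_inner_le_norm _ _).trans ?_
    have := mul_le_mul_of_nonneg_left ((S.Gphi y x).le_opNorm (S.W x)) (norm_nonneg a)
    linarith
  have haa : |⟪a, S.Gphi y x a⟫| ≤ ‖S.Gphi y x‖ * ‖a‖ ^ 2 := by
    refine (abs_real_inner_le_norm _ _).trans ?_
    have := mul_le_mul_of_nonneg_left ((S.Gphi y x).le_opNorm a) (norm_nonneg a)
    linarith
  have hba : |⟪b, S.GR y (S.dphiT y x a)⟫| ≤ ‖S.GR y ∘L S.dphiT y x‖ * ‖b‖ * ‖a‖ := by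
    refine (abs_real_inner_le_norm _ _).trans ?_
    have := mul_le_mul_of_nonneg_left ((S.GR y ∘L S.dphiT y x).le_opNorm a) (norm_nonneg b)
    rw [ContinuousLinearMap.comp_apply] at this
    linarith
  have hbb : |⟪b, S.GR y b⟫| ≤ ‖S.GR y‖ * ‖b‖ ^ 2 := by
    refine (abs_real_inner_le_norm _ _).trans ?_
    have := mul_le_mul_of_nonneg_left ((S.GR y).le_opNorm b) (norm_nonneg b)
    linarith
  set α := ⟪c, ϖ⟫ / S.rho ϖ ^ 2
  set β := ⟪S.W x, ϖ⟫ / S.rho ϖ ^ 2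
  -- products of the normalized regressor with bounded quantities
  have hprod : ∀ {r X s Y : ℝ}, |r| ≤ s → |X| ≤ Y → r * X ≤ s * Y := fun {r X s Y} h1 h2 =>
    (le_abs_self _).trans (by
      rw [abs_mul]
      exact mul_le_mul h1 h2 (abs_nonneg _) ((abs_nonneg _).trans h1))
  have h1 := hprod hα (X := S.Delta x y - ⟪S.dphiT y x (S.W x), S.Y y ϑ⟫
      + 1 / 4 * ⟪a, S.Gphi y x (S.W x)⟫ - 1 / 2 * ⟪b, S.GR y (S.dphiT y x a)⟫
      + 1 / 4 * ⟪b, S.GR y b⟫)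
    (Y := S.sup₂ (fun x y => |S.Delta x y|)
      + S.sup₂ (fun x y => ‖innerSL ℝ (S.W x) ∘L S.dphi y x ∘L S.Y y‖) * ‖ϑ‖
      + 1 / 4 * (S.sup₂ (fun x y => ‖S.Gphi y x‖ * ‖S.W x‖) * ‖a‖)
      + 1 / 2 * (‖S.GR y ∘L S.dphiT y x‖ * ‖b‖ * ‖a‖) + 1 / 4 * (‖S.GR y‖ * ‖b‖ ^ 2)) (by
    have haW' := haW.trans (mul_le_mul_of_nonneg_right hGW (norm_nonneg a))
    rw [abs_le] at *
    constructor <;> linarith [hΔ.1, hΔ.2, hY.1, hY.2, haW'.1, haW'.2, hba.1, hba.2, hbb.1, hbb.2])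
  -- Here the normalized regressor is paired with `W(x)`, which adds a factor `‖W‖`. The quadratic
  -- term takes the joint supremum, as in `phiA`, and the linear term a product of suprema, as in
  -- `iotaA`.
  have h2 : 1 / 4 * β * (⟪a, S.Gphi y x a⟫ - ⟪a, S.Gphi y x (S.W x)⟫)
      ≤ S.regBound / 4 * (S.sup₂ (fun x y => ‖S.Gphi y x‖) * S.sup₁ (fun x => ‖S.W x‖) ^ 2 * ‖a‖
      + S.sup₂ (fun x y => ‖S.Gphi y x‖ * ‖S.W x‖) * ‖a‖ ^ 2) := by
    have h3 := hprod hβ (X := ⟪a, S.Gphi y x a⟫ - ⟪a, S.Gphi y x (S.W x)⟫)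
      (Y := ‖S.Gphi y x‖ * ‖a‖ ^ 2 + ‖S.Gphi y x‖ * ‖S.W x‖ * ‖a‖) (by
        rw [abs_le] at *
        constructor <;> linarith [haW.1, haW.2, haa.1, haa.2])
    have h4 : ‖S.Gphi y x‖ * ‖S.W x‖ * ‖a‖ ^ 2
        ≤ S.sup₂ (fun x y => ‖S.Gphi y x‖ * ‖S.W x‖) * ‖a‖ ^ 2 := by gcongr
    have h5 : ‖S.Gphi y x‖ * ‖S.W x‖ ^ 2 * ‖a‖
        ≤ S.sup₂ (fun x y => ‖S.Gphi y x‖) * S.sup₁ (fun x => ‖S.W x‖) ^ 2 * ‖a‖ := by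
      have := (norm_nonneg _).trans hG
      gcongr
    have h6 := mul_le_mul_of_nonneg_left (add_le_add h5 h4) hq
    linarith
  rw [commonBound]
  linarith

end Scheme

/-- On the segment from `w` to `z` this is the comparison of the derivative at `0` with the slope
over `[0, 1]`. -/
theorem inner_gradient_le_of_convexOn {k : ℕ} {P : E k → ℝ} (hP : ConvexOn ℝ univ P) {w : E k}
    (hd : DifferentiableAt ℝ P w) (z : E k) : ⟪gradient P w, z - w⟫ ≤ P z - P w := by
  have hconv : ConvexOn ℝ univ (P ∘ AffineMap.lineMap (k := ℝ) w z) := by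
    simpa using hP.comp_affineMap (AffineMap.lineMap (k := ℝ) w z)
  have hline : HasDerivAt (fun s : ℝ => AffineMap.lineMap w z s) (z - w) 0 :=
    AffineMap.hasDerivAt_lineMap
  have hw : HasFDerivAt P (fderiv ℝ P w) (AffineMap.lineMap w z (0 : ℝ)) := by
    simpa using hd.hasFDerivAt
  have hder := hw.comp_hasDerivAt (0 : ℝ) hline
  have h := hconv.le_slope_of_hasDerivAt (mem_univ 0) (mem_univ 1) one_pos hder
  simpa [slope_def_field, gradient] using h

namespace Scheme

variable {n m L p N : ℕ} {S : Scheme n m L p N}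

/-- The projection operator does not increase the distance to points of the set. -/
theorem inner_sub_le_inner_sub_proj (hP : S.ProjectionSet) {z : E L} (hz : S.P z ≤ 0)
    (w τ : E L) : ⟪z - w, τ⟫ ≤ ⟪z - w, S.proj w τ⟫ := by
  rw [proj]
  split_ifs with h
  · exact le_rfl
  · push Not at h
    -- Here `P z ≤ 0 < P w`, so the gradient at `w` has negative inner product with `z - w`, and
    -- subtracting a nonnegative multiple of it can only increase the pairing.
    have hgrad := inner_gradient_le_of_convexOn hP.convex
      ((hP.smooth.differentiable (by simp)) w) z
    have hε := hP.ε_pos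
    have hc : 0 ≤ min 1 (S.P w / S.εP)
        * (⟪gradient S.P w, τ⟫ / ‖gradient S.P w‖ ^ 2) :=
      mul_nonneg (le_min zero_le_one (div_nonneg h.1.le hε.le))
        (div_nonneg h.2.le (by positivity))
    rw [inner_sub_right, inner_smul_right, real_inner_comm (gradient S.P w)]
    nlinarith [h.1]

/-! ### The parts of the derivative of the Lyapunov function -/

/-- The HJB equation gives `+¼⟪v, G_R v⟫` and the ideal part of the policy `-½⟪v, G_R v⟫`; the
negative remainder is dropped. What is left comes from the gradient error `e`, the actor error and
the barrier term. -/
theorem value_rate_le (hS : S.Assumptions) {x : E n} (hx : x ∈ S.χ) (wa : E L) {Bsup : ℝ}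
    (hB : ‖S.gradB x‖ ≤ Bsup) :
    ⟪gradient S.V x, S.f x + S.g x (S.policy x wa)⟫
      ≤ -(lambdaMin S.Q * ‖x‖ ^ 2)
        + 1 / 2 * S.sup₁ (fun x => ‖S.dV x ∘L S.GR x‖)
          * (S.sup₁ (fun x => ‖innerSL ℝ (S.phi x x) ∘L S.dW x + S.dEps x‖) + S.cb * Bsup)
        + 1 / 2 * S.sup₁ (fun x => ‖S.dV x ∘L S.GR x ∘L S.dphiT x x‖) * ‖S.W x - wa‖ := by
  have hid : MapsTo (fun x : E n => x) S.χ S.χ := fun _ h => h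
  have hcb := hS.gains.cb_pos
  have hV := hS.value
  set v := gradient S.V x with hv
  set a := S.W x - wa with ha
  set e := v - S.dphiT x x (S.W x) with he
  have hwa : S.dphiT x x wa = v - e - S.dphiT x x a := by
    rw [he, ha, map_sub]; abel
  have hQ := lambdaMin_mul_norm_sq_le hV.Q_pos.1 x
  have hhjb := hjb_eq hV x
  rw [← hv] at hhjb
  have hG := inner_GR_nonneg hV x v
  have hrow : ∀ w, ⟪v, w⟫ = S.dV x w := fun w => (dV_apply x w).symm
  have hs1 : ‖S.dV x ∘L S.GR x‖ ≤ S.sup₁ (fun x => ‖S.dV x ∘L S.GR x‖) :=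
    le_sup₁ (F := fun x => ‖S.dV x ∘L S.GR x‖)
      ((bddOn_dV hS hid).clm_comp (bddOn_GR hS hid)).norm hx
  have hs2 : ‖S.dV x ∘L S.GR x ∘L S.dphiT x x‖
      ≤ S.sup₁ (fun x => ‖S.dV x ∘L S.GR x ∘L S.dphiT x x‖) :=
    le_sup₁ (F := fun x => ‖S.dV x ∘L S.GR x ∘L S.dphiT x x‖)
      ((bddOn_dV hS hid).clm_comp ((bddOn_GR hS hid).clm_comp (bddOn_dphiT hS hid hid))).norm hx
  have hs3 : ‖e‖ ≤ S.sup₁ (fun x => ‖innerSL ℝ (S.phi x x) ∘L S.dW x + S.dEps x‖) := by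
    have h1 : innerSL ℝ e = innerSL ℝ (S.phi x x) ∘L S.dW x + S.dEps x := by
      rw [inner_phi_dW_add_dEps hS hx]
      ext w
      simp [he, hrow, inner_dphiT]
    rw [← innerSL_apply_norm (𝕜 := ℝ) e, h1]
    exact le_sup₁ (F := fun x => ‖innerSL ℝ (S.phi x x) ∘L S.dW x + S.dEps x‖)
      (bddOn_phi_dW_add_dEps hS).norm hx
  set G := S.sup₁ (fun x => ‖S.dV x ∘L S.GR x‖)
  have hG0 : 0 ≤ G := (norm_nonneg _).trans hs1
  have habs : ∀ w, |⟪v, S.GR x w⟫| ≤ G * ‖w‖ := fun w => by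
    rw [hrow]
    exact ((S.dV x ∘L S.GR x).le_opNorm w).trans (mul_le_mul_of_nonneg_right hs1 (norm_nonneg _))
  have h1 : ⟪v, S.GR x e⟫
      ≤ G * S.sup₁ (fun x => ‖innerSL ℝ (S.phi x x) ∘L S.dW x + S.dEps x‖) :=
    (le_abs_self _).trans ((habs e).trans (mul_le_mul_of_nonneg_left hs3 hG0))
  have h2 : -⟪v, S.GR x (S.gradB x)⟫ ≤ G * Bsup :=
    (neg_le_abs _).trans ((habs _).trans (mul_le_mul_of_nonneg_left hB hG0))
  have h3 : ⟪v, S.GR x (S.dphiT x x a)⟫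
      ≤ S.sup₁ (fun x => ‖S.dV x ∘L S.GR x ∘L S.dphiT x x‖) * ‖a‖ := by
    rw [hrow]
    exact (le_abs_self _).trans (((S.dV x ∘L S.GR x ∘L S.dphiT x x).le_opNorm a).trans
      (mul_le_mul_of_nonneg_right hs2 (norm_nonneg _)))
  have h4 := mul_le_mul_of_nonneg_left h2 hcb.le
  rw [plant_field_eq, hwa]
  simp only [inner_sub_right, inner_smul_right, map_sub]
  linarith

/-- The ideal weights move with the state, so this rate enters the equations of both weight errors.
-/
theorem norm_dW_field_le (hS : S.Assumptions) {x : E n} (hx : x ∈ S.χ) (wa : E L) {Bsup : ℝ}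
    (hB : ‖S.gradB x‖ ≤ Bsup) :
    ‖S.dW x (S.f x + S.g x (S.policy x wa))‖
      ≤ S.iotaX Bsup + 1 / 2 * S.sup₁ (fun x => ‖S.dW x ∘L S.GR x ∘L S.dphiT x x‖)
        * ‖S.W x - wa‖ := by
  have hid : MapsTo (fun x : E n => x) S.χ S.χ := fun _ h => h
  have hcb := hS.gains.cb_pos
  set a := S.W x - wa with ha
  have hwa : S.dphiT x x wa = S.dphiT x x (S.W x) - S.dphiT x x a := by
    rw [ha, map_sub]; abel
  have hs1 : ‖S.dW x (S.f x)‖ ≤ S.sup₁ (fun x => ‖S.dW x (S.f x)‖) :=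
    le_sup₁ (F := fun x => ‖S.dW x (S.f x)‖) ((bddOn_dW hS hid).clm_apply (bddOn_f hS hid)).norm hx
  have hs2 : ‖S.dW x (S.GR x (S.dphiT x x (S.W x)))‖
      ≤ S.sup₁ (fun x => ‖S.dW x (S.GR x (S.dphiT x x (S.W x)))‖) :=
    le_sup₁ (F := fun x => ‖S.dW x (S.GR x (S.dphiT x x (S.W x)))‖)
      ((bddOn_dW hS hid).clm_apply ((bddOn_GR hS hid).clm_apply
        ((bddOn_dphiT hS hid hid).clm_apply (bddOn_W hS hid)))).norm hx
  have hs3 : ‖S.dW x ∘L S.GR x‖ ≤ S.sup₁ (fun x => ‖S.dW x ∘L S.GR x‖) :=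
    le_sup₁ (F := fun x => ‖S.dW x ∘L S.GR x‖)
      ((bddOn_dW hS hid).clm_comp (bddOn_GR hS hid)).norm hx
  have hs4 : ‖S.dW x ∘L S.GR x ∘L S.dphiT x x‖
      ≤ S.sup₁ (fun x => ‖S.dW x ∘L S.GR x ∘L S.dphiT x x‖) :=
    le_sup₁ (F := fun x => ‖S.dW x ∘L S.GR x ∘L S.dphiT x x‖)
      ((bddOn_dW hS hid).clm_comp ((bddOn_GR hS hid).clm_comp (bddOn_dphiT hS hid hid))).norm hx
  have h3 : ‖S.dW x (S.GR x (S.gradB x))‖ ≤ S.sup₁ (fun x => ‖S.dW x ∘L S.GR x‖) * Bsup :=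
    ((S.dW x ∘L S.GR x).le_opNorm _).trans
      (mul_le_mul hs3 hB (norm_nonneg _) ((norm_nonneg _).trans hs3))
  have h4 : ‖S.dW x (S.GR x (S.dphiT x x a))‖
      ≤ S.sup₁ (fun x => ‖S.dW x ∘L S.GR x ∘L S.dphiT x x‖) * ‖a‖ :=
    ((S.dW x ∘L S.GR x ∘L S.dphiT x x).le_opNorm _).trans
      (mul_le_mul_of_nonneg_right hs4 (norm_nonneg _))
  have hsplit : S.dW x (S.f x + S.g x (S.policy x wa))
      = S.dW x (S.f x) - (1 / 2 : ℝ) • S.dW x (S.GR x (S.dphiT x x (S.W x)))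
        + (1 / 2 : ℝ) • S.dW x (S.GR x (S.dphiT x x a))
        - (S.cb / 2) • S.dW x (S.GR x (S.gradB x)) := by
    rw [plant_field_eq, hwa]
    simp only [map_sub, map_smul, smul_sub]
    abel
  rw [hsplit]
  refine (norm_sub_le _ _).trans ((add_le_add ((norm_add_le _ _).trans
    (add_le_add (norm_sub_le _ _) le_rfl)) le_rfl).trans ?_)
  rw [norm_smul, norm_smul, norm_smul, Real.norm_of_nonneg (by norm_num : (0 : ℝ) ≤ 1 / 2),
    Real.norm_of_nonneg (by positivity : 0 ≤ S.cb / 2), iotaX]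
  have h5 := mul_le_mul_of_nonneg_left h3 (by positivity : 0 ≤ S.cb / 2)
  linarith

/-- The critic update law in the metric `P = Γ⁻¹`. -/
theorem inner_critic (x : E n) (wc wa : E L) (Γ P : E L →L[ℝ] E L) (th : E p) (t : ℝ) (c : E L)
    (hP : ∀ v, ⟪P c, Γ v⟫ = ⟪c, v⟫) :
    -⟪P c, S.critic x wc wa Γ th t⟫
      = S.kc1 * (⟪c, S.omega x wa th⟫ / S.rho (S.omega x wa th) ^ 2 * S.delta x wc wa th)
        + S.kc2 / N * ∑ i, ⟪c, S.omegaAt (S.xi i x t) x wa th⟫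
          / S.rho (S.omegaAt (S.xi i x t) x wa th) ^ 2 * S.deltaAt (S.xi i x t) x wc wa th := by
  rw [critic, inner_neg_right, neg_neg, hP, inner_add_right, inner_smul_right, inner_smul_right,
    inner_sum]
  congr 1
  · ring
  · congr 1
    refine Finset.sum_congr rfl fun i _ => ?_
    rw [inner_smul_right]
    ring

/-- Measuring the critic error in the metric `Γ⁻¹` cancels the gain in its law, and the projection
only helps. The remaining learning terms regroup regressor by regressor. -/
theorem learning_rate_le (hS : S.Assumptions) {x : E n} (hx : x ∈ S.χ) (wc wa : E L)
    (Γ P : E L →L[ℝ] E L) (th : E p) (t : ℝ)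
    (hP : ∀ v, ⟪P (S.W x - wc), Γ v⟫ = ⟪S.W x - wc, v⟫) :
    -⟪P (S.W x - wc), S.critic x wc wa Γ th t⟫
        + 1 / 2 * (S.kc1 * ⟪S.W x - wc, S.Lam (S.omega x wa th) (S.W x - wc)⟫
          + S.kc2 * ⟪S.W x - wc, S.LamAvg x wa th t (S.W x - wc)⟫)
        - ⟪S.W x - wa, S.actor x wc wa th t⟫
      ≤ S.ka1 * ⟪S.W x - wa, S.W x - wc⟫ - (S.ka1 + S.ka2) * ‖S.W x - wa‖ ^ 2
        + S.ka2 * ⟪S.W x - wa, S.W x⟫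
        + S.kc1 * S.regressorTerm x x wc wa (S.omega x wa th) (S.delta x wc wa th)
        + S.kc2 / N * ∑ i, S.regressorTerm (S.xi i x t) x wc wa
            (S.omegaAt (S.xi i x t) x wa th) (S.deltaAt (S.xi i x t) x wc wa th) := by
  rw [inner_critic x wc wa Γ P th t _ hP, inner_LamAvg]
  set c := S.W x - wc with hc
  set a := S.W x - wa with ha
  have hproj := inner_sub_le_inner_sub_proj hS.projection (hS.projection.ideal x hx) wa
    (-(S.ka1 • (wa - wc)) - S.ka2 • wa
    + (S.kc1 / (4 * S.rho (S.omega x wa th) ^ 2) * ⟪S.omega x wa th, wc⟫) •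
        ContinuousLinearMap.adjoint (S.Gphi x x) wa
    + ∑ i, (S.kc2 / (4 * N * S.rho (S.omegaAt (S.xi i x t) x wa th) ^ 2)
          * ⟪S.omegaAt (S.xi i x t) x wa th, wc⟫) •
        ContinuousLinearMap.adjoint (S.Gphi (S.xi i x t) x) wa)
  have h1 : wa - wc = c - a := by rw [hc, ha]; abel
  have h2 : wa = S.W x - a := by rw [ha]; abel
  have h3 : ⟪a, -(S.ka1 • (wa - wc)) - S.ka2 • wa⟫
      = -(S.ka1 * ⟪a, c⟫) + (S.ka1 + S.ka2) * ‖a‖ ^ 2 - S.ka2 * ⟪a, S.W x⟫ := by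
    rw [h1]
    conv_lhs => rw [h2]
    simp only [inner_sub_right, inner_neg_right, inner_smul_right, real_inner_self_eq_norm_sq]
    ring
  have hsum : ∑ i, ⟪a, (S.kc2 / (4 * N * S.rho (S.omegaAt (S.xi i x t) x wa th) ^ 2)
          * ⟪S.omegaAt (S.xi i x t) x wa th, wc⟫) •
        ContinuousLinearMap.adjoint (S.Gphi (S.xi i x t) x) wa⟫
      = S.kc2 / N * ∑ i, 1 / (4 * S.rho (S.omegaAt (S.xi i x t) x wa th) ^ 2)
          * ⟪S.omegaAt (S.xi i x t) x wa th, wc⟫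
          * ⟪a, ContinuousLinearMap.adjoint (S.Gphi (S.xi i x t) x) wa⟫ := by
    rw [Finset.mul_sum]
    refine Finset.sum_congr rfl fun i _ => ?_
    rw [inner_smul_right]
    have : S.kc2 / (4 * N * S.rho (S.omegaAt (S.xi i x t) x wa th) ^ 2)
        = S.kc2 / N * (1 / (4 * S.rho (S.omegaAt (S.xi i x t) x wa th) ^ 2)) := by
      simp only [div_eq_mul_inv, mul_inv]; ring
    rw [this]
    ring
  rw [inner_add_right, inner_add_right, inner_sum, hsum, h3, inner_smul_right] at hproj
  have hterm : ∑ i, S.regressorTerm (S.xi i x t) x wc wa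
            (S.omegaAt (S.xi i x t) x wa th) (S.deltaAt (S.xi i x t) x wc wa th)
      = ∑ i, ⟪c, S.omegaAt (S.xi i x t) x wa th⟫
          / S.rho (S.omegaAt (S.xi i x t) x wa th) ^ 2 * S.deltaAt (S.xi i x t) x wc wa th
        + 1 / 2 * ∑ i, ⟪c, S.Lam (S.omegaAt (S.xi i x t) x wa th) c⟫
        - ∑ i, 1 / (4 * S.rho (S.omegaAt (S.xi i x t) x wa th) ^ 2)
          * ⟪S.omegaAt (S.xi i x t) x wa th, wc⟫
          * ⟪a, ContinuousLinearMap.adjoint (S.Gphi (S.xi i x t) x) wa⟫ := by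
    rw [Finset.mul_sum, ← Finset.sum_add_distrib, ← Finset.sum_sub_distrib]
    rfl
  have hself : S.kc1 * S.regressorTerm x x wc wa (S.omega x wa th) (S.delta x wc wa th)
      = S.kc1 * (⟪c, S.omega x wa th⟫ / S.rho (S.omega x wa th) ^ 2 * S.delta x wc wa th)
        + 1 / 2 * (S.kc1 * ⟪c, S.Lam (S.omega x wa th) c⟫)
        - S.kc1 / (4 * S.rho (S.omega x wa th) ^ 2) * ⟪S.omega x wa th, wc⟫
          * ⟪a, ContinuousLinearMap.adjoint (S.Gphi x x) wa⟫ := by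
    rw [regressorTerm, ← hc, ← ha]
    ring
  rw [hterm, hself, actor]
  have h4 : S.kc2 * (1 / (N : ℝ) * ∑ i, ⟪c, S.Lam (S.omegaAt (S.xi i x t) x wa th) c⟫)
      = S.kc2 / N * ∑ i, ⟪c, S.Lam (S.omegaAt (S.xi i x t) x wa th) c⟫ := by ring
  rw [h4]
  linarith

/-- The damping term of the current regressor is discarded: pointwise excitation is available only
for the extrapolated ones. -/
theorem regressorTerm_omega_le (hS : S.Assumptions) {x : E n} (hx : x ∈ S.χ) (wc wa : E L)
    (th : E p) {Bsup : ℝ} (hB : ‖S.gradB x‖ ≤ Bsup) :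
    S.regressorTerm x x wc wa (S.omega x wa th) (S.delta x wc wa th)
      ≤ S.commonBound ‖S.W x - wc‖ ‖S.W x - wa‖ ‖S.θ - th‖
        + S.regBound * ‖S.W x - wc‖
          * (1 / 2 * (S.sup₁ (fun x => ‖S.GR x ∘L S.dphiT x x‖) * (S.cb * Bsup) * ‖S.W x - wa‖)
          + 1 / 4 * (S.sup₁ (fun x => ‖S.GR x‖) * (S.cb * Bsup) ^ 2)) := by
  have hid : MapsTo (fun x : E n => x) S.χ S.χ := fun _ h => h
  have hcb := hS.gains.cb_pos
  have hq := regBound_nonneg (S := S)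
  have hxx : x ∈ S.χ ∩ Metric.closedBall x S.l :=
    ⟨hx, Metric.mem_closedBall_self hS.approx.l_pos.le⟩
  have h := regressorTerm_le hS hx hxx (S.cb • S.gradB x) wc wa (S.omega x wa th) th
    (S.delta x wc wa th) (by
      have hs : S.cb • S.gradB x - S.dphiT x x (S.W x - wa)
          = S.dphiT x x wa + S.cb • S.gradB x - S.dphiT x x (S.W x) := by rw [map_sub]; abel
      rw [hs, delta, omega, policy_eq, bellman_error_eq hS.value])
  have h0 := inner_Lam_nonneg (S := S) (S.omega x wa th) (S.W x - wc)
  have hs1 : ‖S.GR x ∘L S.dphiT x x‖ ≤ S.sup₁ (fun x => ‖S.GR x ∘L S.dphiT x x‖) :=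
    le_sup₁ (F := fun x => ‖S.GR x ∘L S.dphiT x x‖)
      ((bddOn_GR hS hid).clm_comp (bddOn_dphiT hS hid hid)).norm hx
  have hs2 : ‖S.GR x‖ ≤ S.sup₁ (fun x => ‖S.GR x‖) :=
    le_sup₁ (F := fun x => ‖S.GR x‖) (bddOn_GR hS hid).norm hx
  have hb : ‖S.cb • S.gradB x‖ ≤ S.cb * Bsup := by
    rw [norm_smul, Real.norm_of_nonneg hcb.le]
    gcongr
  have hs1' := (norm_nonneg _).trans hs1
  have hs2' := (norm_nonneg _).trans hs2
  have h1 : S.regBound * ‖S.W x - wc‖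
      * (1 / 2 * (‖S.GR x ∘L S.dphiT x x‖ * ‖S.cb • S.gradB x‖ * ‖S.W x - wa‖)
          + 1 / 4 * (‖S.GR x‖ * ‖S.cb • S.gradB x‖ ^ 2))
      ≤ S.regBound * ‖S.W x - wc‖
          * (1 / 2 * (S.sup₁ (fun x => ‖S.GR x ∘L S.dphiT x x‖) * (S.cb * Bsup) * ‖S.W x - wa‖)
          + 1 / 4 * (S.sup₁ (fun x => ‖S.GR x‖) * (S.cb * Bsup) ^ 2)) := by
    gcongr
  linarith

theorem regressorTerm_omegaAt_le (hS : S.Assumptions) {y x : E n} (hx : x ∈ S.χ)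
    (hy : y ∈ S.χ ∩ Metric.closedBall x S.l) (wc wa : E L) (th : E p) :
    S.regressorTerm y x wc wa (S.omegaAt y x wa th) (S.deltaAt y x wc wa th)
      ≤ -(1 / 2 * ⟪S.W x - wc, S.Lam (S.omegaAt y x wa th) (S.W x - wc)⟫)
        + S.commonBound ‖S.W x - wc‖ ‖S.W x - wa‖ ‖S.θ - th‖ := by
  have h := regressorTerm_le hS hx hy 0 wc wa (S.omegaAt y x wa th) th (S.deltaAt y x wc wa th) (by
      have hs : 0 - S.dphiT y x (S.W x - wa) = S.dphiT y x wa - S.dphiT y x (S.W x) := by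
        rw [map_sub]; abel
      rw [hs, deltaAt, omegaAt, khat, bellman_error_eq hS.value])
  simpa using h

end Scheme

/-- Half of a quadratic damping pays for a linear term, by `(X s - i)² ≥ 0`. -/
theorem mul_sub_half_mul_sq_le {X i s : ℝ} (hX : 0 < X) :
    i * s - 1 / 2 * X * s ^ 2 ≤ i ^ 2 / (2 * X) := by
  rw [le_div_iff₀ (by positivity)]
  nlinarith [sq_nonneg (X * s - i)]

namespace Scheme

variable {n m L p N : ℕ} {S : Scheme n m L p N}

/-! ### Signs of the constants -/

theorem sup₁_nonneg {F : E n → ℝ} (hF : ∀ x, 0 ≤ F x) : 0 ≤ S.sup₁ F :=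
  Real.sSup_nonneg (by rintro _ ⟨x, -, rfl⟩; exact hF x)

theorem sup₂_nonneg {F : E n → E n → ℝ} (hF : ∀ x y, 0 ≤ F x y) : 0 ≤ S.sup₂ F :=
  Real.sSup_nonneg (by rintro _ ⟨x, -, y, -, rfl⟩; exact hF x y)

theorem commonBound_nonneg {c a ϑ : ℝ} (hc : 0 ≤ c) (ha : 0 ≤ a) (hϑ : 0 ≤ ϑ) :
    0 ≤ S.commonBound c a ϑ := by
  have h1 : 0 ≤ S.sup₂ (fun x y => ‖innerSL ℝ (S.W x) ∘L S.dphi y x ∘L S.Y y‖) :=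
    sup₂_nonneg fun _ _ => norm_nonneg _
  have h2 : 0 ≤ S.sup₂ (fun x y => |S.Delta x y|) := sup₂_nonneg fun _ _ => abs_nonneg _
  have h3 : 0 ≤ S.sup₂ (fun x y => ‖S.Gphi y x‖) := sup₂_nonneg fun _ _ => norm_nonneg _
  have h4 : 0 ≤ S.sup₂ (fun x y => ‖S.Gphi y x‖ * ‖S.W x‖) :=
    sup₂_nonneg fun _ _ => by positivity
  have h5 := regBound_nonneg (S := S)
  rw [commonBound]
  positivity

theorem clow_mul_pos (hS : S.Assumptions) {c₃ Γup : ℝ} (hc₃ : 0 ≤ c₃) (hup : 0 < Γup) :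
    0 < S.clow c₃ Γup * S.kc2 := by
  have h1 := hS.gains.kc2_pos
  have h2 := hS.gains.βc_pos
  rw [clow]
  positivity

theorem kappa_pos (hn : 0 < n) (hS : S.Assumptions) {c₃ Γup : ℝ} (hc₃ : 0 ≤ c₃) (hup : 0 < Γup) :
    0 < S.kappa c₃ Γup := by
  have h1 := clow_mul_pos hS hc₃ hup
  have h2 := hS.gains.ka1_pos
  have h3 := hS.gains.ka2_pos
  have h4 := hS.identifier.K_pos
  have h5 := hS.value.Q_pos.lambdaMin_pos hn
  rw [kappa]
  exact lt_min h5 (lt_min (by positivity) (lt_min (by positivity) (by positivity)))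

/-- Strictness comes from `D_θ²/(2K_θ)`, and it makes the decay rate `ι` usable as a divisor. -/
theorem iota_pos (hS : S.Assumptions) {c₃ Γlow Γup Bsup : ℝ} (hc₃ : 0 ≤ c₃) (hup : 0 < Γup)
    (hB : 0 ≤ Bsup) : 0 < S.iota c₃ Γlow Γup Bsup := by
  have h1 := clow_mul_pos hS hc₃ hup
  have h2 := hS.gains.ka1_pos
  have h3 := hS.gains.ka2_pos
  have h4 := hS.identifier.K_pos
  have h5 := hS.identifier.D_pos
  have h6 := hS.gains.cb_pos
  have h7 : 0 ≤ S.sup₁ (fun x => ‖S.dV x ∘L S.GR x‖) := sup₁_nonneg fun _ => norm_nonneg _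
  have h8 : 0 ≤ S.sup₁ (fun x => ‖innerSL ℝ (S.phi x x) ∘L S.dW x + S.dEps x‖) :=
    sup₁_nonneg fun _ => norm_nonneg _
  rw [iota, mul_assoc 2 (S.clow c₃ Γup)]
  positivity

/-- Positivity of `λ_min(M)` absorbs the cross terms. -/
theorem cross_terms_le {c₃ Γlow Γup Bsup : ℝ} (hM : 0 < lambdaMin (S.M c₃ Γlow Γup Bsup))
    (c a ϑ : ℝ) :
    S.phiA * a ^ 2 + S.phiAC Γlow Bsup * (a * c) + S.phiCθ * (c * ϑ)
      ≤ S.clow c₃ Γup * S.kc2 / 4 * c ^ 2 + (S.ka1 + S.ka2) / 4 * a ^ 2 + S.Kθ / 4 * ϑ ^ 2 := by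
  have hH : (S.M c₃ Γlow Γup Bsup).IsHermitian := by
    ext i j
    fin_cases i <;> fin_cases j <;> simp [M]
  have h := dotProduct_mulVec_nonneg_of_lambdaMin_pos hH hM ![c, a, ϑ]
  simp [M, Matrix.mulVec, dotProduct, Fin.sum_univ_three] at h
  linarith

/-! ### The derivative of the Lyapunov function -/

theorem extrapolation_sum_le (hS : S.Assumptions) {x : E n} (hx : x ∈ S.χ) (wc wa : E L)
    (th : E p) {t c₃ : ℝ} (ht : 0 ≤ t)
    (hexc : c₃ * ‖S.W x - wc‖ ^ 2 ≤ ⟪S.W x - wc, S.LamAvg x wa th t (S.W x - wc)⟫) :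
    S.kc2 / N * ∑ i, S.regressorTerm (S.xi i x t) x wc wa
        (S.omegaAt (S.xi i x t) x wa th) (S.deltaAt (S.xi i x t) x wc wa th)
      ≤ -(1 / 2 * S.kc2 * (c₃ * ‖S.W x - wc‖ ^ 2))
        + S.kc2 * S.commonBound ‖S.W x - wc‖ ‖S.W x - wa‖ ‖S.θ - th‖ := by
  have hk := hS.gains.kc2_pos
  set C := S.commonBound ‖S.W x - wc‖ ‖S.W x - wa‖ ‖S.θ - th‖ with hC
  have hC0 : 0 ≤ C := commonBound_nonneg (norm_nonneg _) (norm_nonneg _) (norm_nonneg _)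
  have h1 := Finset.sum_le_sum fun (i : Fin N) (_ : i ∈ Finset.univ) =>
    regressorTerm_omegaAt_le hS hx (hS.approx.extrapolation i x hx t ht) wc wa th
  rw [Finset.sum_add_distrib, Finset.sum_neg_distrib, ← Finset.mul_sum, Finset.sum_const,
    Finset.card_univ, Fintype.card_fin, nsmul_eq_mul] at h1
  have h2 := mul_le_mul_of_nonneg_left h1 (by positivity : 0 ≤ S.kc2 / N)
  rw [inner_LamAvg] at hexc
  have h3 := mul_le_mul_of_nonneg_left hexc hk.le
  have h4 : S.kc2 / N * (N * C) ≤ S.kc2 * C := by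
    rcases Nat.eq_zero_or_pos N with h0 | h0
    · simp only [h0, Nat.cast_zero, div_zero, zero_mul]
      positivity
    · have hN : (N : ℝ) ≠ 0 := by positivity
      exact le_of_eq (by field_simp)
  have h5 : S.kc2 / N * ∑ i, ⟪S.W x - wc, S.Lam (S.omegaAt (S.xi i x t) x wa th) (S.W x - wc)⟫
      = S.kc2 * (1 / N *
        ∑ i, ⟪S.W x - wc, S.Lam (S.omegaAt (S.xi i x t) x wa th) (S.W x - wc)⟫) := by ring
  linarith

theorem lyapunov_rate_le (hS : S.Assumptions) {x : E n} (hx : x ∈ S.χ)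
    {c₃ Γlow Γup Bsup t : ℝ} (hc₃ : 0 ≤ c₃) (hlow : 0 < Γlow) (hup : 0 < Γup)
    (hM : 0 < lambdaMin (S.M c₃ Γlow Γup Bsup)) (hB : ‖S.gradB x‖ ≤ Bsup) (ht : 0 ≤ t)
    (wc wa : E L) (th : E p) {Γ : E L →L[ℝ] E L} (hΓ : IsSelfAdjoint Γ)
    (hΓb : ∀ v, Γlow * ‖v‖ ^ 2 ≤ ⟪v, Γ v⟫ ∧ ⟪v, Γ v⟫ ≤ Γup * ‖v‖ ^ 2)
    (hexc : c₃ * ‖S.W x - wc‖ ^ 2 ≤ ⟪S.W x - wc, S.LamAvg x wa th t (S.W x - wc)⟫) :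
    ⟪gradient S.V x, S.f x + S.g x (S.policy x wa)⟫
      + ⟪Γ.inverse (S.W x - wc), S.dW x (S.f x + S.g x (S.policy x wa))
          - S.critic x wc wa Γ th t⟫
      + 1 / 2 * (S.kc1 * ⟪S.W x - wc, S.Lam (S.omega x wa th) (S.W x - wc)⟫
          + S.kc2 * ⟪S.W x - wc, S.LamAvg x wa th t (S.W x - wc)⟫
          - S.βc * ⟪S.W x - wc, Γ.inverse (S.W x - wc)⟫)
      + ⟪S.W x - wa, S.dW x (S.f x + S.g x (S.policy x wa)) - S.actor x wc wa th t⟫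
      + (-S.Kθ * ‖S.θ - th‖ ^ 2 + S.Dθ * ‖S.θ - th‖)
      ≤ -(S.kappa c₃ Γup * ‖stack x (S.W x - wc) (S.W x - wa) (S.θ - th)‖ ^ 2)
        + S.iota c₃ Γlow Γup Bsup := by
  have hid : MapsTo (fun x : E n => x) S.χ S.χ := fun _ h => h
  have hu := isUnit_of_coercive hlow fun v => (hΓb v).1
  have h1 := value_rate_le hS hx wa hB
  have h2 := norm_dW_field_le hS hx wa hB
  have h3 := learning_rate_le hS hx wc wa Γ Γ.inverse th t fun v => by
    rw [inner_inverse_of_isUnit hΓ hu, inverse_apply_of_isUnit hu]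
  have h4 := regressorTerm_omega_le hS hx wc wa th hB
  have h5 := extrapolation_sum_le hS hx wc wa th ht hexc
  have hP1 := norm_inverse_apply_le hlow (fun v => (hΓb v).1) (S.W x - wc)
  have hP2 := norm_sq_div_le_inner_inverse hΓ hlow hup hΓb (S.W x - wc)
  have hW : ⟪S.W x - wa, S.W x⟫ ≤ ‖S.W x - wa‖ * S.sup₁ (fun x => ‖S.W x‖) :=
    (real_inner_le_norm _ _).trans (mul_le_mul_of_nonneg_left
      (le_sup₁ (F := fun x => ‖S.W x‖) (bddOn_W hS hid).norm hx) (norm_nonneg _))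
  have hac := real_inner_le_norm (S.W x - wa) (S.W x - wc)
  have hk1 := hS.gains.kc1_pos
  have hk2 := hS.gains.kc2_pos
  have hka1 := hS.gains.ka1_pos
  have hka2 := hS.gains.ka2_pos
  have hβ := hS.gains.βc_pos
  have hK := hS.identifier.K_pos
  have hX := clow_mul_pos hS hc₃ hup
  rw [inner_sub_right, inner_sub_right, norm_stack_sq]
  have h6 : ⟪Γ.inverse (S.W x - wc), S.dW x (S.f x + S.g x (S.policy x wa))⟫
      ≤ ‖S.W x - wc‖ / Γlow * (S.iotaX Bsup
        + 1 / 2 * S.sup₁ (fun x => ‖S.dW x ∘L S.GR x ∘L S.dphiT x x‖) * ‖S.W x - wa‖) :=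
    (real_inner_le_norm _ _).trans (mul_le_mul hP1 h2 (norm_nonneg _) (by positivity))
  have h7 : ⟪S.W x - wa, S.dW x (S.f x + S.g x (S.policy x wa))⟫
      ≤ ‖S.W x - wa‖ * (S.iotaX Bsup
        + 1 / 2 * S.sup₁ (fun x => ‖S.dW x ∘L S.GR x ∘L S.dphiT x x‖) * ‖S.W x - wa‖) :=
    (real_inner_le_norm _ _).trans (mul_le_mul_of_nonneg_left h2 (norm_nonneg _))
  have hcross := cross_terms_le hM ‖S.W x - wc‖ ‖S.W x - wa‖ ‖S.θ - th‖
  have hsqC := mul_sub_half_mul_sq_le (i := S.iotaC Γlow Bsup) (s := ‖S.W x - wc‖) hX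
  have hsqA := mul_sub_half_mul_sq_le (i := S.iotaA Bsup) (s := ‖S.W x - wa‖)
    (add_pos hka1 hka2)
  have hsqθ := mul_sub_half_mul_sq_le (i := S.Dθ) (s := ‖S.θ - th‖) hK
  set c := ‖S.W x - wc‖
  set a := ‖S.W x - wa‖
  set ϑ := ‖S.θ - th‖
  have hκ : S.kappa c₃ Γup * (‖x‖ ^ 2 + c ^ 2 + a ^ 2 + ϑ ^ 2) ≤ lambdaMin S.Q * ‖x‖ ^ 2
      + S.clow c₃ Γup * S.kc2 / 4 * c ^ 2 + (S.ka1 + S.ka2) / 4 * a ^ 2 + S.Kθ / 4 * ϑ ^ 2 := by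
    have k1 : S.kappa c₃ Γup ≤ lambdaMin S.Q := min_le_left _ _
    have k2 : S.kappa c₃ Γup ≤ S.clow c₃ Γup * S.kc2 / 4 :=
      (min_le_right _ _).trans (min_le_left _ _)
    have k3 : S.kappa c₃ Γup ≤ (S.ka1 + S.ka2) / 4 :=
      (min_le_right _ _).trans ((min_le_right _ _).trans (min_le_left _ _))
    have k4 : S.kappa c₃ Γup ≤ S.Kθ / 4 :=
      (min_le_right _ _).trans ((min_le_right _ _).trans (min_le_right _ _))
    linarith [mul_le_mul_of_nonneg_right k1 (sq_nonneg ‖x‖),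
      mul_le_mul_of_nonneg_right k2 (sq_nonneg c), mul_le_mul_of_nonneg_right k3 (sq_nonneg a),
      mul_le_mul_of_nonneg_right k4 (sq_nonneg ϑ)]
  have hι : S.iota c₃ Γlow Γup Bsup = 1 / 2 * S.sup₁ (fun x => ‖S.dV x ∘L S.GR x‖)
      * (S.sup₁ (fun x => ‖innerSL ℝ (S.phi x x) ∘L S.dW x + S.dEps x‖) + S.cb * Bsup)
      + S.iotaC Γlow Bsup ^ 2 / (2 * (S.clow c₃ Γup * S.kc2))
      + S.iotaA Bsup ^ 2 / (2 * (S.ka1 + S.ka2)) + S.Dθ ^ 2 / (2 * S.Kθ) := by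
    rw [iota, mul_assoc 2]
  -- The definition of `clow` merges the two sources of critic damping: extrapolation with level
  -- `c₃` and the forgetting term `-½ β_c Γ⁻¹`.
  have hXc : S.clow c₃ Γup * S.kc2 * c ^ 2
      = 1 / 2 * S.kc2 * (c₃ * c ^ 2) + 1 / 2 * (S.βc * (c ^ 2 / Γup)) := by
    rw [clow]
    field_simp
  have hβP := mul_le_mul_of_nonneg_left hP2 hβ.le
  have h4' := mul_le_mul_of_nonneg_left h4 hk1.le
  have hac' := mul_le_mul_of_nonneg_left hac hka1.le
  have hW' := mul_le_mul_of_nonneg_left hW hka2.le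
  -- All upper bounds collected by degree in the errors: linear coefficients are `iotaC` and
  -- `iotaA`, quadratic ones `phiA`, `phiAC` and `phiCθ`.
  have hlin : c / Γlow * (S.iotaX Bsup
        + 1 / 2 * S.sup₁ (fun x => ‖S.dW x ∘L S.GR x ∘L S.dphiT x x‖) * a)
      + a * (S.iotaX Bsup
        + 1 / 2 * S.sup₁ (fun x => ‖S.dW x ∘L S.GR x ∘L S.dphiT x x‖) * a)
      + 1 / 2 * S.sup₁ (fun x => ‖S.dV x ∘L S.GR x ∘L S.dphiT x x‖) * a
      + S.ka1 * (a * c) + S.ka2 * (a * S.sup₁ (fun x => ‖S.W x‖))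
      + S.kc1 * (S.commonBound c a ϑ + S.regBound * c
          * (1 / 2 * (S.sup₁ (fun x => ‖S.GR x ∘L S.dphiT x x‖) * (S.cb * Bsup) * a)
          + 1 / 4 * (S.sup₁ (fun x => ‖S.GR x‖) * (S.cb * Bsup) ^ 2)))
      + S.kc2 * S.commonBound c a ϑ
      = S.iotaC Γlow Bsup * c + S.iotaA Bsup * a
        + (S.phiA * a ^ 2 + S.phiAC Γlow Bsup * (a * c) + S.phiCθ * (c * ϑ)) := by
    simp only [iotaC, iotaA, phiA, phiAC, phiCθ, commonBound, regBound]
    ring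
  rw [hι]
  linarith

end Scheme

theorem norm_stack_eq_sqrt {n L p : ℕ} (x : E n) (wc wa : E L) (th : E p) :
    ‖stack x wc wa th‖ = √(‖x‖ ^ 2 + ‖wc‖ ^ 2 + ‖wa‖ ^ 2 + ‖th‖ ^ 2) := by
  rw [← norm_stack_sq, Real.sqrt_sq (norm_nonneg _)]

namespace Scheme

variable {n m L p N : ℕ} {S : Scheme n m L p N}

/-! ### The Lyapunov function along a run -/

/-- `V_L(Z(t), t)` along a run. -/
noncomputable def lyap (S : Scheme n m L p N) (r : Run n L p) (t : ℝ) : ℝ :=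
  S.VL r (r.x t) (S.W (r.x t) - r.Wc t) (S.W (r.x t) - r.Wa t) (S.θ - r.θh t) t

section AlongRun

variable {r : Run n L p} {t₀ c₃ Γlow Γup Bsup : ℝ}

theorem ExcitedRun.continuousWithinAt_W (hS : S.Assumptions) (hr : S.ExcitedRun r t₀ c₃ Bsup)
    {t : ℝ} (ht : t₀ ≤ t) (hx : r.x t ∈ S.χ) :
    ContinuousWithinAt (fun s => S.W (r.x s)) (Ici t₀) t := by
  have hxc : ContinuousWithinAt r.x (Ici t₀) t := by
    simpa [timeInterval_top] using hr.sol.x_cont t (mem_timeInterval_top.2 ht)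
  exact (W_contDiffAt hS.approx hx).continuousAt.comp_continuousWithinAt hxc

theorem ExcitedRun.continuousWithinAt_norm_Z (hS : S.Assumptions)
    (hr : S.ExcitedRun r t₀ c₃ Bsup) {t : ℝ} (ht : t₀ ≤ t) (hx : r.x t ∈ S.χ) :
    ContinuousWithinAt (fun s => ‖S.Z r s‖) (Ici t₀) t := by
  have hmem := mem_timeInterval_top.2 ht
  have hW := hr.continuousWithinAt_W hS ht hx
  have hxc := hr.sol.x_cont t hmem
  have hc := hr.sol.Wc_cont t hmem
  have ha := hr.sol.Wa_cont t hmem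
  have hθ := hr.sol.θh_cont t hmem
  rw [timeInterval_top] at hxc hc ha hθ
  simp only [Z, norm_stack_eq_sqrt]
  exact ((((hxc.norm.pow 2).add ((hW.sub hc).norm.pow 2)).add ((hW.sub ha).norm.pow 2)).add
    ((continuousWithinAt_const.sub hθ).norm.pow 2)).sqrt

theorem ExcitedRun.continuousOn_lyap (hS : S.Assumptions) (hr : S.ExcitedRun r t₀ c₃ Bsup)
    {b : ℝ} (hx : ∀ t ∈ Icc t₀ b, r.x t ∈ S.χ) : ContinuousOn (S.lyap r) (Icc t₀ b) := by
  obtain ⟨K, D, hflow, -⟩ := hr.exists_gainFlow hS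
  have hsub : Icc t₀ b ⊆ timeInterval t₀ ⊤ := fun t ht => mem_timeInterval_top.2 ht.1
  have hW : ContinuousOn (fun s => S.W (r.x s)) (Icc t₀ b) := fun t ht =>
    (hr.continuousWithinAt_W hS ht.1 (hx t ht)).mono Icc_subset_Ici_self
  have hxc := hr.sol.x_cont.mono hsub
  have hc := hW.sub (hr.sol.Wc_cont.mono hsub)
  have ha := hW.sub (hr.sol.Wa_cont.mono hsub)
  have hθ : ContinuousOn (fun s => S.θ - r.θh s) (Icc t₀ b) :=
    continuousOn_const.sub (hr.sol.θh_cont.mono hsub)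
  have hP := hflow.continuousOn_inverse (s := Icc t₀ b) Icc_subset_Ici_self
    fun t ht => hflow.isUnit ht.1
  have hVθ : ContinuousOn (fun s => S.Vθ (S.θ - r.θh s, s)) (Icc t₀ b) :=
    hS.identifier.cont.comp (hθ.prodMk continuousOn_id) fun t ht =>
      ⟨mem_univ _, hr.t₀_nonneg.trans ht.1⟩
  exact (((hS.value.smooth.continuous.comp_continuousOn hxc).add
    (continuousOn_const.mul (hc.inner (hP.clm_apply hc)))).add
    (continuousOn_const.mul (ha.inner ha))).add hVθ

theorem ExcitedRun.exists_hasDerivAt_lyap_le (hS : S.Assumptions)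
    (hr : S.ExcitedRun r t₀ c₃ Bsup) (hc₃ : 0 ≤ c₃) (hlow : 0 < Γlow) (hup : 0 < Γup)
    (hM : 0 < lambdaMin (S.M c₃ Γlow Γup Bsup)) (hb : r.GainBounds t₀ Γlow Γup) :
    ∃ D : Set ℝ, (∀ s, (D ∩ Icc t₀ s).Finite) ∧ ∀ t > t₀, t ∉ D → r.x t ∈ S.χ →
      HasDerivAt (S.lyap r) (deriv (S.lyap r) t) t ∧
      deriv (S.lyap r) t ≤ -(S.kappa c₃ Γup * ‖S.Z r t‖ ^ 2) + S.iota c₃ Γlow Γup Bsup := by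
  obtain ⟨K, D, hflow, hode⟩ := hr.exists_gainFlow hS
  refine ⟨D, hflow.finite, fun t ht htD hx => ?_⟩
  obtain ⟨hx', hc', ha', hθ'⟩ := hode t ht htD
  have hu := hflow.isUnit ht.le
  have hP' := hflow.hasDerivAt_inverse ht htD hu
  obtain ⟨hΓ, hΓb⟩ := hb t ht.le
  have hV : HasDerivAt (fun s => S.V (r.x s)) _ t :=
    ((hS.value.smooth.differentiable (by simp)).differentiableAt.hasFDerivAt
      (x := r.x t)).comp_hasDerivAt t hx'
  have hW : HasDerivAt (fun s => S.W (r.x s)) _ t :=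
    (((W_contDiffAt hS.approx hx).differentiableAt (by simp)).hasFDerivAt).comp_hasDerivAt t hx'
  have hc : HasDerivAt (fun s => S.W (r.x s) - r.Wc s) _ t := hW.sub hc'
  have ha : HasDerivAt (fun s => S.W (r.x s) - r.Wa s) _ t := hW.sub ha'
  obtain ⟨hdiff, hid⟩ := hr.identifier (S.θ - r.θh t) t ht
  rw [sub_sub_cancel] at hid
  have hθ : HasDerivAt (fun s => (S.θ - r.θh s, s)) (-r.ψ (r.θh t) t, (1 : ℝ)) t :=
    (hθ'.const_sub S.θ).prodMk (hasDerivAt_id t)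
  have hVθ : HasDerivAt (fun s => S.Vθ (S.θ - r.θh s, s)) _ t :=
    HasFDerivAt.comp_hasDerivAt (f := fun s => (S.θ - r.θh s, s)) t hdiff.hasFDerivAt hθ
  have hderiv := ((hV.add ((hc.inner ℝ (hP'.clm_apply hc)).const_mul (1 / 2))).add
    ((ha.inner ℝ ha).const_mul (1 / 2))).add hVθ
  obtain ⟨T, c₁, c₂, -, -, -, -, -, hexc⟩ := hr.excitation
  have hrate := lyapunov_rate_le hS hx hc₃ hlow hup hM
    (hr.gradB_bound t (mem_timeInterval_top.2 ht.le) (hr.mem_interior hS ht.le))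
    (hr.t₀_nonneg.trans ht.le) (r.Wc t) (r.Wa t) (r.θh t) hΓ hΓb (hexc t ht.le _).2.2
  have hderiv' : HasDerivAt (S.lyap r) _ t := hderiv
  refine ⟨hderiv'.differentiableAt.hasDerivAt, ?_⟩
  rw [hderiv'.deriv]
  refine le_trans ?_ hrate
  have hVeq : fderiv ℝ S.V (r.x t)
        (S.f (r.x t) + S.g (r.x t) (S.policy (r.x t) (r.Wa t)))
      = ⟪gradient S.V (r.x t), S.f (r.x t) + S.g (r.x t) (S.policy (r.x t) (r.Wa t))⟫ :=
    dV_apply _ _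
  rw [hVeq]
  have hA := inner_info (S := S) r t (S.W (r.x t) - r.Wc t) (S.W (r.x t) - r.Wc t)
  simp only [LamRun, LamAvgRun] at hA
  rw [← hA]
  set c := S.W (r.x t) - r.Wc t
  set a := S.W (r.x t) - r.Wa t
  set dw := fderiv ℝ S.W (r.x t) (S.f (r.x t) + S.g (r.x t) (S.policy (r.x t) (r.Wa t)))
  have hdw : S.dW (r.x t) (S.f (r.x t) + S.g (r.x t) (S.policy (r.x t) (r.Wa t))) = dw := rfl
  rw [hdw]
  set dc := dw - S.critic (r.x t) (r.Wc t) (r.Wa t) (r.Γ t) (r.θh t) t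
  set da := dw - S.actor (r.x t) (r.Wc t) (r.Wa t) (r.θh t) t
  -- Symmetry of `Γ⁻¹` makes the two product-rule terms equal, which removes the factor `1/2`.
  have e1 : ⟪c, (r.Γ t).inverse dc⟫ = ⟪(r.Γ t).inverse c, dc⟫ :=
    (inner_inverse_of_isUnit hΓ hu _ _).symm
  have e2 : ⟪dc, (r.Γ t).inverse c⟫ = ⟪(r.Γ t).inverse c, dc⟫ := real_inner_comm _ _
  have e3 : ⟪da, a⟫ = ⟪a, da⟫ := real_inner_comm _ _
  simp only [sub_apply, smul_apply, inner_add_right, inner_sub_right,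
    inner_smul_right, e1, e2, e3]
  linarith

theorem mu_nonneg : 0 ≤ S.mu c₃ Γlow Γup Bsup := Real.sqrt_nonneg _

theorem ExcitedRun.lyap_le (hn : 0 < n) (hS : S.Assumptions)
    (hr : S.ExcitedRun r t₀ c₃ Bsup) (hc₃ : 0 ≤ c₃) (hlow : 0 < Γlow) (hup : 0 < Γup)
    (hBsup : 0 ≤ Bsup) (hM : 0 < lambdaMin (S.M c₃ Γlow Γup Bsup))
    (hb : r.GainBounds t₀ Γlow Γup) {η₁ η₂ : ℝ → ℝ} (hη₂ : ClassK η₂)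
    (hsand : S.Sandwich r t₀ η₁ η₂) {b : ℝ} (hb₀ : t₀ ≤ b) (hx : ∀ t ∈ Icc t₀ b, r.x t ∈ S.χ) :
    S.lyap r b ≤ max (η₂ (S.mu c₃ Γlow Γup Bsup))
      (S.lyap r t₀ - S.iota c₃ Γlow Γup Bsup * (b - t₀)) := by
  obtain ⟨D, hD, hder⟩ := hr.exists_hasDerivAt_lyap_le hS hc₃ hlow hup hM hb
  have hι := iota_pos (Γlow := Γlow) hS hc₃ hup hBsup
  have hκ := kappa_pos hn hS hc₃ hup
  refine le_max_of_decreasing_above hb₀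
    ((hD b).subset (inter_subset_inter_right _ Ioo_subset_Icc_self)) hι.le
    (hr.continuousOn_lyap hS hx)
    (fun t ht htD => (hder t ht.1 htD (hx t (Ioo_subset_Icc_self ht))).1)
    fun t ht htD habove => ?_
  have hxt := hx t (Ioo_subset_Icc_self ht)
  refine (hder t ht.1 htD hxt).2.trans ?_
  have h1 : η₂ (S.mu c₃ Γlow Γup Bsup) < η₂ ‖S.Z r t‖ :=
    habove.trans_le (hsand t ht.1.le _ hxt _ _ _).2
  have h2 : S.mu c₃ Γlow Γup Bsup < ‖S.Z r t‖ := (hη₂.lt_iff mu_nonneg (norm_nonneg _)).1 h1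
  -- Squaring gives `κ‖Z‖² ≥ 2ι`, so the rate `-κ‖Z‖² + ι` is at most `-ι`.
  have h3 : S.mu c₃ Γlow Γup Bsup ^ 2 ≤ ‖S.Z r t‖ ^ 2 := by
    have := mu_nonneg (S := S) (c₃ := c₃) (Γlow := Γlow) (Γup := Γup) (Bsup := Bsup)
    gcongr
  rw [mu, Real.sq_sqrt (by positivity), div_le_iff₀ hκ] at h3
  linarith

/-- Under the smallness conditions the composite state stays in the ball of radius `ζ`. -/
theorem ExcitedRun.norm_Z_lt (hn : 0 < n) (hS : S.Assumptions)
    (hr : S.ExcitedRun r t₀ c₃ Bsup) (hc₃ : 0 ≤ c₃) (hlow : 0 < Γlow) (hup : 0 < Γup)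
    (hBsup : 0 ≤ Bsup) (hM : 0 < lambdaMin (S.M c₃ Γlow Γup Bsup))
    (hb : r.GainBounds t₀ Γlow Γup) {η₁ η₂ : ℝ → ℝ} (hη₁ : ClassK η₁) (hη₂ : ClassK η₂)
    (hsand : S.Sandwich r t₀ η₁ η₂) {ζ : ℝ} (hζ : 0 < ζ)
    (hball : ∀ (x : E n) (wc wa : E L) (th : E p),
      stack x wc wa th ∈ Metric.closedBall 0 ζ → x ∈ S.χ)
    (hinit : η₂ ‖S.Z r t₀‖ < η₁ ζ) (hmu : η₂ (S.mu c₃ Γlow Γup Bsup) < η₁ ζ)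
    {t : ℝ} (ht : t₀ ≤ t) : ‖S.Z r t‖ < ζ := by
  have hχ : ∀ s, ‖S.Z r s‖ < ζ → r.x s ∈ S.χ := fun s hs =>
    hball _ _ _ _ (mem_closedBall_zero_iff.2 hs.le)
  -- Obtained by evaluating the two-sided bound at a vector of norm exactly `ζ`, which exists since
  -- `n > 0`.
  have hle : η₁ ζ ≤ η₂ ζ := by
    have hnorm : ‖stack (EuclideanSpace.single (⟨0, hn⟩ : Fin n) ζ) (0 : E L) (0 : E L)
        (0 : E p)‖ = ζ := by
      simp [norm_stack_eq_sqrt, Real.sqrt_sq_eq_abs, abs_of_pos hζ]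
    have hmem := hball _ _ _ _ (mem_closedBall_zero_iff.2 hnorm.le)
    have h := hsand t₀ le_rfl _ hmem 0 0 0
    rw [hnorm] at h
    exact h.1.trans h.2
  have hZ₀ : ‖S.Z r t₀‖ < ζ :=
    (hη₂.lt_iff (norm_nonneg _) hζ.le).1 (hinit.trans_le hle)
  by_contra! hcon
  set A : Set ℝ := {s | t₀ ≤ s ∧ ζ ≤ ‖S.Z r s‖} with hA
  have hne : A.Nonempty := ⟨t, ht, hcon⟩
  have hbdd : BddBelow A := ⟨t₀, fun s hs => hs.1⟩
  set s := sInf A with hs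
  have hts : t₀ ≤ s := le_csInf hne fun u hu => hu.1
  have hbefore : ∀ u ∈ Ico t₀ s, r.x u ∈ S.χ := fun u hu => hχ u <| by
    by_contra! h
    exact absurd (csInf_le hbdd ⟨hu.1, h⟩) (not_le.2 hu.2)
  -- Continuity of `Z` is available only where the state is in `χ`; at the exit time this follows by
  -- a limit from the left, as `χ` is closed. Then `V_L < η₁ ζ` at that time, so `‖Z‖ < ζ` persists
  -- slightly beyond, against the choice of the infimum.
  have hxs : r.x s ∈ S.χ := by
    rcases hts.eq_or_lt with h | h
    · rw [← h]; exact hχ _ hZ₀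
    · have hxc := hr.sol.x_cont s (mem_timeInterval_top.2 hts)
      have hmono : 𝓝[<] s ≤ 𝓝[timeInterval t₀ ⊤] s := by
        rw [← nhdsWithin_Ioo_eq_nhdsLT h]
        exact nhdsWithin_mono _ fun u hu => mem_timeInterval_top.2 hu.1.le
      refine hS.approx.compact.isClosed.mem_of_tendsto (hxc.mono_left hmono) ?_
      filter_upwards [Ioo_mem_nhdsLT h] with u hu using hbefore u ⟨hu.1.le, hu.2⟩
  have hI : ∀ u ∈ Icc t₀ s, r.x u ∈ S.χ := fun u hu => by
    rcases hu.2.eq_or_lt with h | h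
    · rw [h]; exact hxs
    · exact hbefore u ⟨hu.1, h⟩
  have hL := hr.lyap_le hn hS hc₃ hlow hup hBsup hM hb hη₂ hsand hts hI
  have hι := iota_pos (Γlow := Γlow) hS hc₃ hup hBsup
  have hL₀ : S.lyap r t₀ ≤ η₂ ‖S.Z r t₀‖ := (hsand t₀ le_rfl _ (hχ _ hZ₀) _ _ _).2
  have hLs : S.lyap r s < η₁ ζ := by
    refine hL.trans_lt (max_lt hmu ?_)
    have := mul_nonneg hι.le (sub_nonneg.2 hts)
    linarith
  have hZs : ‖S.Z r s‖ < ζ :=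
    (hη₁.lt_iff (norm_nonneg _) hζ.le).1 ((hsand s hts _ hxs _ _ _).1.trans_lt hLs)
  have hev := (hr.continuousWithinAt_norm_Z hS hts hxs).eventually_lt_const hZs
  obtain ⟨ε, hε, hεs⟩ := Metric.mem_nhdsWithin_iff.1 hev
  obtain ⟨u, huA, hu⟩ := exists_lt_of_csInf_lt hne (lt_add_of_pos_right s hε)
  have hsu : s ≤ u := csInf_le hbdd huA
  have : ‖S.Z r u‖ < ζ := hεs ⟨by
    rw [Metric.mem_ball, Real.dist_eq, abs_of_nonneg (sub_nonneg.2 hsu)]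
    linarith, huA.1⟩
  exact absurd huA.2 (not_le.2 this)

end AlongRun

/-- Once `V_L` is at most `η₂(√(2ι/κ)) = η₁(ρ)`, the lower comparison function gives `‖Z‖ ≤ ρ`. -/
theorem uniformlyUltimatelyBounded (hn : 0 < n) (hS : S.Assumptions)
    {c₃ Γlow Γup Bsup ζ ρ : ℝ} {η₁ η₂ : ℝ → ℝ} (hc₃ : 0 ≤ c₃) (hlow : 0 < Γlow) (hup : 0 < Γup)
    (hBsup : 0 ≤ Bsup) (hζ : 0 < ζ) (hη₁ : ClassK η₁) (hη₂ : ClassK η₂)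
    (hball : ∀ (x : E n) (wc wa : E L) (th : E p),
      stack x wc wa th ∈ Metric.closedBall 0 ζ → x ∈ S.χ)
    (hM : 0 < lambdaMin (S.M c₃ Γlow Γup Bsup)) (hρ : 0 ≤ ρ)
    (hηρ : η₁ ρ = η₂ (S.mu c₃ Γlow Γup Bsup)) :
    UniformlyUltimatelyBounded (S.compositeTrajectories c₃ Γlow Γup Bsup ζ η₁ η₂) ρ := by
  have hι := iota_pos (Γlow := Γlow) hS hc₃ hup hBsup
  intro a ha
  -- The time needed to fall from `η₂ a` to the final level at rate `ι`; the maximum with `0` covers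
  -- small `a`.
  refine ⟨max 0 ((η₂ a - η₂ (S.mu c₃ Γlow Γup Bsup)) / S.iota c₃ Γlow Γup Bsup),
    le_max_left _ _, ?_⟩
  rintro ⟨t₀, z⟩ ⟨r, hz, hr, hb, hsand, hstay⟩ hle t ht
  simp only at hz hr hb hsand hstay hle ht ⊢
  subst hz
  have hT := (le_max_left 0
    ((η₂ a - η₂ (S.mu c₃ Γlow Γup Bsup)) / S.iota c₃ Γlow Γup Bsup))
  have ht₀ : t₀ ≤ t := by linarith
  have hx : ∀ s ≥ t₀, r.x s ∈ S.χ := by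
    rcases hstay with h | ⟨h1, h2⟩
    · exact h
    · exact fun s hs => hball _ _ _ _ (mem_closedBall_zero_iff.2
        (hr.norm_Z_lt hn hS hc₃ hlow hup hBsup hM hb hη₁ hη₂ hsand hζ hball h1 h2 hs).le)
  have hL := hr.lyap_le hn hS hc₃ hlow hup hBsup hM hb hη₂ hsand ht₀ fun s hs => hx s hs.1
  have hL₀ : S.lyap r t₀ ≤ η₂ a :=
    (hsand t₀ le_rfl _ (hx t₀ le_rfl) _ _ _).2.trans
      ((hη₂.le_iff (norm_nonneg _) ha.le).2 hle)
  have hdec : η₂ a - η₂ (S.mu c₃ Γlow Γup Bsup) ≤ S.iota c₃ Γlow Γup Bsup * (t - t₀) := by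
    have h1 := le_max_right 0
      ((η₂ a - η₂ (S.mu c₃ Γlow Γup Bsup)) / S.iota c₃ Γlow Γup Bsup)
    have h2 : (η₂ a - η₂ (S.mu c₃ Γlow Γup Bsup)) / S.iota c₃ Γlow Γup Bsup ≤ t - t₀ := by
      linarith
    rw [div_le_iff₀ hι] at h2
    linarith
  have hLt : S.lyap r t ≤ η₁ ρ := by
    rw [hηρ]
    exact hL.trans (max_le le_rfl (by linarith))
  exact (hη₁.le_iff (norm_nonneg _) hρ).1 ((hsand t ht₀ _ (hx t ht₀) _ _ _).1.trans hLt)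

end Scheme

end SafeMBRL

theorem theorem2 {n m L p N : ℕ} (hn : 0 < n) (S : Scheme n m L p N) (hS : S.Assumptions) :
    -- forward invariance of the interior of the safe set
    S.ForwardInvariant ∧
    -- bounds on the gain and comparison functions for the Lyapunov function exist for every run
    (∀ (r : Run n L p) (t₀ c₃ Bsup : ℝ), S.ExcitedRun r t₀ c₃ Bsup →
      (∀ t ≥ t₀, r.x t ∈ interior S.safe) ∧
      (∃ Γlow > 0, ∃ Γup > 0, r.GainBounds t₀ Γlow Γup) ∧
      ∃ η₁ η₂ : ℝ → ℝ, ClassK η₁ ∧ ClassK η₂ ∧ S.Sandwich r t₀ η₁ η₂) ∧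
    -- uniform ultimate boundedness; `s` is `η₁⁻¹(η₂(ζ))` and `ρ` is `η₁⁻¹(η₂(√(2ι/κ)))`
    ∀ (c₃ Γlow Γup Bsup ζ s ρ : ℝ) (η₁ η₂ : ℝ → ℝ),
      0 ≤ c₃ → 0 < Γlow → 0 < Γup → 0 ≤ Bsup → 0 < ζ → ClassK η₁ → ClassK η₂ →
      (∀ (x : E n) (wc wa : E L) (th : E p),
        stack x wc wa th ∈ Metric.closedBall 0 ζ → x ∈ S.χ) →
      0 < lambdaMin (S.M c₃ Γlow Γup Bsup) →
      0 ≤ s → η₁ s = η₂ ζ → S.mu c₃ Γlow Γup Bsup < s →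
      0 ≤ ρ → η₁ ρ = η₂ (S.mu c₃ Γlow Γup Bsup) →
      UniformlyUltimatelyBounded (S.compositeTrajectories c₃ Γlow Γup Bsup ζ η₁ η₂) ρ ∧
      ∀ q ∈ S.compositeTrajectories c₃ Γlow Γup Bsup ζ η₁ η₂,
        limsup (fun t => ((‖q.2 t‖ : ℝ) : EReal)) atTop ≤ (ρ : EReal) := by
  refine ⟨Scheme.forwardInvariant hS, fun r t₀ c₃ Bsup hr => ?_, ?_⟩
  · obtain ⟨Γlow, hlow, Γup, hup, hb⟩ := hr.exists_gainBounds hS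
    exact ⟨fun t ht => hr.mem_interior hS ht, ⟨Γlow, hlow, Γup, hup, hb⟩,
      Scheme.exists_sandwich hS hr.t₀_nonneg hlow hup hb⟩
  · intro c₃ Γlow Γup Bsup ζ s ρ η₁ η₂ hc₃ hlow hup hBsup hζ hη₁ hη₂ hball hM _ _ _ hρ hηρ
    have huub := Scheme.uniformlyUltimatelyBounded hn hS hc₃ hlow hup hBsup hζ hη₁ hη₂ hball hM
      hρ hηρ
    refine ⟨huub, fun q hq => ?_⟩
    -- The maximum with `1` supplies the positive bound that uniform boundedness asks for, even if
    -- the initial state is zero.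
    obtain ⟨T, -, hT⟩ := huub (max 1 ‖q.2 q.1‖) (by positivity)
    refine limsup_le_of_le (by isBoundedDefault) ?_
    filter_upwards [eventually_ge_atTop (q.1 + T)] with t ht
    exact EReal.coe_le_coe_iff.2 (hT q hq (le_max_right _ _) t ht)
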